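/- Let $k\ge 1$, $n=2k+2\ge 4$, let $y\in\mathbb R^n$, $y\neq 0$, $a=|y|$, $\hat y=y/a$. For $x\in\mathbb R^n$ put $\gamma(x+iy)=\sqrt{|x|^2-a^2+2i\,x\cdot y}=p+iq$ with the branch $p\ge 0$, and let $$\phi(x+iy)=\frac{\gamma^{2-n}}{(2-n)\,\omega_n},\qquad \omega_n=\frac{2\pi^{n/2}}{\Gamma(n/2)},\qquad \phi_\varepsilon=\theta(p-\varepsilon)\,\phi\quad(\varepsilon>0),$$ where $\theta$ is the unit step function. Let $\tilde\delta_\varepsilon=\Delta\phi_\varepsilon$ in the sense of distributions in $x$, that is, $\langle\tilde\delta_\varepsilon,f\rangle=\int_{\mathbb R^n}\phi_\varepsilon\,\Delta f\,dx$ for compactly supported $f\in C^2(\mathbb R^n)$. Then there is exactly one linear functional $\tilde\delta$ on the space $C^k(\mathbb R^n)$ of complex-valued $C^k$ functions which is bounded (i.e. for some compact $K\subset\mathbb R^n$ and some $C$, $|\langle\tilde\delta,f\rangle|\le C\max_{j\le k}\sup_{K}|D^jf|$ for all $f$) and which satisfies $\langle\tilde\delta,f\rangle=\lim_{\varepsilon\to0^+}\langle\tilde\delta_\varepsilon,f\rangle$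 for every compactly supported $f$ that is both $C^k$ and $C^2$. For every $f\in C^k(\mathbb R^n)$ its action is given in cylindrical coordinates by $$\langle\tilde\delta,f\rangle=\frac{a\sqrt\pi}{\Gamma(k+\frac12)}\,D_\rho^kF(\rho)\Big|_{\rho=a},\qquad D_\rho=\frac{\partial}{\partial(\rho^2)}=\frac1{2\rho}\frac{\partial}{\partial\rho},$$ $$F(\rho)=\rho^{2k-1}\Big[\bar f(\rho,0)+i\,\frac{a^2-\rho^2}{2ka}\,\bar f_\zeta(\rho,0)\Big],\qquad \bar f(\rho,\zeta)=\int_{S^{n-2}}f(\rho\sigma+\zeta\hat y)\,d\sigma,$$ where $S^{n-2}$ is the unit sphere of the hyperplane orthogonal to $y$, $d\sigma$ is its normalized surface measure and $\bar f_\zeta=\partial\bar f/\partial\zeta$. Here $\bar f_\zeta(\rho,0)$ exists for all $\rho$, $F$ is $C^{k-1}$ near $\rho=a$, and $D_\rho^{k-1}F$ is differentiable at $\rho=a$, so that the right-hand side is defined. -/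

import Mathlib

open MeasureTheory Filter Topology
open scoped Laplacian

/-- `ℝⁿ` with its Euclidean norm. -/
abbrev RSpace (n : ℕ) : Type := EuclideanSpace ℝ (Fin n)

/-- The complex square `z · z = |x|² - |y|² + 2 i x · y` of `z = x + i y`. -/
noncomputable def complexSq {n : ℕ} (x y : RSpace n) : ℂ :=
  ((‖x‖ ^ 2 - ‖y‖ ^ 2 : ℝ) : ℂ) + 2 * ((inner ℝ x y : ℝ) : ℂ) * Complex.I

/-- The complex length `γ(x + i y) = √(z · z) = p + i q`, on the branch `p ≥ 0`. -/
noncomputable def complexLength {n : ℕ} (x y : RSpace n) : ℂ :=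
  complexSq x y ^ (1 / 2 : ℂ)

/-- The area `ω_n = 2 π^{n/2} / Γ(n/2)` of the unit sphere in `ℝⁿ`. -/
noncomputable def sphereArea (n : ℕ) : ℝ :=
  2 * Real.pi ^ ((n : ℝ) / 2) / Real.Gamma ((n : ℝ) / 2)

/-- The holomorphic potential `φ(x + i y) = γ^{2-n} / ((2 - n) ω_n)`. -/
noncomputable def holPotential {n : ℕ} (x y : RSpace n) : ℂ :=
  complexLength x y ^ (2 - (n : ℤ)) / ((2 - (n : ℂ)) * (sphereArea n : ℂ))

open Classical in
/-- The regularized potential `φ_ε = θ(p - ε) φ`, where `p = Re γ` and `θ` is the unit step. -/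
noncomputable def regPotential {n : ℕ} (y : RSpace n) (ε : ℝ) (x : RSpace n) : ℂ :=
  if ε < (complexLength x y).re then holPotential x y else 0

/-- The action `⟨Δφ_ε, f⟩ = ∫ φ_ε Δf` of the regularized source distribution
(the distributional Laplacian of `φ_ε`) on a test function `f`. -/
noncomputable def regSource {n : ℕ} (y : RSpace n) (ε : ℝ) (f : RSpace n → ℂ) : ℂ :=
  ∫ x, regPotential y ε x * (Δ f) x

/-- The complex vector space of `C^k` functions on `ℝⁿ`. -/
def CkFun (n k : ℕ) : Submodule ℂ (RSpace n → ℂ) where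
  carrier := {f | ContDiff ℝ (k : WithTop ℕ∞) f}
  add_mem' := fun {f g} (hf : ContDiff ℝ (k : WithTop ℕ∞) f)
    (hg : ContDiff ℝ (k : WithTop ℕ∞) g) => ContDiff.add hf hg
  zero_mem' := (contDiff_const : ContDiff ℝ (k : WithTop ℕ∞) (fun _ : RSpace n => (0 : ℂ)))
  smul_mem' := fun c f (hf : ContDiff ℝ (k : WithTop ℕ∞) f) => ContDiff.const_smul c hf

/-- Boundedness on `C^k(ℝⁿ)`: control by the derivatives of order at most `k` on some compact
set, i.e. continuity for the topology of uniform convergence on compact sets of all derivatives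
of order at most `k`. -/
def IsBoundedFunctional {n k : ℕ} (L : CkFun n k →ₗ[ℂ] ℂ) : Prop :=
  ∃ (K : Set (RSpace n)) (C : ℝ), IsCompact K ∧
    ∀ (f : CkFun n k) (M : ℝ), 0 ≤ M →
      (∀ j ≤ k, ∀ x ∈ K, ‖iteratedFDeriv ℝ j (f : RSpace n → ℂ) x‖ ≤ M) →
      ‖L f‖ ≤ C * M

/-- `L` is the singular source distribution of `φ(x + i y)` as a bounded linear functional on
`C^k(ℝⁿ)`: it is bounded and is the limit of the regularized sources as `ε → 0+` on every
compactly supported `C^k` function on which `∫ φ_ε Δf` is defined (i.e. `f` is also `C²`). -/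
def IsSourceDistribution {n k : ℕ} (y : RSpace n) (L : CkFun n k →ₗ[ℂ] ℂ) : Prop :=
  IsBoundedFunctional L ∧
    ∀ f : CkFun n k, ContDiff ℝ 2 (f : RSpace n → ℂ) → HasCompactSupport (f : RSpace n → ℂ) →
      Tendsto (fun ε : ℝ => regSource y ε (f : RSpace n → ℂ)) (𝓝[>] 0) (𝓝 (L f))

/-- The rotation-invariant surface measure on the unit sphere of the hyperplane orthogonal
to `y` (not normalized). -/
noncomputable def orthSphereMeasure {n : ℕ} (y : RSpace n) :
    Measure (Metric.sphere (0 : (Submodule.span ℝ {y})ᗮ) 1) :=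
  ((stdOrthonormalBasis ℝ (Submodule.span ℝ {y})ᗮ).toBasis.addHaar).toSphere

/-- The spherical mean `f̄(ρ, ζ)`: the average of `f(ρ σ + ζ ŷ)` over the unit sphere of the
hyperplane orthogonal to `y`, where `ŷ = y / |y|`. -/
noncomputable def sphMean {n : ℕ} (y : RSpace n) (f : RSpace n → ℂ) (ρ ζ : ℝ) : ℂ :=
  ⨍ σ, f (ρ • ((σ : (Submodule.span ℝ {y})ᗮ) : RSpace n) + ζ • (‖y‖⁻¹ • y))
    ∂(orthSphereMeasure y)

/-- The operator `D_ρ = ∂/∂(ρ²) = (2ρ)⁻¹ ∂/∂ρ`. -/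
noncomputable def Drho (g : ℝ → ℂ) (ρ : ℝ) : ℂ :=
  (1 / (2 * (ρ : ℂ))) * deriv g ρ

/-- `F(ρ) = ρ^{2k-1} [f̄(ρ,0) + i (a² - ρ²)/(2ka) f̄_ζ(ρ,0)]`, with `a = |y|`. -/
noncomputable def cylF {n : ℕ} (k : ℕ) (y : RSpace n) (f : RSpace n → ℂ) (ρ : ℝ) : ℂ :=
  (ρ : ℂ) ^ (2 * k - 1) *
    (sphMean y f ρ 0 +
      Complex.I * (((‖y‖ ^ 2 - ρ ^ 2) / (2 * (k : ℝ) * ‖y‖) : ℝ) : ℂ) *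
        deriv (fun ζ : ℝ => sphMean y f ρ ζ) 0)

/-! ### Smooth dependence of integrals over a compact parameter space -/

section ParametricIntegral

variable {Ω E F : Type*} [TopologicalSpace Ω] [CompactSpace Ω] [SecondCountableTopology Ω]
  [MeasurableSpace Ω] [OpensMeasurableSpace Ω]
  [NormedAddCommGroup E] [NormedSpace ℝ E] [ProperSpace E]
  [NormedAddCommGroup F] [NormedSpace ℝ F]

/-! Put s = ρ² and w = z·z = s + (ζ + ia)². As n = 2k+2 is even, γ^{2-n} = w^{-k} is single valued,
and it is harmonic off the ring s = a², ζ = 0, the zero set of w. So the source sits on the ring,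
and the question is the limit of a flux through the spheroid p = ε as it collapses onto the disc
spanned by the ring.

Averaging over S^{n-2} leaves a problem in (s, ζ). With u(s, ζ) = f̄(√s, ζ) and B = s^{k-1/2} u, the
weight being the volume density up to a constant, the Laplacian becomes the divergence 4∂ₛ(s∂ₛB -
(k-1/2)B) + ∂_ζ²B (`weightedMean_laplacian`). Green's formula outside the spheroid
(`integral_exterior_eq_integral_spheroid`) reduces the regularized source to integrals of γ^{-l} g
over the curve γ = ε + iq, |q| ≤ a, on which s = (a²+ε²)(1 - q²/a²) and ζ = εq/a.

Two facts govern these integrals: on the curve w = γ² cancels two powers of γ, and ζ = -(i/a)ε(γ -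
ε) gains powers of ε. Hadamard's lemma together with s - a² = w - ζ(ζ + 2ia) gives g = g(a²,0) + w
g₁ + ζ g₃, so each derivative of g pays for two powers of γ. Hence ε^m ∫ γ^{-l} g dq tends to 0 for
m ≥ 1, g of class C^r and l ≤ m+1+2r (`tendsto_pow_mul_spheroidIntegral`). At l = 1 the Poisson
kernel gives π, and by induction ∫ γ^{-(2i+1)} g dq tends to π ∂ₛⁱg(a²,0)/i!
(`tendsto_spheroidIntegral_odd`). Only the ζ-component of the flux survives
(`tendsto_integral_exterior`), and the limit is a√π/Γ(k+1/2) times ∂ₛᵏB - (i/2a) ∂ₛ^{k-1}∂_ζB at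
(a²,0), which is `sourceValue`.

This is the stated formula because D_ρ is d/ds and the k-th derivative of (s - a²)h at a² is k
h^{(k-1)}(a²), even when h is only C^{k-1} (`hasDerivAt_iteratedDeriv_sub_mul`,
`hasDerivAt_iteratedDeriv_cylFSq`).

B need not be smooth at s = 0, so f is first cut off near the axis. The discarded part lives away
from the ring and contributes nothing in the limit, by harmonicity (`tendsto_regSource_zero`).
Uniqueness is a density statement: mollification when k = 1, and a cutoff outside the compact set
controlling the functional (`IsBoundedFunctional.eq_zero`). -/

theorem integrable_of_continuous_compactSpace {G : Type*} [NormedAddCommGroup G]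
    {μ : Measure Ω} [IsFiniteMeasure μ] {g : Ω → G} (hg : Continuous g) : Integrable g μ := by
  obtain ⟨C, hC⟩ := isCompact_univ.exists_bound_of_continuousOn hg.continuousOn
  exact Integrable.of_bound hg.aestronglyMeasurable C (Eventually.of_forall fun x => hC x trivial)

omit [NormedSpace ℝ E] in
theorem continuous_integral_of_compactSpace {G : Type*} [NormedAddCommGroup G] [NormedSpace ℝ G]
    {μ : Measure Ω} [IsFiniteMeasure μ] {g : Ω → E → G}
    (hg : Continuous fun z : Ω × E => g z.1 z.2) : Continuous fun x => ∫ ω, g ω x ∂μ := by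
  have := continuous_parametric_integral_of_continuous (μ := μ) (f := fun x ω => g ω x)
    (hg.comp continuous_swap) (isCompact_univ (X := Ω))
  simpa using this

/-- Differentiation of an integral over a compact parameter space, to all orders. -/
theorem HasFTaylorSeriesUpTo.integral_compactSpace [CompleteSpace F]
    {μ : Measure Ω} [IsFiniteMeasure μ]
    {n : WithTop ℕ∞} {f : Ω → E → F} {p : Ω → E → FormalMultilinearSeries ℝ E F}
    (h : ∀ ω, HasFTaylorSeriesUpTo n (f ω) (p ω))
    (hp : ∀ m : ℕ, m ≤ n → Continuous fun z : Ω × E => p z.1 z.2 m) :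
    HasFTaylorSeriesUpTo n (fun x => ∫ ω, f ω x ∂μ) (fun x m => ∫ ω, p ω x m ∂μ) where
  zero_eq x := by
    have hint : Integrable (fun ω => p ω x 0) μ := integrable_of_continuous_compactSpace
      ((hp 0 (by simp)).comp (Continuous.prodMk_left x))
    have := (continuousMultilinearCurryFin0 ℝ E F).toContinuousLinearEquiv
      |>.toContinuousLinearMap.integral_comp_comm hint
    simp only [ContinuousLinearEquiv.coe_coe, LinearIsometryEquiv.coe_toContinuousLinearEquiv,
      continuousMultilinearCurryFin0_apply] at this
    rw [show (∫ ω, p ω x 0 ∂μ).curry0 = (∫ ω, p ω x 0 ∂μ) 0 from rfl]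
    rw [← this]
    exact integral_congr_ae (Eventually.of_forall fun ω => (h ω).zero_eq x)
  fderiv m hm x := by
    have hm' : ((m + 1 : ℕ) : WithTop ℕ∞) ≤ n := ENat.add_one_natCast_le_withTop_of_lt hm
    have hc := hp m hm.le
    have hc' := hp (m + 1) hm'
    obtain ⟨C, hC⟩ := (isCompact_univ.prod (isCompact_closedBall x 1)).exists_bound_of_continuousOn
      hc'.continuousOn
    have hint : Integrable (fun ω => p ω x (m + 1)) μ := integrable_of_continuous_compactSpace
      (hc'.comp (Continuous.prodMk_left x))
    let Φ : (E [×(m + 1)]→L[ℝ] F) →L[ℝ] (E →L[ℝ] E [×m]→L[ℝ] F) :=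
      (continuousMultilinearCurryLeftEquiv ℝ
        (fun _ : Fin (m + 1) => E) F).toContinuousLinearEquiv.toContinuousLinearMap
    have hcurry : AEStronglyMeasurable (fun ω => Φ (p ω x (m + 1))) μ :=
      Φ.continuous.comp_aestronglyMeasurable hint.aestronglyMeasurable
    have key := hasFDerivAt_integral_of_dominated_of_fderiv_le (μ := μ)
      (F := fun y ω => p ω y m) (F' := fun y ω => (p ω y (m + 1)).curryLeft) (x₀ := x)
      (bound := fun _ => C) (Metric.ball_mem_nhds x one_pos)
      (Eventually.of_forall fun y =>
        (hc.comp (Continuous.prodMk_left y)).aestronglyMeasurable)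
      (integrable_of_continuous_compactSpace (hc.comp (Continuous.prodMk_left x)))
      hcurry
      (Eventually.of_forall fun ω y hy => by
        have h1 := hC (ω, y) ⟨trivial, Metric.ball_subset_closedBall hy⟩
        rwa [← ContinuousMultilinearMap.curryLeft_norm] at h1)
      (integrable_const C)
      (Eventually.of_forall fun ω y _ => (h ω).fderiv m hm y)
    have h2 := ContinuousLinearMap.integral_comp_comm (𝕜 := ℝ)
      (Fₗ := E →L[ℝ] E [×m]→L[ℝ] F) Φ hint
    have h3 : ∫ ω, (p ω x (m + 1)).curryLeft ∂μ = (∫ ω, p ω x (m + 1) ∂μ).curryLeft := h2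
    rw [h3] at key
    exact key
  cont m hm := continuous_integral_of_compactSpace (hp m hm)

omit [CompactSpace Ω] [SecondCountableTopology Ω] [MeasurableSpace Ω] [OpensMeasurableSpace Ω]
  [ProperSpace E] in
theorem continuous_iteratedFDeriv_comp_clm {V : Type*}
    [NormedAddCommGroup V] [NormedSpace ℝ V] {r : ℕ} {f : V → F} (hf : ContDiff ℝ r f)
    {A : Ω → E →L[ℝ] V} (hA : Continuous A) {m : ℕ} (hm : (m : WithTop ℕ∞) ≤ r) :
    Continuous fun z : Ω × E =>
      (iteratedFDeriv ℝ m f (A z.1 z.2)).compContinuousLinearMap (fun _ => A z.1) := by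
  have h1 : Continuous fun z : Ω × E => iteratedFDeriv ℝ m f (A z.1 z.2) :=
    (hf.continuous_iteratedFDeriv hm).comp
      ((hA.comp continuous_fst).clm_apply continuous_snd)
  have h2 : Continuous fun z : Ω × E => ContinuousMultilinearMap.compContinuousLinearMapL
      (𝕜 := ℝ) (F := F) (fun _ : Fin m => A z.1) :=
    (ContinuousMultilinearMap.compContinuousLinearMapContinuousMultilinear ℝ
      (fun _ : Fin m => E) (fun _ : Fin m => V) F).cont.comp
      (continuous_pi fun _ => hA.comp continuous_fst)
  exact h2.clm_apply h1

/-- The Taylor series of `x ↦ ∫ f (A ω x) dμ(ω)` for a continuous family of linear maps `A`. -/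
theorem hasFTaylorSeriesUpTo_integral_comp_clm [CompleteSpace F] {V : Type*}
    [NormedAddCommGroup V] [NormedSpace ℝ V]
    (μ : Measure Ω) [IsFiniteMeasure μ] {r : ℕ} {f : V → F} (hf : ContDiff ℝ r f)
    {A : Ω → E →L[ℝ] V} (hA : Continuous A) :
    HasFTaylorSeriesUpTo r (fun x => ∫ ω, f (A ω x) ∂μ)
      (fun x m =>
        ∫ ω, (iteratedFDeriv ℝ m f (A ω x)).compContinuousLinearMap (fun _ => A ω) ∂μ) := by
  refine HasFTaylorSeriesUpTo.integral_compactSpace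
    (p := fun ω x m => (iteratedFDeriv ℝ m f (A ω x)).compContinuousLinearMap (fun _ => A ω))
    (fun ω => ?_) fun m hm => ?_
  · have h1 : HasFTaylorSeriesUpTo (r : WithTop ℕ∞) f (ftaylorSeries ℝ f) :=
      (contDiff_iff_ftaylorSeries).1 hf
    have h2 := (hasFTaylorSeriesUpToOn_univ_iff.2 h1).compContinuousLinearMap (A ω)
    exact hasFTaylorSeriesUpToOn_univ_iff.1 h2
  · exact continuous_iteratedFDeriv_comp_clm hf hA hm

theorem contDiff_integral_comp_clm [CompleteSpace F] {V : Type*}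
    [NormedAddCommGroup V] [NormedSpace ℝ V]
    (μ : Measure Ω) [IsFiniteMeasure μ] {r : ℕ} {f : V → F} (hf : ContDiff ℝ r f)
    {A : Ω → E →L[ℝ] V} (hA : Continuous A) :
    ContDiff ℝ r (fun x => ∫ ω, f (A ω x) ∂μ) := by
  have := hasFTaylorSeriesUpTo_integral_comp_clm μ hf hA
  exact this.contDiff

theorem norm_iteratedFDeriv_integral_comp_clm_le [CompleteSpace F] {V : Type*}
    [NormedAddCommGroup V] [NormedSpace ℝ V]
    (μ : Measure Ω) [IsFiniteMeasure μ] {r : ℕ} {f : V → F} (hf : ContDiff ℝ r f)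
    {A : Ω → E →L[ℝ] V} (hA : Continuous A) {m : ℕ} (hm : m ≤ r) (x : E) {C M : ℝ}
    (hC : ∀ ω, ‖A ω‖ ≤ C)
    (hM : ∀ ω, ‖iteratedFDeriv ℝ m f (A ω x)‖ ≤ M) :
    ‖iteratedFDeriv ℝ m (fun x => ∫ ω, f (A ω x) ∂μ) x‖ ≤ M * C ^ m * μ.real Set.univ := by
  have := (hasFTaylorSeriesUpTo_integral_comp_clm μ hf hA).eq_iteratedFDeriv
    (m := m) (by exact_mod_cast hm) x
  rw [← this]
  refine norm_integral_le_of_norm_le_const (Eventually.of_forall fun ω => ?_)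
  refine (ContinuousMultilinearMap.norm_compContinuousLinearMap_le _ _).trans ?_
  simp only [Finset.prod_const, Finset.card_univ, Fintype.card_fin]
  have h0 := norm_nonneg (A ω)
  have h1 := (norm_nonneg _).trans (hM ω)
  gcongr
  · exact hM ω
  · exact hC ω

theorem fderiv_integral_comp_clm_apply [CompleteSpace F] {V : Type*}
    [NormedAddCommGroup V] [NormedSpace ℝ V]
    (μ : Measure Ω) [IsFiniteMeasure μ] {f : V → F} (hf : ContDiff ℝ 1 f)
    {A : Ω → E →L[ℝ] V} (hA : Continuous A) (x v : E) :
    fderiv ℝ (fun x => ∫ ω, f (A ω x) ∂μ) x v = ∫ ω, fderiv ℝ f (A ω x) (A ω v) ∂μ := by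
  have hs := hasFTaylorSeriesUpTo_integral_comp_clm (r := 1) μ (by exact_mod_cast hf) hA
  have h1 := hs.eq_iteratedFDeriv (m := 1) (by simp) x
  have h2 := congrArg (fun T => T (fun _ => v)) h1
  simp only [iteratedFDeriv_one_apply] at h2
  rw [← h2, ContinuousMultilinearMap.integral_apply]
  · simp [iteratedFDeriv_one_apply]
  · exact integrable_of_continuous_compactSpace
      ((continuous_iteratedFDeriv_comp_clm (r := 1) hf hA le_rfl).comp (Continuous.prodMk_left x))

end ParametricIntegral

/-! ### Hadamard's lemma with control of regularity -/

section Hadamard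

/-- Hadamard's lemma along the segment from `P x` to `x = P x + Q x`. -/
theorem exists_contDiff_eq_add_apply {E F : Type*} [NormedAddCommGroup E] [NormedSpace ℝ E]
    [ProperSpace E] [NormedAddCommGroup F] [NormedSpace ℝ F] [CompleteSpace F]
    {r : ℕ} {g : E → F} (hg : ContDiff ℝ (r + 1 : ℕ) g) (P Q : E →L[ℝ] E)
    (hPQ : ∀ x, P x + Q x = x) :
    ∃ G : E → E →L[ℝ] F, ContDiff ℝ r G ∧ ∀ x, g x = g (P x) + G x (Q x) := by
  have hg1 : ContDiff ℝ 1 g := hg.of_le (by norm_cast; omega)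
  have hd : ContDiff ℝ r (fderiv ℝ g) := hg.fderiv_right (by norm_cast)
  -- The path P x + t Q x runs from P x to x. G is the mean of g' along it, so only one derivative
  -- is lost.
  have hA : Continuous fun t : unitInterval => P + (t : ℝ) • Q := by fun_prop
  refine ⟨fun x => ∫ t : unitInterval, fderiv ℝ g ((P + (t : ℝ) • Q) x),
    contDiff_integral_comp_clm _ hd hA, fun x => ?_⟩
  have hint : Integrable (fun t : unitInterval => fderiv ℝ g ((P + (t : ℝ) • Q) x)) :=
    integrable_of_continuous_compactSpace (hd.continuous.comp (hA.clm_apply continuous_const))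
  rw [ContinuousLinearMap.integral_apply hint]
  have hder : ∀ t : ℝ, HasDerivAt (fun t : ℝ => g ((P + t • Q) x))
      (fderiv ℝ g ((P + t • Q) x) (Q x)) t := fun t => by
    have h1 : HasDerivAt (fun t : ℝ => (P + t • Q) x) (Q x) t := by
      have := ((hasDerivAt_id t).smul_const (Q x)).const_add (P x)
      simpa using this
    exact ((hg1.differentiable one_ne_zero _).hasFDerivAt).comp_hasDerivAt t h1
  have hcont : Continuous fun t : ℝ => fderiv ℝ g ((P + t • Q) x) (Q x) := by
    refine (hd.continuous.comp ?_).clm_apply continuous_const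
    fun_prop
  have h2 := intervalIntegral.integral_eq_sub_of_hasDerivAt (a := 0) (b := 1)
    (fun t _ => hder t) (hcont.intervalIntegrable _ _)
  have h3 : ∫ t : unitInterval, fderiv ℝ g ((P + (t : ℝ) • Q) x) (Q x)
      = ∫ t in (0 : ℝ)..1, fderiv ℝ g ((P + t • Q) x) (Q x) := by
    rw [intervalIntegral.integral_of_le zero_le_one, ← integral_Icc_eq_integral_Ioc]
    exact integral_subtype measurableSet_Icc
      (fun t : ℝ => fderiv ℝ g ((P + t • Q) x) (Q x))
  rw [h3, h2]
  simp [hPQ]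

theorem exists_contDiff_eq_add_apply_sub {E F : Type*} [NormedAddCommGroup E] [NormedSpace ℝ E]
    [ProperSpace E] [NormedAddCommGroup F] [NormedSpace ℝ F] [CompleteSpace F]
    {r : ℕ} {g : E → F} (hg : ContDiff ℝ (r + 1 : ℕ) g) (x₀ : E) :
    ∃ G : E → E →L[ℝ] F, ContDiff ℝ r G ∧ ∀ x, g x = g x₀ + G x (x - x₀) := by
  obtain ⟨G, hG, h⟩ := exists_contDiff_eq_add_apply (g := fun x => g (x + x₀))
    (hg.comp (contDiff_id.add contDiff_const)) 0 (ContinuousLinearMap.id ℝ E) (by simp)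
  exact ⟨fun x => G (x - x₀), hG.comp (contDiff_id.sub contDiff_const), fun x => by
    simpa using h (x - x₀)⟩

theorem exists_contDiff_eq_add_sub_mul {r : ℕ} {h : ℝ → ℂ} (hh : ContDiff ℝ (r + 1 : ℕ) h)
    (c : ℝ) : ∃ h₁ : ℝ → ℂ, ContDiff ℝ r h₁ ∧ ∀ s, h s = h c + ((s - c : ℝ) : ℂ) * h₁ s := by
  obtain ⟨G, hG, h⟩ := exists_contDiff_eq_add_apply_sub hh c
  refine ⟨fun s => G s 1, hG.clm_apply contDiff_const, fun s => ?_⟩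
  rw [h s, show G s (s - c) = G s ((s - c) • (1 : ℝ)) by simp, map_smul, Complex.real_smul]

theorem exists_contDiff_eq_add_mul_add_mul {r : ℕ} {g : ℝ × ℝ → ℂ}
    (hg : ContDiff ℝ (r + 1 : ℕ) g) (c : ℝ) :
    ∃ g₁ g₂ : ℝ × ℝ → ℂ, ContDiff ℝ r g₁ ∧ ContDiff ℝ r g₂ ∧
      ∀ x, g x = g (c, 0) + ((x.1 - c : ℝ) : ℂ) * g₁ x + (x.2 : ℂ) * g₂ x := by
  obtain ⟨G, hG, h⟩ := exists_contDiff_eq_add_apply_sub hg (c, 0)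
  refine ⟨fun x => G x (1, 0), fun x => G x (0, 1), hG.clm_apply contDiff_const,
    hG.clm_apply contDiff_const, fun x => ?_⟩
  rw [h x, show x - (c, 0) = (x.1 - c) • ((1, 0) : ℝ × ℝ) + x.2 • ((0, 1) : ℝ × ℝ) by
    ext <;> simp, map_add, map_smul, map_smul, Complex.real_smul, Complex.real_smul, add_assoc]

theorem exists_contDiff_eq_add_snd_mul {r : ℕ} {g : ℝ × ℝ → ℂ}
    (hg : ContDiff ℝ (r + 1 : ℕ) g) :
    ∃ g₁ : ℝ × ℝ → ℂ, ContDiff ℝ r g₁ ∧ ∀ x, g x = g (x.1, 0) + (x.2 : ℂ) * g₁ x := by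
  obtain ⟨G, hG, h⟩ := exists_contDiff_eq_add_apply hg
    ((ContinuousLinearMap.fst ℝ ℝ ℝ).prod 0) (ContinuousLinearMap.prod 0
      (ContinuousLinearMap.snd ℝ ℝ ℝ)) (fun x => by ext <;> simp)
  refine ⟨fun x => G x (0, 1), hG.clm_apply contDiff_const, fun x => ?_⟩
  have h1 : (ContinuousLinearMap.prod 0 (ContinuousLinearMap.snd ℝ ℝ ℝ)) x
      = x.2 • ((0, 1) : ℝ × ℝ) := by ext <;> simp
  rw [h x, h1, map_smul, Complex.real_smul]
  simp

end Hadamard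

/-! ### Derivatives of (s - c) h(s) at c -/

section SubMul

theorem ContDiffAt.contDiffAt_iteratedDeriv {h : ℝ → ℂ} {c : ℝ} {j m : ℕ}
    (hh : ContDiffAt ℝ (j + m : ℕ) h c) : ContDiffAt ℝ j (iteratedDeriv m h) c := by
  have h1 : ContDiffAt ℝ j (iteratedFDeriv ℝ m h) c := hh.iteratedFDeriv_right (by norm_cast)
  have h2 := (ContinuousMultilinearMap.apply ℝ (fun _ : Fin m => ℝ) ℂ
    (fun _ => 1)).contDiff.contDiffAt.comp c h1
  exact h2

theorem ContDiffAt.eventually_hasDerivAt_iteratedDeriv {h : ℝ → ℂ} {c : ℝ} {m : ℕ}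
    (hh : ContDiffAt ℝ (m + 1 : ℕ) h c) :
    ∀ᶠ s in 𝓝 c, HasDerivAt (iteratedDeriv m h) (iteratedDeriv (m + 1) h s) s := by
  filter_upwards [hh.eventually (by simp)] with s hs
  rw [iteratedDeriv_succ]
  have : ContDiffAt ℝ (1 : ℕ) (iteratedDeriv m h) s :=
    ContDiffAt.contDiffAt_iteratedDeriv (by rwa [add_comm])
  exact (this.differentiableAt (by simp)).hasDerivAt

/-- Leibniz's rule for a linear factor. For m = 0 the truncated index m - 1 is harmless, its
coefficient being 0. -/
theorem eventually_iteratedDeriv_sub_mul {c : ℝ} (m : ℕ) {h : ℝ → ℂ}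
    (hh : ContDiffAt ℝ m h c) : ∀ᶠ s in 𝓝 c,
      iteratedDeriv m (fun s : ℝ => ((s - c : ℝ) : ℂ) * h s) s
        = ((s - c : ℝ) : ℂ) * iteratedDeriv m h s + m * iteratedDeriv (m - 1) h s := by
  induction m with
  | zero => simp
  | succ m ih =>
    have h1 := ih (hh.of_le (by norm_cast; omega))
    have h2 := hh.eventually_hasDerivAt_iteratedDeriv
    have h3 : ∀ᶠ s in 𝓝 c, HasDerivAt (fun s => (m : ℂ) * iteratedDeriv (m - 1) h s)
        ((m : ℂ) * iteratedDeriv m h s) s := by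
      rcases m with - | m
      · simp [hasDerivAt_const]
      · have := (hh.of_le (m := (m + 1 : ℕ)) (by norm_cast; omega)).eventually_hasDerivAt_iteratedDeriv
        filter_upwards [this] with s hs
        exact hs.const_mul _
    filter_upwards [h1.eventually_nhds, h2, h3] with s hs1 hs2 hs3
    rw [iteratedDeriv_succ, EventuallyEq.deriv_eq hs1]
    have h4 : HasDerivAt (fun s : ℝ => ((s - c : ℝ) : ℂ)) 1 s := by
      simpa using ((hasDerivAt_id s).sub_const c).ofReal_comp
    refine (((h4.mul hs2).add hs3).deriv).trans ?_
    push_cast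
    ring

/-- The difference quotient at c is φ itself, so no differentiability of φ is needed. This is the
source of the extra derivative of F at ρ = a. -/
theorem hasDerivAt_sub_mul_of_continuousAt {c : ℝ} {φ : ℝ → ℂ} (hφ : ContinuousAt φ c) :
    HasDerivAt (fun s : ℝ => ((s - c : ℝ) : ℂ) * φ s) (φ c) c := by
  rw [hasDerivAt_iff_tendsto_slope]
  refine (hφ.tendsto.mono_left nhdsWithin_le_nhds).congr' ?_
  filter_upwards [self_mem_nhdsWithin] with s hs
  have : ((s - c : ℝ) : ℂ) ≠ 0 := by
    exact_mod_cast sub_ne_zero.2 hs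
  simp only [slope, vsub_eq_sub, sub_self, Complex.ofReal_zero, zero_mul, sub_zero]
  rw [Complex.real_smul, Complex.ofReal_inv, inv_mul_cancel_left₀ this]

/-- The `(m+1)`-st derivative at `c` of `(s - c) h(s)`, for `h` only `m` times differentiable. -/
theorem hasDerivAt_iteratedDeriv_sub_mul {c : ℝ} {m : ℕ} {h : ℝ → ℂ} (hh : ContDiffAt ℝ m h c) :
    HasDerivAt (iteratedDeriv m (fun s : ℝ => ((s - c : ℝ) : ℂ) * h s))
      ((m + 1) * iteratedDeriv m h c) c := by
  have h1 := eventually_iteratedDeriv_sub_mul m hh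
  refine HasDerivAt.congr_of_eventuallyEq ?_ h1
  have hcont : ContinuousAt (iteratedDeriv m h) c := by
    have : ContDiffAt ℝ (0 : ℕ) (iteratedDeriv m h) c :=
      ContDiffAt.contDiffAt_iteratedDeriv (by rwa [zero_add])
    exact this.continuousAt
  have h3 : HasDerivAt (fun s => (m : ℂ) * iteratedDeriv (m - 1) h s)
      ((m : ℂ) * iteratedDeriv m h c) c := by
    rcases m with - | m
    · simp [hasDerivAt_const]
    · exact hh.eventually_hasDerivAt_iteratedDeriv.self_of_nhds.const_mul _
  rw [add_mul, one_mul, add_comm]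
  exact (hasDerivAt_sub_mul_of_continuousAt hcont).add h3

end SubMul

/-! ### The spheroid p = ε and the Poisson kernel -/

section CurveLimits

/-- `(s, ζ)`-coordinates, with `s = ρ²`, of the point of the spheroid `p = ε` with `Im γ = q`. -/
noncomputable def spheroidPoint (a ε q : ℝ) : ℝ × ℝ :=
  ((a ^ 2 + ε ^ 2) * (1 - q ^ 2 / a ^ 2), ε * q / a)

@[fun_prop]
theorem continuous_spheroidPoint (a : ℝ) :
    Continuous fun x : ℝ × ℝ => spheroidPoint a x.1 x.2 := by
  unfold spheroidPoint
  fun_prop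

theorem spheroidPoint_zero_zero (a : ℝ) : spheroidPoint a 0 0 = (a ^ 2, 0) := by
  simp [spheroidPoint]

/-- The complex square in the coordinates `(s, ζ)`. -/
noncomputable def cylSq (a : ℝ) (x : ℝ × ℝ) : ℂ := x.1 + (x.2 + a * Complex.I) ^ 2

/-- Separating real and imaginary parts of w = (p + iq)² gives aζ = pq and s + ζ² - a² = p² - q²;
`spheroidPoint` solves these for p = ε. -/
theorem cylSq_spheroidPoint {a : ℝ} (ha : a ≠ 0) (ε q : ℝ) :
    cylSq a (spheroidPoint a ε q) = (ε + q * Complex.I) ^ 2 := by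
  have ha' : (a : ℂ) ≠ 0 := by exact_mod_cast ha
  simp only [cylSq, spheroidPoint]
  push_cast
  field_simp
  ring_nf
  simp only [Complex.I_sq]
  ring

theorem eps_add_mul_I_ne_zero {ε : ℝ} (hε : 0 < ε) (q : ℝ) : (ε + q * Complex.I : ℂ) ≠ 0 := by
  intro h
  have := congrArg Complex.re h
  simp at this
  exact hε.ne' this

theorem norm_eps_add_mul_I_sq (ε q : ℝ) : ‖(ε + q * Complex.I : ℂ)‖ ^ 2 = ε ^ 2 + q ^ 2 := by
  rw [← Complex.normSq_eq_norm_sq, Complex.normSq_add_mul_I]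

theorem le_norm_eps_add_mul_I (ε q : ℝ) :
    ε ≤ ‖(ε + q * Complex.I : ℂ)‖ := by
  have := Complex.abs_re_le_norm (ε + q * Complex.I : ℂ)
  simp at this
  exact (le_abs_self ε).trans this

theorem continuous_inv_eps_add_mul_I_pow {ε : ℝ} (hε : 0 < ε) (l : ℕ) :
    Continuous fun q : ℝ => ((ε + q * Complex.I : ℂ) ^ l)⁻¹ :=
  Continuous.inv₀ (by fun_prop) fun q => pow_ne_zero _ (eps_add_mul_I_ne_zero hε q)

/-- The Poisson kernel of the half plane is an approximate identity. -/
theorem tendsto_integral_poissonKernel_mul {H : ℝ × ℝ → ℂ} (hH : Continuous H) {a : ℝ}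
    (ha : 0 < a) :
    Tendsto (fun ε : ℝ => ∫ q in -a..a, ((ε / (ε ^ 2 + q ^ 2) : ℝ) : ℂ) * H (ε, q)) (𝓝[>] 0)
      (𝓝 (Real.pi * H (0, 0))) := by
  obtain ⟨C, hC⟩ := ((isCompact_Icc (a := (0 : ℝ)) (b := 1)).prod
    (isCompact_Icc (a := -a) (b := a))).exists_bound_of_continuousOn hH.continuousOn
  have hC0 : 0 ≤ C := (norm_nonneg _).trans (hC (0, 0) ⟨by simp, by simp [ha.le]⟩)
  -- The substitution q = εt turns the kernel into 1/(1+t²), of total mass π. The growing interval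
  -- is encoded by an indicator so that dominated convergence applies on the whole line.
  have key : Tendsto (fun ε : ℝ => ∫ t : ℝ, (Set.Ioc (-(a / ε)) (a / ε)).indicator
      (fun t => (((1 + t ^ 2)⁻¹ : ℝ) : ℂ) * H (ε, ε * t)) t) (𝓝[>] 0)
      (𝓝 (∫ t : ℝ, (((1 + t ^ 2)⁻¹ : ℝ) : ℂ) * H (0, 0))) := by
    refine tendsto_integral_filter_of_dominated_convergence (fun t => (1 + t ^ 2)⁻¹ * C) ?_ ?_ ?_ ?_
    · refine Eventually.of_forall fun ε => AEStronglyMeasurable.indicator ?_ measurableSet_Ioc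
      refine Continuous.aestronglyMeasurable ?_
      refine Continuous.mul (Complex.continuous_ofReal.comp (Continuous.inv₀ (by fun_prop) ?_))
        (by fun_prop)
      intro t; positivity
    · filter_upwards [Ioo_mem_nhdsGT (zero_lt_one' ℝ)] with ε hε
      refine Eventually.of_forall fun t => ?_
      by_cases ht : t ∈ Set.Ioc (-(a / ε)) (a / ε)
      · rw [Set.indicator_of_mem ht, norm_mul, Complex.norm_real, Real.norm_eq_abs,
          abs_of_nonneg (by positivity)]
        gcongr
        refine hC _ ⟨⟨hε.1.le, hε.2.le⟩, ?_, ?_⟩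
        · have := ht.1.le
          rw [neg_le, le_div_iff₀ hε.1] at this
          change -a ≤ ε * t
          linarith
        · have := ht.2
          rw [le_div_iff₀ hε.1] at this
          change ε * t ≤ a
          linarith
      · rw [Set.indicator_of_notMem ht, norm_zero]
        positivity
    · exact (integrable_inv_one_add_sq).mul_const C
    · refine Eventually.of_forall fun t => ?_
      have h1 : Tendsto (fun ε : ℝ => (((1 + t ^ 2)⁻¹ : ℝ) : ℂ) * H (ε, ε * t)) (𝓝[>] 0)
          (𝓝 ((((1 + t ^ 2)⁻¹ : ℝ) : ℂ) * H (0, 0))) := by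
        have : Continuous fun ε : ℝ => (((1 + t ^ 2)⁻¹ : ℝ) : ℂ) * H (ε, ε * t) := by fun_prop
        have := this.tendsto 0
        simp only [zero_mul] at this
        exact this.mono_left nhdsWithin_le_nhds
      refine h1.congr' ?_
      have h2 : Tendsto (fun ε : ℝ => a / ε) (𝓝[>] 0) atTop :=
        tendsto_inv_nhdsGT_zero.const_mul_atTop ha
      filter_upwards [h2.eventually (eventually_gt_atTop |t|)] with ε hε
      rw [Set.indicator_of_mem]
      rw [abs_lt] at hε
      exact ⟨hε.1, hε.2.le⟩
  have hpi : ∫ t : ℝ, (((1 + t ^ 2)⁻¹ : ℝ) : ℂ) * H (0, 0) = Real.pi * H (0, 0) := by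
    rw [integral_mul_const, integral_complex_ofReal, integral_univ_inv_one_add_sq]
  rw [hpi] at key
  refine key.congr' ?_
  filter_upwards [self_mem_nhdsWithin] with ε hε
  have hε : 0 < ε := hε
  rw [integral_indicator measurableSet_Ioc, ← intervalIntegral.integral_of_le
    (by have := div_pos ha hε; linarith)]
  have h3 := intervalIntegral.smul_integral_comp_mul_left (a := -(a / ε)) (b := a / ε)
    (fun q : ℝ => ((ε / (ε ^ 2 + q ^ 2) : ℝ) : ℂ) * H (ε, q)) ε
  rw [mul_neg, mul_div_cancel₀ _ hε.ne'] at h3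
  rw [← h3, ← intervalIntegral.integral_smul]
  refine intervalIntegral.integral_congr fun t _ => ?_
  simp only [Complex.real_smul, ← mul_assoc, ← Complex.ofReal_mul]
  congr 2
  have : 1 + t ^ 2 ≠ 0 := by positivity
  field_simp

end CurveLimits

/-! ### Negligible curve integrals -/

section CurveLimits

/-- The weighted curve integral `∫ (ε + iq)^{-l} g dq` over the part `|q| ≤ a` of the spheroid. -/
noncomputable def spheroidIntegral (a : ℝ) (l : ℕ) (g : ℝ × ℝ → ℂ) (ε : ℝ) : ℂ :=
  ∫ q in -a..a, ((ε + q * Complex.I : ℂ) ^ l)⁻¹ * g (spheroidPoint a ε q)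

theorem intervalIntegrable_curveIntegrand {a ε : ℝ} (hε : 0 < ε) (l : ℕ) {g : ℝ × ℝ → ℂ}
    (hg : Continuous g) : IntervalIntegrable (fun q : ℝ => ((ε + q * Complex.I : ℂ) ^ l)⁻¹ *
      g (spheroidPoint a ε q)) volume (-a) a :=
  ((continuous_inv_eps_add_mul_I_pow hε l).mul (hg.comp ((continuous_spheroidPoint a).comp
    (Continuous.prodMk_right ε)))).intervalIntegrable _ _

theorem inv_eps_add_mul_I_pow_eq {ε : ℝ} (hε : 0 < ε) (q : ℝ) :
    (ε + q * Complex.I : ℂ)⁻¹ = ((1 / (ε ^ 2 + q ^ 2) : ℝ) : ℂ) * (ε - q * Complex.I) := by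
  have h1 : ((ε ^ 2 + q ^ 2 : ℝ) : ℂ) ≠ 0 := by
    have : ε ^ 2 + q ^ 2 ≠ 0 := by positivity
    exact_mod_cast this
  refine inv_eq_of_mul_eq_one_right ?_
  push_cast at h1 ⊢
  field_simp
  ring_nf
  simp only [Complex.I_sq]
  ring

/-- The integral of `(ε + iq)^{-l-2}`. -/
theorem integral_inv_eps_add_mul_I_pow {a ε : ℝ} (hε : 0 < ε) (l : ℕ) :
    ∫ q in -a..a, ((ε + q * Complex.I : ℂ) ^ (l + 2))⁻¹ =
      Complex.I / (l + 1) * (((ε + a * Complex.I : ℂ) ^ (l + 1))⁻¹ -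
        ((ε - a * Complex.I : ℂ) ^ (l + 1))⁻¹) := by
  have hder : ∀ q : ℝ, HasDerivAt (fun q : ℝ =>
      Complex.I / (l + 1) * ((ε + q * Complex.I : ℂ) ^ (l + 1))⁻¹)
      ((ε + q * Complex.I : ℂ) ^ (l + 2))⁻¹ q := fun q => by
    have hne := eps_add_mul_I_ne_zero hε q
    have h1 : HasDerivAt (fun q : ℝ => (ε + q * Complex.I : ℂ)) Complex.I q := by
      simpa using ((hasDerivAt_id q).ofReal_comp.mul_const Complex.I).const_add (ε : ℂ)
    have h2 := ((h1.pow (l + 1)).inv (pow_ne_zero _ hne)).const_mul (Complex.I / (l + 1))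
    refine h2.congr_deriv ?_
    have hl : (l + 1 : ℂ) ≠ 0 := by exact_mod_cast Nat.succ_ne_zero l
    simp only [Nat.add_sub_cancel]
    simp only [Pi.pow_apply]
    have e1 : ((ε + q * Complex.I : ℂ) ^ (l + 1)) ^ 2
        = (ε + q * Complex.I : ℂ) ^ (l + 2) * (ε + q * Complex.I : ℂ) ^ l := by ring
    have hp := pow_ne_zero l hne
    have hp2 := pow_ne_zero (l + 2) hne
    rw [e1]
    push_cast
    generalize (ε + q * Complex.I : ℂ) = Z at *
    field_simp
    rw [Complex.I_sq]
    ring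
  rw [intervalIntegral.integral_eq_sub_of_hasDerivAt (fun q _ => hder q)
    ((continuous_inv_eps_add_mul_I_pow hε _).intervalIntegrable _ _)]
  push_cast
  ring

theorem tendsto_eps_add_nhds (c : ℂ) : Tendsto (fun ε : ℝ => (ε : ℂ) + c) (𝓝[>] 0) (𝓝 c) := by
  have : Continuous fun ε : ℝ => (ε : ℂ) + c := by fun_prop
  have := this.tendsto 0
  simp only [Complex.ofReal_zero, zero_add] at this
  exact this.mono_left nhdsWithin_le_nhds

/-- The antiderivative only sees the endpoints ε ± ia, which stay away from 0, so the limit is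
finite although the integrand blows up at q = 0. -/
theorem tendsto_integral_inv_eps_add_mul_I_pow {a : ℝ} (ha : 0 < a) (l : ℕ) :
    Tendsto (fun ε : ℝ => ∫ q in -a..a, ((ε + q * Complex.I : ℂ) ^ (l + 2))⁻¹) (𝓝[>] 0)
      (𝓝 (Complex.I / (l + 1) * (((a * Complex.I : ℂ) ^ (l + 1))⁻¹ -
        ((-(a * Complex.I) : ℂ) ^ (l + 1))⁻¹))) := by
  have ha' : (a * Complex.I : ℂ) ≠ 0 := mul_ne_zero (by exact_mod_cast ha.ne') Complex.I_ne_zero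
  have h1 := ((tendsto_eps_add_nhds (a * Complex.I)).pow (l + 1)).inv₀ (pow_ne_zero _ ha')
  have h2 := ((tendsto_eps_add_nhds (-(a * Complex.I))).pow (l + 1)).inv₀
    (pow_ne_zero _ (neg_ne_zero.2 ha'))
  refine ((h1.sub h2).const_mul (Complex.I / (l + 1))).congr' ?_
  filter_upwards [self_mem_nhdsWithin] with ε hε
  rw [integral_inv_eps_add_mul_I_pow hε]
  rfl

theorem tendsto_ofReal_pow_nhdsGT {m : ℕ} (hm : 1 ≤ m) :
    Tendsto (fun ε : ℝ => (ε : ℂ) ^ m) (𝓝[>] 0) (𝓝 0) := by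
  have := (tendsto_eps_add_nhds 0).pow m
  simpa [show m ≠ 0 by omega] using this

theorem tendsto_pow_mul_spheroidIntegral_const {a : ℝ} (ha : 0 < a) {m : ℕ} (hm : 1 ≤ m) (l : ℕ)
    (c : ℂ) :
    Tendsto (fun ε : ℝ => (ε : ℂ) ^ m * spheroidIntegral a (l + 2) (fun _ => c) ε) (𝓝[>] 0)
      (𝓝 0) := by
  have := (tendsto_ofReal_pow_nhdsGT hm).mul
    ((tendsto_integral_inv_eps_add_mul_I_pow ha l).mul_const c)
  rw [zero_mul] at this
  refine this.congr fun ε => ?_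
  simp only [spheroidIntegral, intervalIntegral.integral_mul_const]

theorem spheroidIntegral_add {a ε : ℝ} (hε : 0 < ε) (l : ℕ) {g h : ℝ × ℝ → ℂ}
    (hg : Continuous g) (hh : Continuous h) :
    spheroidIntegral a l (fun x => g x + h x) ε =
      spheroidIntegral a l g ε + spheroidIntegral a l h ε := by
  rw [spheroidIntegral, spheroidIntegral, spheroidIntegral, ← intervalIntegral.integral_add
    (intervalIntegrable_curveIntegrand hε l hg) (intervalIntegrable_curveIntegrand hε l hh)]
  simp only [mul_add]

/-- On the curve w = γ²: this is the step that lowers the singularity by two. -/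
theorem spheroidIntegral_cylSq_mul {a ε : ℝ} (ha : a ≠ 0) (hε : 0 < ε) (l : ℕ) (g : ℝ × ℝ → ℂ) :
    spheroidIntegral a (l + 2) (fun x => cylSq a x * g x) ε = spheroidIntegral a l g ε := by
  refine intervalIntegral.integral_congr fun q _ => ?_
  have := eps_add_mul_I_ne_zero hε q
  simp only [cylSq_spheroidPoint ha, pow_add]
  field_simp

/-- On the spheroid `ζ = ε q / a` and `q = -i (γ - ε)`. -/
theorem spheroidIntegral_snd_mul {a ε : ℝ} (hε : 0 < ε) (l : ℕ) {g : ℝ × ℝ → ℂ}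
    (hg : Continuous g) :
    spheroidIntegral a (l + 1) (fun x => (x.2 : ℂ) * g x) ε = -Complex.I / a *
      (ε * spheroidIntegral a l g ε - ε ^ 2 * spheroidIntegral a (l + 1) g ε) := by
  rw [spheroidIntegral, spheroidIntegral, spheroidIntegral, ← intervalIntegral.integral_const_mul,
    ← intervalIntegral.integral_const_mul, ← intervalIntegral.integral_sub
      ((intervalIntegrable_curveIntegrand hε l hg).const_mul _)
      ((intervalIntegrable_curveIntegrand hε (l + 1) hg).const_mul _),
    ← intervalIntegral.integral_const_mul]
  refine intervalIntegral.integral_congr fun q _ => ?_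
  have := eps_add_mul_I_ne_zero hε q
  simp only [pow_succ]
  rw [show ((spheroidPoint a ε q).2 : ℂ) = ε * q / a by simp [spheroidPoint]]
  field_simp
  ring_nf
  simp only [Complex.I_sq]
  ring

/-- For l ≤ 1 the integrand is the Poisson kernel times a continuous function vanishing at (ε, q) =
(0, 0). For l ≥ 2 the value of g at the ring is split off, constants being handled by the explicit
antiderivative; the rest is dominated, thanks to |γ| ≥ ε, by the Poisson kernel times a function
vanishing there. -/
theorem tendsto_pow_mul_spheroidIntegral_of_continuous {a : ℝ} (ha : 0 < a) {m l : ℕ} (hm : 1 ≤ m)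
    (hl : l ≤ m + 1) {g : ℝ × ℝ → ℂ} (hg : Continuous g) :
    Tendsto (fun ε : ℝ => (ε : ℂ) ^ m * spheroidIntegral a l g ε) (𝓝[>] 0) (𝓝 0) := by
  have hcs : Continuous fun x : ℝ × ℝ => g (spheroidPoint a x.1 x.2) := by fun_prop
  obtain ⟨m, rfl⟩ := Nat.exists_eq_add_of_le' hm
  have hsmall : ∀ l : ℕ, l ≤ 1 →
      Tendsto (fun ε : ℝ => (ε : ℂ) ^ (m + 1) * spheroidIntegral a l g ε) (𝓝[>] 0) (𝓝 0) := by
    intro l hl1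
    have hH : Continuous fun x : ℝ × ℝ => (x.1 : ℂ) ^ m * ((x.1 - x.2 * Complex.I) ^ l *
      ((x.1 : ℂ) ^ 2 + (x.2 : ℂ) ^ 2) ^ (1 - l)) * g (spheroidPoint a x.1 x.2) := by fun_prop
    have h1 := tendsto_integral_poissonKernel_mul hH ha
    have h0 : (Real.pi : ℂ) * ((((0 : ℝ) : ℂ) ^ m * ((((0 : ℝ) : ℂ) - ((0 : ℝ) : ℂ) * Complex.I) ^ l *
        (((0 : ℝ) : ℂ) ^ 2 + ((0 : ℝ) : ℂ) ^ 2) ^ (1 - l))) * g (spheroidPoint a 0 0)) = 0 := by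
      interval_cases l <;> simp
    replace h1 := h0 ▸ h1
    refine h1.congr' ?_
    filter_upwards [self_mem_nhdsWithin] with ε hε
    have hε : 0 < ε := hε
    rw [spheroidIntegral, ← intervalIntegral.integral_const_mul]
    refine intervalIntegral.integral_congr fun q _ => ?_
    have hne : (ε : ℂ) ^ 2 + (q : ℂ) ^ 2 ≠ 0 := by
      have : ε ^ 2 + q ^ 2 ≠ 0 := by positivity
      exact_mod_cast this
    interval_cases l
    · simp only [pow_zero, one_mul, inv_one, Nat.sub_zero, pow_one]
      push_cast
      field_simp
      ring
    · simp only [pow_one, Nat.sub_self, pow_zero, mul_one]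
      rw [inv_eps_add_mul_I_pow_eq hε]
      push_cast
      field_simp
      ring
  rcases Nat.lt_or_ge l 2 with hl2 | hl2
  · exact hsmall l (by omega)
  obtain ⟨l, rfl⟩ := Nat.exists_eq_add_of_le' hl2
  set g₀ := g (a ^ 2, 0)
  have hconst := tendsto_pow_mul_spheroidIntegral_const ha hm l g₀
  have hdiff : Tendsto (fun ε : ℝ => (ε : ℂ) ^ (m + 1) *
      spheroidIntegral a (l + 2) (fun x => g x - g₀) ε) (𝓝[>] 0) (𝓝 0) := by
    have hH : Continuous fun x : ℝ × ℝ => ((‖g (spheroidPoint a x.1 x.2) - g₀‖ : ℝ) : ℂ) := by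
      fun_prop
    have h1 := (tendsto_integral_poissonKernel_mul hH ha).norm
    simp only [spheroidPoint_zero_zero, g₀, sub_self, norm_zero, Complex.ofReal_zero,
      mul_zero] at h1
    refine squeeze_zero_norm' ?_ h1
    filter_upwards [Ioo_mem_nhdsGT (zero_lt_one' ℝ)] with ε hε
    have hε0 : 0 < ε := hε.1
    have hcε : Continuous fun q : ℝ => ‖g (spheroidPoint a ε q) - g₀‖ :=
      ((hcs.comp (Continuous.prodMk_right ε)).sub continuous_const).norm
    have hpk : Continuous fun q : ℝ => ε / (ε ^ 2 + q ^ 2) * ‖g (spheroidPoint a ε q) - g₀‖ :=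
      (Continuous.div continuous_const (by fun_prop) (fun q => by positivity)).mul hcε
    have h2 : ∫ q in -a..a, ((ε / (ε ^ 2 + q ^ 2) : ℝ) : ℂ) *
        ((‖g (spheroidPoint a ε q) - g₀‖ : ℝ) : ℂ) =
        ((∫ q in -a..a, ε / (ε ^ 2 + q ^ 2) * ‖g (spheroidPoint a ε q) - g₀‖ : ℝ) : ℂ) := by
      rw [← intervalIntegral.integral_ofReal]
      simp only [Complex.ofReal_mul]
    have hle : -a ≤ a := by linarith
    rw [h2, Complex.norm_real, spheroidIntegral, ← intervalIntegral.integral_const_mul]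
    refine le_trans ?_ (le_abs_self _)
    refine intervalIntegral.norm_integral_le_of_norm_le hle ?_ (hpk.intervalIntegrable _ _)
    refine Eventually.of_forall fun q _ => ?_
    rw [norm_mul, norm_mul, norm_inv, norm_pow, norm_pow, Complex.norm_real, Real.norm_eq_abs,
      abs_of_pos hε0, ← mul_assoc]
    gcongr
    rw [pow_add _ l 2, norm_eps_add_mul_I_sq, mul_inv, pow_succ, div_eq_mul_inv]
    -- The exponents are now m + 1 and l + 2, so the hypothesis reads l ≤ m; ε < 1 is used as well.
    have h3 : ε ^ m * (‖(ε + q * Complex.I : ℂ)‖ ^ l)⁻¹ ≤ 1 := by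
      have h4 := le_norm_eps_add_mul_I ε q
      rw [← div_eq_mul_inv, div_le_one (pow_pos (hε0.trans_le h4) _)]
      calc ε ^ m ≤ ε ^ l := pow_le_pow_of_le_one hε0.le hε.2.le (by omega)
        _ ≤ _ := by gcongr
    calc ε ^ m * ε * ((‖(ε + q * Complex.I : ℂ)‖ ^ l)⁻¹ * (ε ^ 2 + q ^ 2)⁻¹)
        = (ε ^ m * (‖(ε + q * Complex.I : ℂ)‖ ^ l)⁻¹) * (ε * (ε ^ 2 + q ^ 2)⁻¹) := by ring
      _ ≤ 1 * (ε * (ε ^ 2 + q ^ 2)⁻¹) := by gcongr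
      _ = _ := one_mul _
  have := hdiff.add hconst
  rw [add_zero] at this
  refine this.congr' ?_
  filter_upwards [self_mem_nhdsWithin] with ε hε
  rw [← mul_add, ← spheroidIntegral_add hε _ (by fun_prop) continuous_const]
  simp only [sub_add_cancel]

/-- Negligible curve integrals. -/
theorem tendsto_pow_mul_spheroidIntegral {a : ℝ} (ha : 0 < a) (r : ℕ) :
    ∀ {m l : ℕ} (_ : 1 ≤ m) (_ : l ≤ m + 1 + 2 * r) {g : ℝ × ℝ → ℂ} (_ : ContDiff ℝ r g),
    Tendsto (fun ε : ℝ => (ε : ℂ) ^ m * spheroidIntegral a l g ε) (𝓝[>] 0) (𝓝 0) := by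
  induction r with
  | zero =>
    intro m l hm hl g hg
    exact tendsto_pow_mul_spheroidIntegral_of_continuous ha hm (by omega) hg.continuous
  | succ r ih =>
    intro m l hm hl g hg
    rcases Nat.lt_or_ge l (m + 2) with hlm | hlm
    · exact tendsto_pow_mul_spheroidIntegral_of_continuous ha hm (by omega) hg.continuous
    obtain ⟨l, rfl⟩ := Nat.exists_eq_add_of_le' (show 2 ≤ l by omega)
    -- Replacing s - a² by w - ζ(ζ + 2ia) gives g = const + w g₁ + ζ g₃ with g₁, g₃ of class C^r.
    -- The pairs (m, l), (m+1, l+1), (m+2, l+2) that arise all satisfy the bound for r.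
    obtain ⟨g₁, g₂, hg₁, hg₂, hgeq⟩ := exists_contDiff_eq_add_mul_add_mul hg (a ^ 2)
    have hg₃ : ContDiff ℝ r fun x : ℝ × ℝ => g₂ x - (x.2 + 2 * a * Complex.I) * g₁ x := by
      have : ContDiff ℝ r fun x : ℝ × ℝ => ((x.2 : ℂ) + 2 * a * Complex.I) :=
        (Complex.ofRealCLM.contDiff.comp contDiff_snd).add contDiff_const
      exact hg₂.sub (this.mul hg₁)
    have hdec : g = fun x => (g (a ^ 2, 0) + cylSq a x * g₁ x) +
        (x.2 : ℂ) * (g₂ x - (x.2 + 2 * a * Complex.I) * g₁ x) := by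
      funext x
      rw [hgeq x, cylSq]
      push_cast
      ring_nf
      simp only [Complex.I_sq]
      ring
    have hcw : Continuous (cylSq a) := by unfold cylSq; fun_prop
    have t0 := tendsto_pow_mul_spheroidIntegral_const ha hm l (g (a ^ 2, 0))
    have t1 := ih (m := m) (l := l) hm (by omega) hg₁
    have t2 := ih (m := m + 1) (l := l + 1) (by omega) (by omega) hg₃
    have t3 := ih (m := m + 2) (l := l + 2) (by omega) (by omega) hg₃
    have := (t0.add t1).add ((t2.sub t3).const_mul (-Complex.I / a))
    simp only [add_zero, sub_zero, mul_zero] at this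
    refine this.congr' ?_
    filter_upwards [self_mem_nhdsWithin] with ε hε
    conv_rhs => rw [hdec]
    have hc₁ : Continuous fun x => cylSq a x * g₁ x := hcw.mul hg₁.continuous
    have hc₂ : Continuous fun x => g (a ^ 2, 0) + cylSq a x * g₁ x := continuous_const.add hc₁
    have hc₃ : Continuous fun x : ℝ × ℝ => (x.2 : ℂ) *
        (g₂ x - (x.2 + 2 * a * Complex.I) * g₁ x) :=
      (Complex.continuous_ofReal.comp continuous_snd).mul hg₃.continuous
    rw [spheroidIntegral_add hε _ hc₂ hc₃, spheroidIntegral_add hε _ continuous_const hc₁,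
      spheroidIntegral_cylSq_mul ha.ne' hε, spheroidIntegral_snd_mul hε _ hg₃.continuous]
    ring

end CurveLimits

/-! ### Curve integrals with a nonzero limit -/

section CurveLimits

/-- The real part of 1/(ε + iq) is the Poisson kernel. The imaginary part is odd in q and integrates
to 0, since s depends on q² only. -/
theorem tendsto_spheroidIntegral_one {a : ℝ} (ha : 0 < a) {h : ℝ → ℂ} (hh : Continuous h) :
    Tendsto (spheroidIntegral a 1 (fun x => h x.1)) (𝓝[>] 0) (𝓝 (Real.pi * h (a ^ 2))) := by
  have hH : Continuous fun x : ℝ × ℝ => h (spheroidPoint a x.1 x.2).1 := by fun_prop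
  have h1 := tendsto_integral_poissonKernel_mul hH ha
  simp only [spheroidPoint_zero_zero] at h1
  refine h1.congr' ?_
  filter_upwards [self_mem_nhdsWithin] with ε hε
  have hε : 0 < ε := hε
  have hcε : Continuous fun q : ℝ => h (spheroidPoint a ε q).1 :=
    hH.comp (Continuous.prodMk_right ε)
  have hodd : ∫ q in -a..a, ((q / (ε ^ 2 + q ^ 2) : ℝ) : ℂ) * h (spheroidPoint a ε q).1 = 0 := by
    have h2 := intervalIntegral.integral_comp_neg (a := -a) (b := a)
      (fun q : ℝ => ((q / (ε ^ 2 + q ^ 2) : ℝ) : ℂ) * h (spheroidPoint a ε q).1)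
    have h3 : ∀ q : ℝ, ((-q / (ε ^ 2 + (-q) ^ 2) : ℝ) : ℂ) * h (spheroidPoint a ε (-q)).1 =
        -(((q / (ε ^ 2 + q ^ 2) : ℝ) : ℂ) * h (spheroidPoint a ε q).1) := fun q => by
      simp only [spheroidPoint, neg_sq]
      push_cast
      ring
    simp only [h3, neg_neg, intervalIntegral.integral_neg] at h2
    exact self_eq_neg.1 h2.symm
  have hc1 : Continuous fun q : ℝ => ((ε / (ε ^ 2 + q ^ 2) : ℝ) : ℂ) * h (spheroidPoint a ε q).1 :=
    (Complex.continuous_ofReal.comp (Continuous.div continuous_const (by fun_prop)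
      (fun q => by positivity))).mul hcε
  have hc2 : Continuous fun q : ℝ => ((q / (ε ^ 2 + q ^ 2) : ℝ) : ℂ) * h (spheroidPoint a ε q).1 :=
    (Complex.continuous_ofReal.comp (Continuous.div continuous_id (by fun_prop)
      (fun q => by positivity))).mul hcε
  have h4 : spheroidIntegral a 1 (fun x => h x.1) ε =
      (∫ q in -a..a, ((ε / (ε ^ 2 + q ^ 2) : ℝ) : ℂ) * h (spheroidPoint a ε q).1) - Complex.I *
      ∫ q in -a..a, ((q / (ε ^ 2 + q ^ 2) : ℝ) : ℂ) * h (spheroidPoint a ε q).1 := by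
    rw [spheroidIntegral, ← intervalIntegral.integral_const_mul,
      ← intervalIntegral.integral_sub (hc1.intervalIntegrable _ _)
        ((hc2.const_mul _).intervalIntegrable _ _)]
    refine intervalIntegral.integral_congr fun q _ => ?_
    simp only [pow_one]
    rw [inv_eps_add_mul_I_pow_eq hε]
    push_cast
    ring
  rw [h4, hodd, mul_zero, sub_zero]

/-- A factor s - a² equals w up to a multiple of ζ, so it cancels two powers of γ modulo negligible
terms. The factorial builds up because the (i+1)-st derivative of (s - a²)h₁ at a² is (i+1) times
the i-th derivative of h₁. -/
theorem tendsto_spheroidIntegral_fst {a : ℝ} (ha : 0 < a) (i : ℕ) :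
    ∀ {h : ℝ → ℂ} (_ : ContDiff ℝ i h),
    Tendsto (spheroidIntegral a (2 * i + 1) (fun x => h x.1)) (𝓝[>] 0)
      (𝓝 (Real.pi * iteratedDeriv i h (a ^ 2) / i.factorial)) := by
  induction i with
  | zero =>
    intro h hh
    simpa using tendsto_spheroidIntegral_one ha hh.continuous
  | succ i ih =>
    intro h hh
    obtain ⟨h₁, hh₁, heq⟩ := exists_contDiff_eq_add_sub_mul hh (a ^ 2)
    set G : ℝ × ℝ → ℂ := fun x => -(x.2 + 2 * a * Complex.I) * h₁ x.1
    have hG : ContDiff ℝ i G := by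
      have : ContDiff ℝ i fun x : ℝ × ℝ => ((x.2 : ℂ) + 2 * a * Complex.I) :=
        (Complex.ofRealCLM.contDiff.comp contDiff_snd).add contDiff_const
      exact this.neg.mul (hh₁.comp contDiff_fst)
    have hdec : (fun x : ℝ × ℝ => h x.1) =
        fun x => (h (a ^ 2) + cylSq a x * h₁ x.1) + (x.2 : ℂ) * G x := by
      funext x
      rw [heq x.1, cylSq]
      simp only [G]
      push_cast
      ring_nf
      simp only [Complex.I_sq]
      ring
    have hcw : Continuous (cylSq a) := by unfold cylSq; fun_prop
    -- For this odd exponent the antiderivative is an even power of γ, with equal limits at the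
    -- endpoints ±ia.
    have t0 : Tendsto (spheroidIntegral a (2 * i + 1 + 2) (fun _ => h (a ^ 2))) (𝓝[>] 0)
        (𝓝 0) := by
      have := (tendsto_integral_inv_eps_add_mul_I_pow ha (2 * i + 1)).mul_const (h (a ^ 2))
      have h0 : ((-(a * Complex.I) : ℂ) ^ (2 * i + 1 + 1)) = (a * Complex.I : ℂ) ^ (2 * i + 1 + 1) :=
        Even.neg_pow ⟨i + 1, by ring⟩ _
      rw [h0, sub_self, mul_zero, zero_mul] at this
      refine this.congr fun ε => ?_
      simp only [spheroidIntegral, intervalIntegral.integral_mul_const]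
    have t1 := ih hh₁
    have t2 := tendsto_pow_mul_spheroidIntegral ha i (m := 1) (l := 2 * i + 2) le_rfl (by omega) hG
    have t3 := tendsto_pow_mul_spheroidIntegral ha i (m := 2) (l := 2 * i + 2 + 1) (by omega)
      (by omega) hG
    have := (t0.add t1).add ((t2.sub t3).const_mul (-Complex.I / a))
    simp only [add_zero, sub_zero, mul_zero, zero_add] at this
    have hderiv : iteratedDeriv (i + 1) h (a ^ 2) = (i + 1) * iteratedDeriv i h₁ (a ^ 2) := by
      have h2 := (hasDerivAt_iteratedDeriv_sub_mul (c := a ^ 2) hh₁.contDiffAt).deriv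
      rw [← iteratedDeriv_succ] at h2
      rw [← h2, iteratedDeriv_succ', iteratedDeriv_succ']
      congr 1
      conv_lhs => rw [show h = fun s => h (a ^ 2) + ((s - a ^ 2 : ℝ) : ℂ) * h₁ s from funext heq]
      funext s
      exact deriv_const_add _
    have hlim : (Real.pi : ℂ) * iteratedDeriv (i + 1) h (a ^ 2) / (i + 1).factorial =
        Real.pi * iteratedDeriv i h₁ (a ^ 2) / i.factorial := by
      rw [hderiv, Nat.factorial_succ]
      have : (i + 1 : ℂ) ≠ 0 := by exact_mod_cast Nat.succ_ne_zero i
      have : (i.factorial : ℂ) ≠ 0 := by exact_mod_cast i.factorial_ne_zero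
      push_cast
      field_simp
    rw [hlim]
    refine this.congr' ?_
    filter_upwards [self_mem_nhdsWithin] with ε hε
    have hc₁ : Continuous fun x : ℝ × ℝ => cylSq a x * h₁ x.1 :=
      hcw.mul (hh₁.continuous.comp continuous_fst)
    have hc₂ : Continuous fun x : ℝ × ℝ => h (a ^ 2) + cylSq a x * h₁ x.1 :=
      continuous_const.add hc₁
    have hc₃ : Continuous fun x : ℝ × ℝ => (x.2 : ℂ) * G x :=
      (Complex.continuous_ofReal.comp continuous_snd).mul hG.continuous
    rw [hdec, show 2 * (i + 1) + 1 = 2 * i + 1 + 2 by ring, spheroidIntegral_add hε _ hc₂ hc₃,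
      spheroidIntegral_add hε _ continuous_const hc₁, spheroidIntegral_cylSq_mul ha.ne' hε,
      show 2 * i + 1 + 2 = 2 * i + 2 + 1 by ring, spheroidIntegral_snd_mul hε _ hG.continuous]
    ring

/-- Only g(s, 0) matters: the rest is ζ g₁, negligible because ζ carries a factor ε and g₁ has the i
- 1 derivatives just needed. For i = 0 the truncated i - 1 is 0, and g₁ exists thanks to the
separate C¹ hypothesis. -/
theorem tendsto_spheroidIntegral_odd {a : ℝ} (ha : 0 < a) (i : ℕ) {g : ℝ × ℝ → ℂ}
    (hg : ContDiff ℝ i g) (hg' : ContDiff ℝ 1 g) :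
    Tendsto (spheroidIntegral a (2 * i + 1) g) (𝓝[>] 0)
      (𝓝 (Real.pi * iteratedDeriv i (fun s => g (s, 0)) (a ^ 2) / i.factorial)) := by
  have hgr : ContDiff ℝ ((i - 1) + 1 : ℕ) g := by
    rcases i with - | i
    · simpa using hg'
    · exact hg
  obtain ⟨g₁, hg₁, heq⟩ := exists_contDiff_eq_add_snd_mul hgr
  have hh : ContDiff ℝ i fun s : ℝ => g (s, 0) := hg.comp (contDiff_id.prodMk contDiff_const)
  have t1 := tendsto_spheroidIntegral_fst ha i hh
  have t2 := tendsto_pow_mul_spheroidIntegral ha (i - 1) (m := 1) (l := 2 * i) le_rfl (by omega) hg₁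
  have t3 := tendsto_pow_mul_spheroidIntegral ha (i - 1) (m := 2) (l := 2 * i + 1) (by omega)
      (by omega) hg₁
  have := t1.add ((t2.sub t3).const_mul (-Complex.I / a))
  simp only [add_zero, sub_zero, mul_zero] at this
  refine this.congr' ?_
  filter_upwards [self_mem_nhdsWithin] with ε hε
  have hc₁ : Continuous fun x : ℝ × ℝ => (x.2 : ℂ) * g₁ x :=
    (Complex.continuous_ofReal.comp continuous_snd).mul hg₁.continuous
  have hc₂ : Continuous fun x : ℝ × ℝ => g (x.1, 0) :=
    hh.continuous.comp continuous_fst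
  conv_rhs => rw [show g = fun x => g (x.1, 0) + (x.2 : ℂ) * g₁ x from funext heq]
  rw [spheroidIntegral_add hε _ hc₂ hc₁, spheroidIntegral_snd_mul hε _ hg₁.continuous, pow_one]

/-- Write q = -i(γ - ε): the term in γ leaves an odd exponent, the term in ε is negligible. The
ζ-flux through the spheroid comes with exactly this factor q. -/
theorem tendsto_integral_mul_inv_pow {a : ℝ} (ha : 0 < a) (i : ℕ) {g : ℝ × ℝ → ℂ}
    (hg : ContDiff ℝ i g) (hg' : ContDiff ℝ 1 g) :
    Tendsto (fun ε : ℝ => ∫ q in -a..a, (q : ℂ) * (((ε + q * Complex.I : ℂ) ^ (2 * i + 2))⁻¹ *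
      g (spheroidPoint a ε q))) (𝓝[>] 0)
      (𝓝 (-Complex.I * (Real.pi * iteratedDeriv i (fun s => g (s, 0)) (a ^ 2) / i.factorial))) := by
  have t1 := tendsto_spheroidIntegral_odd ha i hg hg'
  have t2 := tendsto_pow_mul_spheroidIntegral ha i (m := 1) (l := 2 * i + 2) le_rfl (by omega) hg
  have := (t1.sub t2).const_mul (-Complex.I)
  rw [sub_zero] at this
  refine this.congr' ?_
  filter_upwards [self_mem_nhdsWithin] with ε hε
  have hε : 0 < ε := hε
  rw [spheroidIntegral, spheroidIntegral, ← intervalIntegral.integral_const_mul,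
    ← intervalIntegral.integral_sub (intervalIntegrable_curveIntegrand hε _ hg.continuous)
      ((intervalIntegrable_curveIntegrand hε _ hg.continuous).const_mul _),
    ← intervalIntegral.integral_const_mul]
  refine intervalIntegral.integral_congr fun q _ => ?_
  have := eps_add_mul_I_ne_zero hε q
  have hq : (q : ℂ) = -Complex.I * ((ε + q * Complex.I) - ε) := by
    ring_nf
    simp [Complex.I_sq]
  simp only [show 2 * i + 2 = 2 * i + 1 + 1 by ring, pow_succ _ (2 * i + 1)]
  generalize (ε + q * Complex.I : ℂ) = Z at *
  rw [hq]
  have hZ := pow_ne_zero (2 * i + 1) this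
  field_simp
  try ring

end CurveLimits

/-! ### The cylindrical Laplacian and Green's identity -/

section Green

/-- The partial derivative in the first variable. -/
noncomputable def partialFst (B : ℝ × ℝ → ℂ) (x : ℝ × ℝ) : ℂ := fderiv ℝ B x (1, 0)

/-- The partial derivative in the second variable. -/
noncomputable def partialSnd (B : ℝ × ℝ → ℂ) (x : ℝ × ℝ) : ℂ := fderiv ℝ B x (0, 1)

/-- The `s`-component `4 s^{k+1/2} ∂ₛu` of the flux of `u`, in terms of `B = s^{k-1/2} u`. -/
noncomputable def radialFlux (k : ℕ) (B : ℝ × ℝ → ℂ) (x : ℝ × ℝ) : ℂ :=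
  4 * (x.1 * partialFst B x - (k - 1 / 2) * B x)

/-- The cylindrical Laplacian, acting on the weighted function `B = s^{k-1/2} u`. -/
noncomputable def cylLaplacian (k : ℕ) (B : ℝ × ℝ → ℂ) (x : ℝ × ℝ) : ℂ :=
  partialFst (radialFlux k B) x + partialSnd (partialSnd B) x

theorem contDiff_ofReal_fst {n : WithTop ℕ∞} : ContDiff ℝ n fun x : ℝ × ℝ => (x.1 : ℂ) :=
  Complex.ofRealCLM.contDiff.comp contDiff_fst

theorem contDiff_ofReal_snd {n : WithTop ℕ∞} : ContDiff ℝ n fun x : ℝ × ℝ => (x.2 : ℂ) :=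
  Complex.ofRealCLM.contDiff.comp contDiff_snd

theorem ContDiff.partialFst {m n : WithTop ℕ∞} {B : ℝ × ℝ → ℂ} (hB : ContDiff ℝ n B)
    (hmn : m + 1 ≤ n) : ContDiff ℝ m (partialFst B) :=
  (hB.fderiv_right hmn).clm_apply contDiff_const

theorem ContDiff.partialSnd {m n : WithTop ℕ∞} {B : ℝ × ℝ → ℂ} (hB : ContDiff ℝ n B)
    (hmn : m + 1 ≤ n) : ContDiff ℝ m (partialSnd B) :=
  (hB.fderiv_right hmn).clm_apply contDiff_const

theorem ContDiff.radialFlux {m n : WithTop ℕ∞} {B : ℝ × ℝ → ℂ} (k : ℕ) (hB : ContDiff ℝ n B)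
    (hmn : m + 1 ≤ n) : ContDiff ℝ m (radialFlux k B) :=
  contDiff_const.mul ((contDiff_ofReal_fst.mul (hB.partialFst hmn)).sub
    (contDiff_const.mul (hB.of_le (le_self_add.trans hmn))))

theorem hasFDerivAt_ofReal_fst (x : ℝ × ℝ) : HasFDerivAt (fun x : ℝ × ℝ => (x.1 : ℂ))
    (Complex.ofRealCLM.comp (ContinuousLinearMap.fst ℝ ℝ ℝ)) x :=
  (Complex.ofRealCLM.comp (ContinuousLinearMap.fst ℝ ℝ ℝ)).hasFDerivAt

theorem hasFDerivAt_ofReal_snd_add (c : ℂ) (x : ℝ × ℝ) :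
    HasFDerivAt (fun x : ℝ × ℝ => (x.2 : ℂ) + c)
      (Complex.ofRealCLM.comp (ContinuousLinearMap.snd ℝ ℝ ℝ)) x :=
  (Complex.ofRealCLM.comp (ContinuousLinearMap.snd ℝ ℝ ℝ)).hasFDerivAt.add_const c

theorem contDiff_cylSq {n : WithTop ℕ∞} (a : ℝ) : ContDiff ℝ n (cylSq a) :=
  contDiff_ofReal_fst.add ((contDiff_ofReal_snd.add contDiff_const).pow 2)

theorem fderiv_cylSq_apply (a : ℝ) (x v : ℝ × ℝ) :
    fderiv ℝ (cylSq a) x v = v.1 + 2 * (x.2 + a * Complex.I) * v.2 := by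
  have h := (hasFDerivAt_ofReal_fst x).add ((hasFDerivAt_ofReal_snd_add (a * Complex.I) x).pow 2)
  have h' : HasFDerivAt (cylSq a) _ x := h
  rw [h'.fderiv]
  simp
  left
  ring

theorem contDiffAt_inv_cylSq_pow {n : WithTop ℕ∞} {a : ℝ} {x : ℝ × ℝ} (hx : cylSq a x ≠ 0)
    (k : ℕ) : ContDiffAt ℝ n (fun x => (cylSq a x ^ k)⁻¹) x :=
  ((contDiff_cylSq a).contDiffAt.pow k).inv (pow_ne_zero _ hx)

theorem hasDerivAt_inv_pow (k : ℕ) {w : ℂ} (hw : w ≠ 0) :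
    HasDerivAt (fun z : ℂ => (z ^ k)⁻¹) (-k * (w ^ (k + 1))⁻¹) w := by
  refine ((hasDerivAt_pow k w).inv (pow_ne_zero k hw)).congr_deriv ?_
  rcases k with - | k
  · simp
  · simp only [Nat.add_sub_cancel]
    have := pow_ne_zero k hw
    push_cast
    field_simp
    ring

theorem fderiv_inv_cylSq_pow_apply {a : ℝ} {x : ℝ × ℝ} (hx : cylSq a x ≠ 0) (k : ℕ)
    (v : ℝ × ℝ) : fderiv ℝ (fun x => (cylSq a x ^ k)⁻¹) x v =
      -k * (cylSq a x ^ (k + 1))⁻¹ * (v.1 + 2 * (x.2 + a * Complex.I) * v.2) := by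
  have h1 : HasFDerivAt (cylSq a) (fderiv ℝ (cylSq a) x) x :=
    ((contDiff_cylSq (n := 1) a).differentiable one_ne_zero x).hasFDerivAt
  have h3 := (hasDerivAt_inv_pow k hx).comp_hasFDerivAt x h1
  have h4 : HasFDerivAt (fun x => (cylSq a x ^ k)⁻¹) _ x := h3
  rw [h4.fderiv]
  simp [fderiv_cylSq_apply]

/-- The `s`-component of `w^{-k} ∇u - u ∇w^{-k}`. -/
noncomputable def greenFst (a : ℝ) (k : ℕ) (B : ℝ × ℝ → ℂ) (x : ℝ × ℝ) : ℂ :=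
  (cylSq a x ^ k)⁻¹ * radialFlux k B x + (cylSq a x ^ (k + 1))⁻¹ * (4 * k * (x.1 * B x))

/-- The `ζ`-component of `w^{-k} ∇u - u ∇w^{-k}`. -/
noncomputable def greenSnd (a : ℝ) (k : ℕ) (B : ℝ × ℝ → ℂ) (x : ℝ × ℝ) : ℂ :=
  (cylSq a x ^ k)⁻¹ * partialSnd B x +
    (cylSq a x ^ (k + 1))⁻¹ * (2 * k * ((x.2 + a * Complex.I) * B x))

theorem contDiffAt_greenFst {a : ℝ} {x : ℝ × ℝ} (hx : cylSq a x ≠ 0) (k : ℕ)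
    {B : ℝ × ℝ → ℂ} (hB : ContDiff ℝ 2 B) : ContDiffAt ℝ 1 (greenFst a k B) x :=
  ((contDiffAt_inv_cylSq_pow hx k).mul (hB.radialFlux k (by norm_num)).contDiffAt).add
    ((contDiffAt_inv_cylSq_pow hx (k + 1)).mul (contDiff_const.mul (contDiff_ofReal_fst.mul
      (hB.of_le one_le_two))).contDiffAt)

theorem contDiffAt_greenSnd {a : ℝ} {x : ℝ × ℝ} (hx : cylSq a x ≠ 0) (k : ℕ)
    {B : ℝ × ℝ → ℂ} (hB : ContDiff ℝ 2 B) : ContDiffAt ℝ 1 (greenSnd a k B) x :=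
  ((contDiffAt_inv_cylSq_pow hx k).mul (hB.partialSnd (by norm_num)).contDiffAt).add
    ((contDiffAt_inv_cylSq_pow hx (k + 1)).mul (contDiff_const.mul ((contDiff_ofReal_snd.add
      contDiff_const).mul (hB.of_le one_le_two))).contDiffAt)

/-- Green's identity in divergence form: `w^{-k}` is harmonic. -/
theorem partialFst_greenFst_add_partialSnd_greenSnd {a : ℝ} {x : ℝ × ℝ} (hx : cylSq a x ≠ 0)
    (k : ℕ) {B : ℝ × ℝ → ℂ} (hB : ContDiff ℝ 2 B) :
    partialFst (greenFst a k B) x + partialSnd (greenSnd a k B) x =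
      (cylSq a x ^ k)⁻¹ * cylLaplacian k B x := by
  have hB1 : HasFDerivAt B (fderiv ℝ B x) x :=
    (hB.differentiable (by norm_num) x).hasFDerivAt
  have hR : HasFDerivAt (radialFlux k B) (fderiv ℝ (radialFlux k B) x) x :=
    ((hB.radialFlux (m := 1) k (by norm_num)).differentiable one_ne_zero x).hasFDerivAt
  have hQ : HasFDerivAt (partialSnd B) (fderiv ℝ (partialSnd B) x) x :=
    ((hB.partialSnd (m := 1) (by norm_num)).differentiable one_ne_zero x).hasFDerivAt
  have hW : ∀ k : ℕ, HasFDerivAt (fun x => (cylSq a x ^ k)⁻¹)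
      (fderiv ℝ (fun x => (cylSq a x ^ k)⁻¹) x) x := fun k =>
    ((contDiffAt_inv_cylSq_pow (n := 1) hx k).differentiableAt one_ne_zero).hasFDerivAt
  have h1 : HasFDerivAt (greenFst a k B) _ x := ((hW k).mul hR).add ((hW (k + 1)).mul
    (((hasFDerivAt_ofReal_fst x).mul hB1).const_mul (4 * k : ℂ)))
  have h2 : HasFDerivAt (greenSnd a k B) _ x := ((hW k).mul hQ).add ((hW (k + 1)).mul
    (((hasFDerivAt_ofReal_snd_add (a * Complex.I) x).mul hB1).const_mul (2 * k : ℂ)))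
  rw [cylLaplacian, partialFst, h1.fderiv, partialSnd, h2.fderiv]
  simp only [add_apply, smul_apply, smul_eq_mul,
    fderiv_inv_cylSq_pow_apply hx, ContinuousLinearMap.comp_apply, ContinuousLinearMap.coe_fst',
    ContinuousLinearMap.coe_snd', Complex.ofRealCLM_apply, partialFst, partialSnd]
  simp only [radialFlux, partialFst]
  -- The terms in w^{-k-1} and w^{-k-2} cancel only after w = s + (ζ + ia)² is used; raising all of
  -- them to the power -k-2 leaves a polynomial identity.
  have hw : (cylSq a x ^ (k + 1))⁻¹ = (cylSq a x ^ (k + 1 + 1))⁻¹ *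
      (x.1 + (x.2 + a * Complex.I) ^ 2) := by
    rw [← cylSq, pow_succ _ (k + 1)]
    field_simp
  rw [hw]
  push_cast
  ring

end Green

/-! ### Green's formula outside the spheroid -/

section Green

theorem cylSq_ne_zero {a : ℝ} (ha : a ≠ 0) {x : ℝ × ℝ} (hx : x ≠ (a ^ 2, 0)) :
    cylSq a x ≠ 0 := by
  intro h
  have him := congrArg Complex.im h
  have hre := congrArg Complex.re h
  simp [cylSq, pow_two] at him hre
  have h2 : x.2 = 0 := by
    have : 2 * a * x.2 = 0 := by linarith
    simpa [ha] using this
  rw [h2] at hre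
  exact hx (Prod.ext (by simp; nlinarith) h2)

theorem partialFst_eq_zero {B : ℝ × ℝ → ℂ} {x : ℝ × ℝ} (hx : x ∉ tsupport B) :
    partialFst B x = 0 := by
  rw [partialFst, fderiv_of_notMem_tsupport ℝ hx]
  rfl

theorem partialSnd_eq_zero {B : ℝ × ℝ → ℂ} {x : ℝ × ℝ} (hx : x ∉ tsupport B) :
    partialSnd B x = 0 := by
  rw [partialSnd, fderiv_of_notMem_tsupport ℝ hx]
  rfl

theorem radialFlux_eq_zero {k : ℕ} {B : ℝ × ℝ → ℂ} {x : ℝ × ℝ} (hx : x ∉ tsupport B) :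
    radialFlux k B x = 0 := by
  rw [radialFlux, partialFst_eq_zero hx, image_eq_zero_of_notMem_tsupport hx]
  simp

theorem greenFst_eq_zero {a : ℝ} {k : ℕ} {B : ℝ × ℝ → ℂ} {x : ℝ × ℝ} (hx : x ∉ tsupport B) :
    greenFst a k B x = 0 := by
  rw [greenFst, radialFlux_eq_zero hx, image_eq_zero_of_notMem_tsupport hx]
  simp

theorem greenSnd_eq_zero {a : ℝ} {k : ℕ} {B : ℝ × ℝ → ℂ} {x : ℝ × ℝ} (hx : x ∉ tsupport B) :
    greenSnd a k B x = 0 := by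
  rw [greenSnd, partialSnd_eq_zero hx, image_eq_zero_of_notMem_tsupport hx]
  simp

theorem cylLaplacian_eq_zero {k : ℕ} {B : ℝ × ℝ → ℂ} {x : ℝ × ℝ} (hx : x ∉ tsupport B) :
    cylLaplacian k B x = 0 := by
  have h1 : tsupport (radialFlux k B) ⊆ tsupport B :=
    closure_minimal (fun y hy => not_imp_comm.1 radialFlux_eq_zero hy) (isClosed_tsupport B)
  have h2 : tsupport (partialSnd B) ⊆ tsupport B :=
    closure_minimal (fun y hy => not_imp_comm.1 partialSnd_eq_zero hy) (isClosed_tsupport B)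
  rw [cylLaplacian, partialFst_eq_zero (fun h => hx (h1 h)),
    partialSnd_eq_zero (fun h => hx (h2 h)), add_zero]

/-- The spheroid `p = ε` as a graph `s = spheroidGraph a ε ζ`. -/
noncomputable def spheroidGraph (a ε ζ : ℝ) : ℝ := (a ^ 2 + ε ^ 2) * (1 - ζ ^ 2 / ε ^ 2)

theorem hasDerivAt_spheroidGraph (a ε ζ : ℝ) :
    HasDerivAt (spheroidGraph a ε) (-(2 * (a ^ 2 + ε ^ 2) * ζ / ε ^ 2)) ζ := by
  have h := (((hasDerivAt_pow 2 ζ).div_const (ε ^ 2)).const_sub 1).const_mul (a ^ 2 + ε ^ 2)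
  refine h.congr_deriv ?_
  simp
  ring

theorem contDiff_spheroidGraph {n : WithTop ℕ∞} (a ε : ℝ) : ContDiff ℝ n (spheroidGraph a ε) := by
  unfold spheroidGraph
  fun_prop

theorem integral_Ioi_eq_integral_Ioi_add (f : ℝ → ℂ) (b : ℝ) :
    ∫ s in Set.Ioi b, f s = ∫ t in Set.Ioi 0, f (b + t) := by
  have := (measurePreserving_add_left volume b).setIntegral_preimage_emb
    (measurableEmbedding_addLeft b) f (Set.Ioi b)
  rw [← this]
  congr 2
  ext t
  simp

/-- Green's formula on the exterior of the spheroid `p = ε`. -/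
theorem integral_exterior_eq_integral_spheroid {a : ℝ} (ha : 0 < a) (k : ℕ) {B : ℝ × ℝ → ℂ}
    (hB : ContDiff ℝ 2 B) (hBs : HasCompactSupport B) {c : ℝ} (hc : 0 < c)
    (hBc : ∀ x : ℝ × ℝ, x.1 < c → B x = 0) {ε : ℝ} (hε : 0 < ε) :
    ∫ ζ : ℝ, ∫ s in Set.Ioi (spheroidGraph a ε ζ),
        (cylSq a (s, ζ) ^ k)⁻¹ * cylLaplacian k B (s, ζ) =
      ∫ ζ in -ε..ε, -(greenFst a k B (spheroidGraph a ε ζ, ζ) +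
        (2 * (a ^ 2 + ε ^ 2) * ζ / ε ^ 2 : ℝ) * greenSnd a k B (spheroidGraph a ε ζ, ζ)) := by
  obtain ⟨R, hR⟩ := hBs.isCompact.isBounded.subset_closedBall 0
  have hK1 : ∀ x : ℝ × ℝ, R < |x.1| → x ∉ tsupport B := fun x hx h => by
    have := hR h
    rw [mem_closedBall_zero_iff] at this
    exact absurd ((norm_fst_le x).trans this) (not_le.2 hx)
  have hK2 : ∀ x : ℝ × ℝ, R < |x.2| → x ∉ tsupport B := fun x hx h => by
    have := hR h
    rw [mem_closedBall_zero_iff] at this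
    exact absurd ((norm_snd_le x).trans this) (not_le.2 hx)
  have hKc : ∀ x : ℝ × ℝ, x.1 < c → x ∉ tsupport B := fun x hx h => by
    have h1 : tsupport B ⊆ {x : ℝ × ℝ | c ≤ x.1} :=
      closure_minimal (fun y hy => not_lt.1 fun h => hy (hBc y h))
        (isClosed_le continuous_const continuous_fst)
    exact absurd (h1 h) (not_le.2 hx)
  -- R' > R puts the sides |ζ| = R' outside the support of B; R' > ε makes the rectangle contain the
  -- whole spheroid.
  obtain ⟨R', hR', hRR'⟩ : ∃ R' : ℝ, ε < R' ∧ R < R' :=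
    ⟨max ε R + 1, by have := le_max_left ε R; linarith, by have := le_max_right ε R; linarith⟩
  have hR'0 : 0 < R' := hε.trans hR'
  -- The graph is lowest at |ζ| = R'; this height still brings the top edge to s ≥ R' > R.
  set T : ℝ := R' + (a ^ 2 + ε ^ 2) * (R' ^ 2 / ε ^ 2) with hT
  have hT0 : 0 < T := by positivity
  -- This shear flattens the boundary to t = 0. The field becomes (Q, P - slope · Q), with P and Q
  -- the s- and ζ-components and slope the derivative of the graph, and keeps its divergence, so the
  -- divergence theorem on a rectangle applies.
  set Θ : ℝ × ℝ → ℝ × ℝ := fun z => (spheroidGraph a ε z.1 + z.2, z.1) with hΘ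
  have hΘd : ContDiff ℝ 1 Θ :=
    (((contDiff_spheroidGraph a ε).comp contDiff_fst).add contDiff_snd).prodMk contDiff_fst
  have hΘT : ∀ ζ t : ℝ, |ζ| ≤ R' → T ≤ t → Θ (ζ, t) ∉ tsupport B := fun ζ t hζ ht => by
    refine hK1 _ (lt_of_lt_of_le ?_ (le_abs_self _))
    simp only [hΘ, spheroidGraph]
    have h1 : ζ ^ 2 / ε ^ 2 ≤ R' ^ 2 / ε ^ 2 := by
      rw [← sq_abs ζ]
      gcongr
    have h2 : (a ^ 2 + ε ^ 2) * (ζ ^ 2 / ε ^ 2) ≤ (a ^ 2 + ε ^ 2) * (R' ^ 2 / ε ^ 2) := by gcongr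
    have h3 : 0 ≤ a ^ 2 + ε ^ 2 := by positivity
    linarith
  -- At ζ = 0 the graph is at a² + ε² > a², so the ring lies strictly inside the spheroid.
  have hΘne : ∀ ζ t : ℝ, 0 ≤ t → cylSq a (Θ (ζ, t)) ≠ 0 := fun ζ t ht => by
    refine cylSq_ne_zero ha.ne' fun h => ?_
    rw [Prod.ext_iff] at h
    obtain ⟨h1, h2⟩ := h
    simp only [hΘ, spheroidGraph] at h1 h2
    rw [h2] at h1
    have : 0 < ε ^ 2 := by positivity
    simp at h1
    linarith
  set f : ℝ × ℝ → ℂ := fun z => greenSnd a k B (Θ z) with hf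
  set g : ℝ × ℝ → ℂ := fun z => greenFst a k B (Θ z) +
    (2 * (a ^ 2 + ε ^ 2) * z.1 / ε ^ 2 : ℝ) * greenSnd a k B (Θ z) with hg
  have hcoef : ContDiff ℝ 1 fun z : ℝ × ℝ => ((2 * (a ^ 2 + ε ^ 2) * z.1 / ε ^ 2 : ℝ) : ℂ) :=
    Complex.ofRealCLM.contDiff.comp ((contDiff_const.mul contDiff_fst).div_const _)
  have hfd : ∀ z : ℝ × ℝ, 0 ≤ z.2 → ContDiffAt ℝ 1 f z := fun z hz =>
    (contDiffAt_greenSnd (hΘne z.1 z.2 hz) k hB).comp z hΘd.contDiffAt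
  have hgd : ∀ z : ℝ × ℝ, 0 ≤ z.2 → ContDiffAt ℝ 1 g z := fun z hz =>
    ((contDiffAt_greenFst (hΘne z.1 z.2 hz) k hB).comp z hΘd.contDiffAt).add
      (hcoef.contDiffAt.mul (hfd z hz))
  have hdiv : ∀ z : ℝ × ℝ, 0 ≤ z.2 → fderiv ℝ f z (1, 0) + fderiv ℝ g z (0, 1) =
      (cylSq a (Θ z) ^ k)⁻¹ * cylLaplacian k B (Θ z) := fun z hz => by
    have hne := hΘne z.1 z.2 hz
    rw [← partialFst_greenFst_add_partialSnd_greenSnd hne k hB]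
    have hΘ' : HasFDerivAt Θ (((ContinuousLinearMap.smulRight (1 : ℝ →L[ℝ] ℝ)
        (-(2 * (a ^ 2 + ε ^ 2) * z.1 / ε ^ 2))).comp (ContinuousLinearMap.fst ℝ ℝ ℝ) +
        ContinuousLinearMap.snd ℝ ℝ ℝ).prod (ContinuousLinearMap.fst ℝ ℝ ℝ)) z :=
      (((hasDerivAt_spheroidGraph a ε z.1).hasFDerivAt.comp z hasFDerivAt_fst).add
        hasFDerivAt_snd).prodMk hasFDerivAt_fst
    have hP : HasFDerivAt (greenFst a k B) (fderiv ℝ (greenFst a k B) (Θ z)) (Θ z) :=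
      ((contDiffAt_greenFst hne k hB).differentiableAt one_ne_zero).hasFDerivAt
    have hQ : HasFDerivAt (greenSnd a k B) (fderiv ℝ (greenSnd a k B) (Θ z)) (Θ z) :=
      ((contDiffAt_greenSnd hne k hB).differentiableAt one_ne_zero).hasFDerivAt
    have hf' : HasFDerivAt f _ z := hQ.comp z hΘ'
    have hg' : HasFDerivAt g _ z := (hP.comp z hΘ').add
      (((hcoef.differentiable one_ne_zero z).hasFDerivAt).mul hf')
    have hco : fderiv ℝ (fun z : ℝ × ℝ => ((2 * (a ^ 2 + ε ^ 2) * z.1 / ε ^ 2 : ℝ) : ℂ)) z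
        (0, 1) = 0 := by
      have h1 : HasFDerivAt (fun z : ℝ × ℝ => ((2 * (a ^ 2 + ε ^ 2) * z.1 / ε ^ 2 : ℝ) : ℂ)) _ z :=
        Complex.ofRealCLM.hasFDerivAt.comp z
          ((hasFDerivAt_fst.const_mul (2 * (a ^ 2 + ε ^ 2))).mul_const (ε ^ 2)⁻¹)
      rw [h1.fderiv]
      simp
    rw [hf'.fderiv, hg'.fderiv]
    simp only [add_apply, smul_apply, ContinuousLinearMap.comp_apply,
      ContinuousLinearMap.prod_apply, ContinuousLinearMap.coe_fst', ContinuousLinearMap.coe_snd',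
      ContinuousLinearMap.smulRight_apply, one_apply_eq_self, smul_eq_mul, hco]
    simp only [one_mul, add_zero, zero_mul, zero_add, mul_zero, partialFst, partialSnd]
    rw [show ((-(2 * (a ^ 2 + ε ^ 2) * z.1 / ε ^ 2), 1) : ℝ × ℝ) =
      (-(2 * (a ^ 2 + ε ^ 2) * z.1 / ε ^ 2)) • ((1, 0) : ℝ × ℝ) + (0, 1) by simp, map_add,
      map_smul, Complex.real_smul]
    push_cast
    ring
  have hrect : ∀ z ∈ Set.uIcc (-R') R' ×ˢ Set.uIcc 0 T, 0 ≤ z.2 := fun z hz => by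
    have := hz.2
    rw [Set.uIcc_of_le hT0.le] at this
    exact this.1
  have hrect' : ∀ z ∈ Set.Ioo (min (-R') R') (max (-R') R') ×ˢ Set.Ioo (min 0 T) (max 0 T),
      0 ≤ z.2 := fun z hz => by
    have := hz.2.1
    rw [min_eq_left hT0.le] at this
    exact this.le
  have hcd : ContinuousOn (fun z => fderiv ℝ f z (1, 0) + fderiv ℝ g z (0, 1))
      (Set.uIcc (-R') R' ×ˢ Set.uIcc 0 T) := fun z hz => by
    have h1 := ((hfd z (hrect z hz)).fderiv_right (m := 0) (by norm_num)).continuousAt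
    have h2 := ((hgd z (hrect z hz)).fderiv_right (m := 0) (by norm_num)).continuousAt
    exact ((h1.clm_apply continuousAt_const).add
      (h2.clm_apply continuousAt_const)).continuousWithinAt
  have key := integral2_divergence_prod_of_hasFDerivAt f g (fderiv ℝ f) (fderiv ℝ g) (-R') 0 R' T
    (fun z hz => (hfd z (hrect z hz)).continuousAt.continuousWithinAt)
    (fun z hz => (hgd z (hrect z hz)).continuousAt.continuousWithinAt)
    (fun z hz => ((hfd z (hrect' z hz)).differentiableAt one_ne_zero).hasFDerivAt)
    (fun z hz => ((hgd z (hrect' z hz)).differentiableAt one_ne_zero).hasFDerivAt)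
    (hcd.integrableOn_compact (isCompact_uIcc.prod isCompact_uIcc))
  have hb1 : ∀ t : ℝ, f (R', t) = 0 := fun t => greenSnd_eq_zero (hK2 _ (by
    simp only [hΘ]
    rwa [abs_of_pos hR'0]))
  have hb2 : ∀ t : ℝ, f (-R', t) = 0 := fun t => greenSnd_eq_zero (hK2 _ (by
    simp only [hΘ]
    rwa [abs_neg, abs_of_pos hR'0]))
  have hle : -R' ≤ R' := by linarith
  have hb3 : ∫ ζ in -R'..R', g (ζ, T) = 0 := by
    rw [intervalIntegral.integral_congr (g := fun _ => (0 : ℂ)) fun ζ hζ => ?_]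
    · simp
    · rw [Set.uIcc_of_le hle] at hζ
      have := hΘT ζ T (abs_le.2 hζ) le_rfl
      simp only [hg, greenFst_eq_zero this, greenSnd_eq_zero this, mul_zero, add_zero]
  simp only [hb1, hb2, hb3, intervalIntegral.integral_zero, zero_sub, add_zero, sub_zero] at key
  have hL : ∫ ζ : ℝ, ∫ s in Set.Ioi (spheroidGraph a ε ζ),
        (cylSq a (s, ζ) ^ k)⁻¹ * cylLaplacian k B (s, ζ) =
      ∫ ζ in -R'..R', ∫ t in (0 : ℝ)..T, fderiv ℝ f (ζ, t) (1, 0) + fderiv ℝ g (ζ, t) (0, 1) := by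
    have h1 : ∀ ζ : ℝ, R < |ζ| → ∫ s in Set.Ioi (spheroidGraph a ε ζ),
        (cylSq a (s, ζ) ^ k)⁻¹ * cylLaplacian k B (s, ζ) = 0 := fun ζ hζ => by
      simp only [cylLaplacian_eq_zero (hK2 (_, ζ) hζ), mul_zero, integral_zero]
    rw [← intervalIntegral.integral_eq_integral_of_support_subset (a := -R') (b := R')]
    · refine intervalIntegral.integral_congr fun ζ hζ => ?_
      rw [Set.uIcc_of_le hle] at hζ
      have h2 : ∀ t ∈ Set.uIcc 0 T, fderiv ℝ f (ζ, t) (1, 0) + fderiv ℝ g (ζ, t) (0, 1) =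
          (cylSq a (Θ (ζ, t)) ^ k)⁻¹ * cylLaplacian k B (Θ (ζ, t)) := fun t ht => by
        rw [Set.uIcc_of_le hT0.le] at ht
        exact hdiv (ζ, t) ht.1
      rw [intervalIntegral.integral_congr h2, intervalIntegral.integral_of_le hT0.le,
        integral_Ioi_eq_integral_Ioi_add]
      refine setIntegral_eq_of_subset_of_forall_sdiff_eq_zero measurableSet_Ioi
        (fun t ht => ht.1) fun t ht => ?_
      have h3 : T ≤ t := by
        by_contra h
        exact ht.2 ⟨ht.1, (not_le.1 h).le⟩
      have := cylLaplacian_eq_zero (k := k) (hΘT ζ t (abs_le.2 hζ) h3)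
      simp only [hΘ] at this
      rw [this, mul_zero]
    · intro ζ hζ
      by_contra h
      refine hζ (h1 ζ (hRR'.trans_le ?_))
      by_contra h'
      rw [not_le, abs_lt] at h'
      exact h ⟨h'.1, h'.2.le⟩
  rw [hL, key, ← intervalIntegral.integral_neg]
  -- For |ζ| ≥ ε the graph has s ≤ 0, where B vanishes: only the genuine spheroid contributes.
  have hsupp : ∀ S : ℝ, ε ≤ S → (Function.support fun ζ : ℝ => -g (ζ, 0)) ⊆ Set.Ioc (-S) S := by
    intro S hS ζ hζ
    by_contra h
    refine hζ ?_
    have h1 : ε ≤ |ζ| := by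
      by_contra h'
      rw [not_le, abs_lt] at h'
      exact h ⟨by linarith, by linarith⟩
    have h2 : Θ (ζ, 0) ∉ tsupport B := by
      refine hKc _ (lt_of_le_of_lt ?_ hc)
      simp only [hΘ, spheroidGraph, add_zero]
      have h3 : 1 ≤ ζ ^ 2 / ε ^ 2 := by
        rw [one_le_div (by positivity), ← sq_abs ζ]
        gcongr
      exact mul_nonpos_of_nonneg_of_nonpos (by positivity) (by linarith)
    simp only [hg, greenFst_eq_zero h2, greenSnd_eq_zero h2, mul_zero, add_zero, neg_zero]
  rw [intervalIntegral.integral_eq_integral_of_support_subset (hsupp R' hR'.le),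
    ← intervalIntegral.integral_eq_integral_of_support_subset (hsupp ε le_rfl)]
  simp only [hg, hΘ, add_zero]

end Green

/-! ### The limit of the flux through the spheroid -/

section Green

theorem spheroidGraph_eps_mul {a ε : ℝ} (hε : ε ≠ 0) (q : ℝ) :
    (spheroidGraph a ε (ε / a * q), ε / a * q) = spheroidPoint a ε q := by
  simp only [spheroidGraph, spheroidPoint, Prod.mk.injEq]
  constructor
  · congr 2
    rw [mul_pow, div_pow]
    field_simp
  · ring

/-- The limit `ε → 0` of the integral of `w^{-k} Δu` over the exterior of the spheroid `p = ε`. -/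
theorem tendsto_integral_exterior {a : ℝ} (ha : 0 < a) (i : ℕ) {B : ℝ × ℝ → ℂ}
    (hB : ContDiff ℝ 2 B) (hBk : ContDiff ℝ (i + 1 : ℕ) B) (hBs : HasCompactSupport B)
    {c : ℝ} (hc : 0 < c) (hBc : ∀ x : ℝ × ℝ, x.1 < c → B x = 0) :
    Tendsto (fun ε : ℝ => ∫ ζ : ℝ, ∫ s in Set.Ioi (spheroidGraph a ε ζ),
        (cylSq a (s, ζ) ^ (i + 1))⁻¹ * cylLaplacian (i + 1) B (s, ζ)) (𝓝[>] 0)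
      (𝓝 (2 * Real.pi * Complex.I / i.factorial *
        (iteratedDeriv i (fun s => partialSnd B (s, 0)) (a ^ 2) +
          2 * a * Complex.I * iteratedDeriv (i + 1) (fun s => B (s, 0)) (a ^ 2)))) := by
  have hR : ContDiff ℝ i (radialFlux (i + 1) B) := hBk.radialFlux _ (by norm_cast)
  have hS : ContDiff ℝ (i + 1 : ℕ) (fun x : ℝ × ℝ => (x.1 : ℂ) * B x) :=
    contDiff_ofReal_fst.mul hBk
  have hQ : ContDiff ℝ i (partialSnd B) := hBk.partialSnd (by norm_cast)
  have hQ1 : ContDiff ℝ 1 (partialSnd B) := hB.partialSnd (by norm_num)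
  have hZ : ContDiff ℝ (i + 1 : ℕ) (fun x : ℝ × ℝ => ((x.2 : ℂ) + a * Complex.I) * B x) :=
    (contDiff_ofReal_snd.add contDiff_const).mul hBk
  have hZ1 : ContDiff ℝ 1 (fun x : ℝ × ℝ => ((x.2 : ℂ) + a * Complex.I) * B x) :=
    (contDiff_ofReal_snd.add contDiff_const).mul (hB.of_le one_le_two)
  -- The s-component of the flux keeps the factor ε of dζ = (ε/a) dq and disappears. Both exponents
  -- sit exactly on the border l = m + 1 + 2r.
  have t1 := tendsto_pow_mul_spheroidIntegral ha i (m := 1) (l := 2 * i + 2) le_rfl (by omega) hR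
  have t2 := tendsto_pow_mul_spheroidIntegral ha (i + 1) (m := 1) (l := 2 * (i + 1) + 2) le_rfl
    (by omega) hS
  have t3 := tendsto_integral_mul_inv_pow ha i hQ hQ1
  have t4 := tendsto_integral_mul_inv_pow ha (i + 1) hZ hZ1
  -- In the ζ-component the slope 2(a²+ε²)ζ/ε² times dζ/dq is 2(a²+ε²)q/a²: no factor ε is left, so
  -- this component survives.
  have tc : Tendsto (fun ε : ℝ => (2 * ((a : ℂ) ^ 2 + ε ^ 2) / a ^ 2)) (𝓝[>] 0) (𝓝 2) := by
    have h1 : Continuous fun ε : ℝ => (2 * ((a : ℂ) ^ 2 + ε ^ 2) / a ^ 2) := by fun_prop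
    have h2 := h1.tendsto 0
    have h3 : (a : ℂ) ≠ 0 := by exact_mod_cast ha.ne'
    have h4 : (2 * ((a : ℂ) ^ 2 + ((0 : ℝ) : ℂ) ^ 2) / a ^ 2) = 2 := by
      simp only [Complex.ofReal_zero]
      field_simp
      ring
    rw [h4] at h2
    exact h2.mono_left nhdsWithin_le_nhds
  have key := (((t1.add (t2.const_mul (4 * (i + 1 : ℕ) : ℂ))).const_mul (a : ℂ)⁻¹).add
    (tc.mul (t3.add (t4.const_mul (2 * (i + 1 : ℕ) : ℂ))))).neg
  have hlim : -((a : ℂ)⁻¹ * (0 + 4 * (i + 1 : ℕ) * 0) + 2 * (-Complex.I * (Real.pi *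
      iteratedDeriv i (fun s => partialSnd B (s, 0)) (a ^ 2) / i.factorial) +
      2 * (i + 1 : ℕ) * (-Complex.I * (Real.pi * iteratedDeriv (i + 1) (fun s : ℝ =>
        ((((s, 0) : ℝ × ℝ).2 : ℂ) + a * Complex.I) * B (s, 0)) (a ^ 2) / (i + 1).factorial)))) =
      2 * Real.pi * Complex.I / i.factorial *
        (iteratedDeriv i (fun s => partialSnd B (s, 0)) (a ^ 2) +
          2 * a * Complex.I * iteratedDeriv (i + 1) (fun s => B (s, 0)) (a ^ 2)) := by
    have h1 : iteratedDeriv (i + 1) (fun s : ℝ =>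
        ((((s, 0) : ℝ × ℝ).2 : ℂ) + a * Complex.I) * B (s, 0)) (a ^ 2) =
        a * Complex.I * iteratedDeriv (i + 1) (fun s => B (s, 0)) (a ^ 2) := by
      simp only [Complex.ofReal_zero, zero_add]
      rw [iteratedDeriv_const_mul_field]
    have h2 : (i + 1 : ℂ) ≠ 0 := by exact_mod_cast Nat.succ_ne_zero i
    have h3 : (i.factorial : ℂ) ≠ 0 := by exact_mod_cast i.factorial_ne_zero
    rw [h1, Nat.factorial_succ]
    push_cast
    field_simp
    ring
  rw [hlim] at key
  refine key.congr' ?_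
  filter_upwards [self_mem_nhdsWithin] with ε hε
  have hε : 0 < ε := hε
  have hεa : 0 < ε / a := div_pos hε ha
  rw [integral_exterior_eq_integral_spheroid ha (i + 1) hB hBs hc hBc hε]
  have hsub := intervalIntegral.smul_integral_comp_mul_left (a := -a) (b := a)
    (fun ζ : ℝ => -(greenFst a (i + 1) B (spheroidGraph a ε ζ, ζ) +
        (2 * (a ^ 2 + ε ^ 2) * ζ / ε ^ 2 : ℝ) * greenSnd a (i + 1) B (spheroidGraph a ε ζ, ζ)))
    (ε / a)
  rw [mul_neg, div_mul_cancel₀ _ ha.ne'] at hsub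
  rw [← hsub]
  have hI1 := intervalIntegrable_curveIntegrand (a := a) hε (2 * i + 2) hR.continuous
  have hI2 := intervalIntegrable_curveIntegrand (a := a) hε (2 * (i + 1) + 2) hS.continuous
  have hq : ∀ {u : ℝ → ℂ}, IntervalIntegrable u volume (-a) a →
      IntervalIntegrable (fun q : ℝ => (q : ℂ) * u q) volume (-a) a := fun h =>
    h.continuousOn_mul Complex.continuous_ofReal.continuousOn
  have hI3 := hq (intervalIntegrable_curveIntegrand (a := a) hε (2 * i + 2) hQ.continuous)
  have hI4 := hq (intervalIntegrable_curveIntegrand (a := a) hε (2 * (i + 1) + 2) hZ.continuous)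
  rw [spheroidIntegral, spheroidIntegral]
  simp only [← intervalIntegral.integral_const_mul]
  rw [← intervalIntegral.integral_add (hI1.const_mul _) ((hI2.const_mul _).const_mul _),
    ← intervalIntegral.integral_const_mul, ← intervalIntegral.integral_add hI3 (hI4.const_mul _),
    ← intervalIntegral.integral_const_mul, ← intervalIntegral.integral_add
      (((hI1.const_mul _).add ((hI2.const_mul _).const_mul _)).const_mul _)
      ((hI3.add (hI4.const_mul _)).const_mul _), ← intervalIntegral.integral_neg,
    ← intervalIntegral.integral_smul]
  refine intervalIntegral.integral_congr fun q _ => ?_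
  have ha' : (a : ℂ) ≠ 0 := by exact_mod_cast ha.ne'
  have hε' : (ε : ℂ) ≠ 0 := by exact_mod_cast hε.ne'
  have hp1 : (spheroidPoint a ε q).1 = spheroidGraph a ε (ε / a * q) := by
    rw [← spheroidGraph_eps_mul hε.ne']
  have hp2 : (spheroidPoint a ε q).2 = ε / a * q := by
    rw [← spheroidGraph_eps_mul hε.ne']
  simp only [greenFst, greenSnd, spheroidGraph_eps_mul hε.ne', cylSq_spheroidPoint ha.ne',
    ← pow_mul, Complex.real_smul, hp1, hp2]
  rw [show 2 * (i + 1 + 1) = 2 * (i + 1) + 2 by ring, show 2 * (i + 1) = 2 * i + 2 by ring]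
  generalize ((ε + q * Complex.I : ℂ) ^ (2 * i + 2))⁻¹ = w₁
  generalize ((ε + q * Complex.I : ℂ) ^ (2 * i + 2 + 2))⁻¹ = w₂
  push_cast
  field_simp

end Green

/-! ### Integration in cylindrical coordinates -/

section Cylindrical

/-- Integration in polar coordinates. -/
theorem integral_eq_integral_Ioi_integral_sphere {E F : Type*} [NormedAddCommGroup E]
    [NormedSpace ℝ E] [MeasurableSpace E] [BorelSpace E] [FiniteDimensional ℝ E] [Nontrivial E]
    (μ : Measure E) [μ.IsAddHaarMeasure] [NormedAddCommGroup F] [NormedSpace ℝ F]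
    {g : E → F} (hg : Integrable g μ) :
    ∫ x, g x ∂μ = ∫ r in Set.Ioi (0 : ℝ), r ^ (Module.finrank ℝ E - 1) •
      ∫ σ : Metric.sphere (0 : E) 1, g (r • (σ : E)) ∂μ.toSphere := by
  have hmp := μ.measurePreserving_homeomorphUnitSphereProd
  have hemb := (homeomorphUnitSphereProd E).measurableEmbedding
  set h : Metric.sphere (0 : E) 1 × Set.Ioi (0 : ℝ) → F := fun z => g ((z.2 : ℝ) • (z.1 : E))
  have hcomp : ∀ x : ({(0 : E)}ᶜ : Set E), h (homeomorphUnitSphereProd E x) = g x := fun x => by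
    have h1 := (homeomorphUnitSphereProd E).symm_apply_apply x
    conv_rhs => rw [← h1]
    rw [homeomorphUnitSphereProd_symm_apply_coe]
  have hint : Integrable h (μ.toSphere.prod (.volumeIoiPow (Module.finrank ℝ E - 1))) := by
    rw [← hmp.integrable_comp_emb hemb]
    have h2 : (h ∘ homeomorphUnitSphereProd E) = fun x : ({(0 : E)}ᶜ : Set E) => g x :=
      funext hcomp
    rw [h2]
    have h3 : IntegrableOn g ({(0 : E)}ᶜ : Set E) μ := hg.integrableOn
    rwa [integrableOn_iff_comap_subtypeVal (measurableSet_singleton _).compl] at h3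
  calc ∫ x, g x ∂μ = ∫ x : ({(0 : E)}ᶜ : Set E), g x ∂(μ.comap (↑)) := by
        rw [integral_subtype_comap (measurableSet_singleton _).compl, restrict_compl_singleton]
    _ = ∫ z, h z ∂(μ.toSphere.prod (.volumeIoiPow (Module.finrank ℝ E - 1))) := by
        rw [← hmp.integral_comp hemb]
        simp only [hcomp]
    _ = ∫ r : Set.Ioi (0 : ℝ), ∫ σ, h (σ, r) ∂μ.toSphere
          ∂(.volumeIoiPow (Module.finrank ℝ E - 1)) := integral_prod_symm _ hint
    _ = _ := by
        simp only [Measure.volumeIoiPow, ENNReal.ofReal]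
        rw [integral_withDensity_eq_integral_smul,
          integral_subtype_comap measurableSet_Ioi fun a : ℝ =>
            Real.toNNReal (a ^ (Module.finrank ℝ E - 1)) • ∫ σ : Metric.sphere (0 : E) 1,
              g (a • (σ : E)) ∂μ.toSphere,
          setIntegral_congr_fun measurableSet_Ioi fun x hx => ?_]
        · rw [NNReal.smul_def, Real.coe_toNNReal _ (pow_nonneg (Set.mem_Ioi.1 hx).le _)]
        · exact (measurable_subtype_coe.pow_const _).real_toNNReal

variable {n : ℕ}

/-- The unit vector in the direction of `y`. -/
noncomputable def unitDir (y : RSpace n) : RSpace n := ‖y‖⁻¹ • y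

theorem norm_unitDir {y : RSpace n} (hy : y ≠ 0) : ‖unitDir y‖ = 1 := by
  rw [unitDir, norm_smul, norm_inv, norm_norm, inv_mul_cancel₀ (norm_ne_zero_iff.2 hy)]

theorem span_unitDir {y : RSpace n} (hy : y ≠ 0) :
    Submodule.span ℝ {unitDir y} = Submodule.span ℝ {y} :=
  Submodule.span_singleton_smul_eq (IsUnit.mk0 _ (inv_ne_zero (norm_ne_zero_iff.2 hy))) y

theorem inner_unitDir_orth {y : RSpace n} (v : (Submodule.span ℝ {y})ᗮ) :
    inner ℝ (unitDir y) (v : RSpace n) = 0 := by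
  rw [unitDir, inner_smul_left, Submodule.mem_orthogonal_singleton_iff_inner_right.1 v.2, mul_zero]

/-- The decomposition of a vector into its components along and orthogonal to `y`. -/
theorem measurePreserving_add_smul_unitDir {y : RSpace n} (hy : y ≠ 0) :
    MeasurePreserving (fun z : ℝ × (Submodule.span ℝ {y})ᗮ => (z.2 : RSpace n) + z.1 • unitDir y)
      volume volume := by
  have h1 : unitDir y ∈ Submodule.span ℝ {y} := by
    rw [← span_unitDir hy]
    exact Submodule.mem_span_singleton_self _
  let e₁ : ℝ ≃ₗᵢ[ℝ] Submodule.span ℝ {y} :=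
    (LinearIsometryEquiv.toSpanUnitSingleton (unitDir y) (norm_unitDir hy)).trans
      (LinearIsometryEquiv.ofEq _ _ (span_unitDir hy))
  let e : WithLp 2 (ℝ × (Submodule.span ℝ {y})ᗮ) ≃ₗᵢ[ℝ] RSpace n :=
    (LinearIsometryEquiv.withLpProdCongr 2 e₁ (LinearIsometryEquiv.refl ℝ _)).trans
      (Submodule.span ℝ {y}).orthogonalDecomposition.symm
  have h2 := e.measurePreserving.comp (WithLp.volume_preserving_toLp ℝ (Submodule.span ℝ {y})ᗮ)
  have h3 : (fun z : ℝ × (Submodule.span ℝ {y})ᗮ => (z.2 : RSpace n) + z.1 • unitDir y) =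
      e ∘ WithLp.toLp 2 := by
    funext z
    rw [add_comm]
    change _ = ((e₁ z.1 : Submodule.span ℝ {y}) : RSpace n) + (z.2 : RSpace n)
    simp [e₁]
  rw [h3]
  exact h2

theorem finrank_orth {k : ℕ} (hn : n = 2 * k + 2) {y : RSpace n} (hy : y ≠ 0) :
    Module.finrank ℝ (Submodule.span ℝ {y})ᗮ = 2 * k + 1 := by
  have : Fact (Module.finrank ℝ (RSpace n) = 2 * k + 1 + 1) := ⟨by simp [hn]⟩
  exact Submodule.finrank_orthogonal_span_singleton hy

theorem orthSphereMeasure_eq (y : RSpace n) :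
    orthSphereMeasure y = (volume : Measure (Submodule.span ℝ {y})ᗮ).toSphere := by
  rw [orthSphereMeasure, OrthonormalBasis.addHaar_eq_volume]

theorem isFiniteMeasure_orthSphereMeasure (y : RSpace n) :
    IsFiniteMeasure (orthSphereMeasure y) := by
  rw [orthSphereMeasure_eq]
  infer_instance

theorem integral_orthSphere_eq {k : ℕ} (hn : n = 2 * k + 2) {y : RSpace n} (hy : y ≠ 0)
    (G : RSpace n → ℂ) (ρ ζ : ℝ) :
    ∫ σ : Metric.sphere (0 : (Submodule.span ℝ {y})ᗮ) 1,
      G (ρ • ((σ : (Submodule.span ℝ {y})ᗮ) : RSpace n) + ζ • unitDir y) ∂(orthSphereMeasure y) =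
      (orthSphereMeasure y).real Set.univ * sphMean y G ρ ζ := by
  have := isFiniteMeasure_orthSphereMeasure y
  have hnt : Nontrivial (Submodule.span ℝ {y})ᗮ :=
    Module.nontrivial_of_finrank_pos (R := ℝ) (by rw [finrank_orth hn hy]; omega)
  have h0 : (orthSphereMeasure y).real Set.univ ≠ 0 := by
    rw [orthSphereMeasure_eq, Measure.real, ENNReal.toReal_ne_zero]
    exact ⟨Measure.measure_univ_ne_zero.2
      (Measure.toSphere_ne_zero (volume : Measure (Submodule.span ℝ {y})ᗮ)),
      measure_ne_top _ _⟩
  rw [sphMean, average_eq, Complex.real_smul, ← mul_assoc, ← Complex.ofReal_mul,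
    mul_inv_cancel₀ h0]
  simp [unitDir]

/-- Integration in cylindrical coordinates `s = ρ²`, `ζ` around the axis spanned by `y`. -/
theorem integral_cylindrical {k : ℕ} (hk : 1 ≤ k) (hn : n = 2 * k + 2) {y : RSpace n} (hy : y ≠ 0)
    {G : RSpace n → ℂ} (hG : Integrable G) :
    ∫ x, G x = (((orthSphereMeasure y).real Set.univ / 2 : ℝ) : ℂ) * ∫ ζ : ℝ,
      ∫ s in Set.Ioi (0 : ℝ), ((√s ^ (2 * k - 1) : ℝ) : ℂ) * sphMean y G (√s) ζ := by
  have hmp := measurePreserving_add_smul_unitDir hy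
  have hnt : Nontrivial (Submodule.span ℝ {y})ᗮ :=
    Module.nontrivial_of_finrank_pos (R := ℝ) (by rw [finrank_orth hn hy]; omega)
  have h1 : ∫ x, G x =
      ∫ z : ℝ × (Submodule.span ℝ {y})ᗮ, G ((z.2 : RSpace n) + z.1 • unitDir y) := by
    rw [← integral_map hmp.aemeasurable (by rw [hmp.map_eq]; exact hG.aestronglyMeasurable),
      hmp.map_eq]
  have hint : Integrable (fun z : ℝ × (Submodule.span ℝ {y})ᗮ =>
      G ((z.2 : RSpace n) + z.1 • unitDir y)) (volume.prod volume) :=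
    hmp.integrable_comp_of_integrable hG
  rw [h1, Measure.volume_eq_prod, integral_prod _ hint, ← integral_const_mul]
  refine integral_congr_ae ?_
  filter_upwards [hint.prod_right_ae] with ζ hζ
  rw [integral_eq_integral_Ioi_integral_sphere _ hζ, finrank_orth hn hy, Nat.add_sub_cancel,
    ← integral_const_mul]
  simp only [← orthSphereMeasure_eq, Submodule.coe_smul, integral_orthSphere_eq hn hy]
  -- With s = r² the density r^{2k} dr becomes (1/2) s^{k-1/2} ds, which accounts for both the half
  -- and the exponent 2k - 1 of √s.
  rw [← integral_comp_rpow_Ioi (fun s : ℝ => (((orthSphereMeasure y).real Set.univ / 2 : ℝ) : ℂ) *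
    (((√s ^ (2 * k - 1) : ℝ) : ℂ) * sphMean y G (√s) ζ)) (p := 2) two_ne_zero]
  refine setIntegral_congr_fun measurableSet_Ioi fun r hr => ?_
  have hr : 0 < r := hr
  have h2 : (2 : ℝ) - 1 = 1 := by norm_num
  obtain ⟨k, rfl⟩ := Nat.exists_eq_add_of_le' hk
  simp only [Real.rpow_two, Real.sqrt_sq hr.le, h2, Real.rpow_one, Complex.real_smul,
    show 2 * (k + 1) - 1 = 2 * k + 1 by omega]
  push_cast
  rw [abs_of_pos two_pos]
  push_cast
  ring

/-- The dimension 2k + 1 times the volume of the unit ball. The factor √π/Γ(k+1/2) of the final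
formula originates here. -/
theorem measureReal_orthSphere {k : ℕ} (hn : n = 2 * k + 2) {y : RSpace n} (hy : y ≠ 0) :
    (orthSphereMeasure y).real Set.univ =
      2 * Real.pi ^ k * √Real.pi / Real.Gamma (k + 1 / 2) := by
  have hnt : Nontrivial (Submodule.span ℝ {y})ᗮ :=
    Module.nontrivial_of_finrank_pos (R := ℝ) (by rw [finrank_orth hn hy]; omega)
  rw [orthSphereMeasure_eq, Measure.toSphere_real_apply_univ, Measure.real,
    InnerProductSpace.volume_ball, finrank_orth hn hy]
  have h1 : Real.Gamma (((2 * k + 1 : ℕ) : ℝ) / 2 + 1) =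
      (k + 1 / 2) * Real.Gamma (k + 1 / 2) := by
    rw [← Real.Gamma_add_one (by positivity)]
    congr 1
    push_cast
    ring
  have h2 : 0 < Real.Gamma ((k : ℝ) + 1 / 2) := Real.Gamma_pos_of_pos (by positivity)
  rw [h1, ENNReal.ofReal_one, one_pow, one_mul, ENNReal.toReal_ofReal (by positivity)]
  have h3 : √Real.pi ^ (2 * k + 1) = Real.pi ^ k * √Real.pi := by
    rw [pow_succ, pow_mul, Real.sq_sqrt Real.pi_pos.le]
  rw [h3]
  push_cast
  have h4 : (2 * k + 1 : ℝ) ≠ 0 := by positivity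
  field_simp
  try ring

end Cylindrical

/-! ### Spherical means and their weighted version -/

section Cylindrical

variable {n : ℕ}

/-- The linear map `(ρ, ζ) ↦ ρ σ + ζ ŷ`. -/
noncomputable def cylMap (y : RSpace n) (σ : Metric.sphere (0 : (Submodule.span ℝ {y})ᗮ) 1) :
    ℝ × ℝ →L[ℝ] RSpace n :=
  (ContinuousLinearMap.fst ℝ ℝ ℝ).smulRight ((σ : (Submodule.span ℝ {y})ᗮ) : RSpace n) +
    (ContinuousLinearMap.snd ℝ ℝ ℝ).smulRight (unitDir y)

theorem cylMap_apply (y : RSpace n) (σ : Metric.sphere (0 : (Submodule.span ℝ {y})ᗮ) 1)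
    (x : ℝ × ℝ) : cylMap y σ x =
      x.1 • ((σ : (Submodule.span ℝ {y})ᗮ) : RSpace n) + x.2 • unitDir y := rfl

theorem continuous_cylMap (y : RSpace n) : Continuous (cylMap y) := by
  refine Continuous.add ?_ continuous_const
  exact (ContinuousLinearMap.smulRightL ℝ (ℝ × ℝ) (RSpace n)
    (ContinuousLinearMap.fst ℝ ℝ ℝ)).continuous.comp
    (continuous_subtype_val.comp continuous_subtype_val)

theorem norm_orthSphere (y : RSpace n) (σ : Metric.sphere (0 : (Submodule.span ℝ {y})ᗮ) 1) :
    ‖((σ : (Submodule.span ℝ {y})ᗮ) : RSpace n)‖ = 1 := by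
  have := σ.2
  rwa [mem_sphere_zero_iff_norm] at this

theorem norm_cylMap_apply_sq {y : RSpace n} (hy : y ≠ 0)
    (σ : Metric.sphere (0 : (Submodule.span ℝ {y})ᗮ) 1) (x : ℝ × ℝ) :
    ‖cylMap y σ x‖ ^ 2 = x.1 ^ 2 + x.2 ^ 2 := by
  rw [cylMap_apply, norm_add_sq_real, norm_smul, norm_smul, norm_orthSphere, norm_unitDir hy,
    inner_smul_left, inner_smul_right, real_inner_comm, inner_unitDir_orth]
  simp

theorem inner_cylMap_unitDir {y : RSpace n} (hy : y ≠ 0)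
    (σ : Metric.sphere (0 : (Submodule.span ℝ {y})ᗮ) 1) (x : ℝ × ℝ) :
    inner ℝ (cylMap y σ x) (unitDir y) = x.2 := by
  rw [cylMap_apply, inner_add_left, inner_smul_left, inner_smul_left, real_inner_comm,
    inner_unitDir_orth, real_inner_self_eq_norm_sq, norm_unitDir hy]
  simp

theorem norm_cylMap_le {y : RSpace n} (hy : y ≠ 0)
    (σ : Metric.sphere (0 : (Submodule.span ℝ {y})ᗮ) 1) : ‖cylMap y σ‖ ≤ 2 := by
  refine ContinuousLinearMap.opNorm_le_bound _ zero_le_two fun x => ?_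
  rw [cylMap_apply]
  refine (norm_add_le _ _).trans ?_
  rw [norm_smul, norm_smul, norm_orthSphere, norm_unitDir hy]
  have := norm_fst_le x
  have := norm_snd_le x
  linarith

/-- The squared distance from the axis spanned by `y`. -/
noncomputable def perpSq (y x : RSpace n) : ℝ := ‖x‖ ^ 2 - inner ℝ x (unitDir y) ^ 2

theorem perpSq_cylMap {y : RSpace n} (hy : y ≠ 0)
    (σ : Metric.sphere (0 : (Submodule.span ℝ {y})ᗮ) 1) (x : ℝ × ℝ) :
    perpSq y (cylMap y σ x) = x.1 ^ 2 := by
  rw [perpSq, norm_cylMap_apply_sq hy, inner_cylMap_unitDir hy]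
  ring

theorem contDiff_perpSq {m : WithTop ℕ∞} (y : RSpace n) : ContDiff ℝ m (perpSq y) :=
  (contDiff_norm_sq ℝ).sub ((contDiff_id.inner ℝ contDiff_const).pow 2)

/-- The normalized surface measure on the unit sphere of the hyperplane orthogonal to `y`. -/
noncomputable def orthSphereProb (y : RSpace n) :
    Measure (Metric.sphere (0 : (Submodule.span ℝ {y})ᗮ) 1) :=
  (orthSphereMeasure y Set.univ)⁻¹ • orthSphereMeasure y

theorem sphMean_eq_integral (y : RSpace n) (f : RSpace n → ℂ) (x : ℝ × ℝ) :
    sphMean y f x.1 x.2 = ∫ σ, f (cylMap y σ x) ∂(orthSphereProb y) := rfl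

theorem isProbabilityMeasure_orthSphereProb {k : ℕ} (hn : n = 2 * k + 2) {y : RSpace n}
    (hy : y ≠ 0) : IsProbabilityMeasure (orthSphereProb y) := by
  have := isFiniteMeasure_orthSphereMeasure y
  have hnt : Nontrivial (Submodule.span ℝ {y})ᗮ :=
    Module.nontrivial_of_finrank_pos (R := ℝ) (by rw [finrank_orth hn hy]; omega)
  have : NeZero (orthSphereMeasure y) := ⟨by
    rw [orthSphereMeasure_eq]
    exact Measure.toSphere_ne_zero _⟩
  rw [orthSphereProb]
  infer_instance

theorem contDiff_sphMean {k : ℕ} (hn : n = 2 * k + 2) {y : RSpace n} (hy : y ≠ 0) {r : ℕ}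
    {f : RSpace n → ℂ} (hf : ContDiff ℝ r f) :
    ContDiff ℝ r (fun x : ℝ × ℝ => sphMean y f x.1 x.2) := by
  have := isProbabilityMeasure_orthSphereProb hn hy
  exact contDiff_integral_comp_clm _ hf (continuous_cylMap y)

theorem norm_iteratedFDeriv_sphMean_le {k : ℕ} (hn : n = 2 * k + 2) {y : RSpace n} (hy : y ≠ 0)
    {r : ℕ} {f : RSpace n → ℂ} (hf : ContDiff ℝ r f) {m : ℕ} (hm : m ≤ r) (x : ℝ × ℝ) {M : ℝ}
    (hM : ∀ σ, ‖iteratedFDeriv ℝ m f (cylMap y σ x)‖ ≤ M) :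
    ‖iteratedFDeriv ℝ m (fun x : ℝ × ℝ => sphMean y f x.1 x.2) x‖ ≤ M * 2 ^ m := by
  have := isProbabilityMeasure_orthSphereProb hn hy
  have := norm_iteratedFDeriv_integral_comp_clm_le (orthSphereProb y) hf (continuous_cylMap y)
    hm x (norm_cylMap_le hy) hM
  rw [probReal_univ, mul_one] at this
  exact this

theorem fderiv_sphMean_apply {k : ℕ} (hn : n = 2 * k + 2) {y : RSpace n} (hy : y ≠ 0)
    {f : RSpace n → ℂ} (hf : ContDiff ℝ 1 f) (x v : ℝ × ℝ) :
    fderiv ℝ (fun x : ℝ × ℝ => sphMean y f x.1 x.2) x v =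
      ∫ σ, fderiv ℝ f (cylMap y σ x) (cylMap y σ v) ∂(orthSphereProb y) := by
  have := isProbabilityMeasure_orthSphereProb hn hy
  exact fderiv_integral_comp_clm_apply _ hf (continuous_cylMap y) x v

/-- The weighted spherical mean `s^{k-1/2} f̄(√s, ζ)`. -/
noncomputable def weightedMean (k : ℕ) (y : RSpace n) (f : RSpace n → ℂ) (x : ℝ × ℝ) : ℂ :=
  ((√x.1 ^ (2 * k - 1) : ℝ) : ℂ) * sphMean y f (√x.1) x.2

theorem weightedMean_eq_zero_of_lt {k : ℕ} {y : RSpace n} (hy : y ≠ 0) {f : RSpace n → ℂ}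
    {c : ℝ} (hc : 0 < c) (hfc : ∀ x, perpSq y x < c → f x = 0) {x : ℝ × ℝ} (hx : x.1 < c) :
    weightedMean k y f x = 0 := by
  have h1 : √x.1 ^ 2 < c := by
    rcases le_or_gt 0 x.1 with h | h
    · rwa [Real.sq_sqrt h]
    · rwa [Real.sqrt_eq_zero_of_nonpos h.le, zero_pow two_ne_zero]
  have h2 : sphMean y f (√x.1) x.2 = 0 := by
    have := sphMean_eq_integral y f (√x.1, x.2)
    simp only at this
    rw [this, integral_congr_ae (g := fun _ => (0 : ℂ)) (Eventually.of_forall fun σ => hfc _ ?_),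
      integral_zero]
    rwa [perpSq_cylMap hy]
  rw [weightedMean, h2, mul_zero]

theorem weightedMean_eq_zero_of_gt {k : ℕ} {y : RSpace n} (hy : y ≠ 0) {f : RSpace n → ℂ}
    {R : ℝ} (hR : ∀ x, R < ‖x‖ ^ 2 → f x = 0) {x : ℝ × ℝ} (hx0 : 0 ≤ x.1)
    (hx : R < x.1 + x.2 ^ 2) : weightedMean k y f x = 0 := by
  have h2 : sphMean y f (√x.1) x.2 = 0 := by
    have := sphMean_eq_integral y f (√x.1, x.2)
    simp only at this
    rw [this, integral_congr_ae (g := fun _ => (0 : ℂ)) (Eventually.of_forall fun σ => hR _ ?_),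
      integral_zero]
    rwa [norm_cylMap_apply_sq hy, Real.sq_sqrt hx0]
  rw [weightedMean, h2, mul_zero]

theorem contDiffAt_weightedMean {k : ℕ} (hn : n = 2 * k + 2) {y : RSpace n} (hy : y ≠ 0) {r : ℕ}
    {f : RSpace n → ℂ} (hf : ContDiff ℝ r f) {x : ℝ × ℝ} (hx : 0 < x.1) :
    ContDiffAt ℝ r (weightedMean k y f) x := by
  have h1 : ContDiffAt ℝ r (fun x : ℝ × ℝ => √x.1) x := contDiffAt_fst.sqrt hx.ne'
  exact (Complex.ofRealCLM.contDiff.contDiffAt.comp x (h1.pow _)).mul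
    ((contDiff_sphMean hn hy hf).contDiffAt.comp x (h1.prodMk contDiffAt_snd))

/-- The square root is smooth only for s > 0; vanishing of f near the axis lets the mean continue by
zero to s ≤ 0. -/
theorem contDiff_weightedMean {k : ℕ} (hn : n = 2 * k + 2) {y : RSpace n} (hy : y ≠ 0) {r : ℕ}
    {f : RSpace n → ℂ} (hf : ContDiff ℝ r f) {c : ℝ} (hc : 0 < c)
    (hfc : ∀ x, perpSq y x < c → f x = 0) : ContDiff ℝ r (weightedMean k y f) := by
  refine contDiff_iff_contDiffAt.2 fun x => ?_
  rcases lt_or_ge 0 x.1 with hx | hx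
  · exact contDiffAt_weightedMean hn hy hf hx
  · refine contDiffAt_const (c := (0 : ℂ)) |>.congr_of_eventuallyEq ?_
    filter_upwards [(isOpen_lt continuous_fst continuous_const).mem_nhds (hx.trans_lt hc)] with z hz
    exact weightedMean_eq_zero_of_lt hy hc hfc hz

theorem hasCompactSupport_weightedMean {k : ℕ} {y : RSpace n} (hy : y ≠ 0)
    {f : RSpace n → ℂ} (hf : HasCompactSupport f) {c : ℝ} (hc : 0 < c)
    (hfc : ∀ x, perpSq y x < c → f x = 0) : HasCompactSupport (weightedMean k y f) := by
  obtain ⟨R, hR⟩ := hf.isCompact.isBounded.subset_closedBall 0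
  have hR' : ∀ x, R ^ 2 < ‖x‖ ^ 2 → f x = 0 := fun x hx => by
    refine image_eq_zero_of_notMem_tsupport fun h => ?_
    have := hR h
    rw [mem_closedBall_zero_iff] at this
    have h2 : ‖x‖ ^ 2 ≤ R ^ 2 := by gcongr
    exact absurd hx (not_lt.2 h2)
  refine HasCompactSupport.of_support_subset_isCompact
    ((isCompact_Icc (a := 0) (b := R ^ 2)).prod (isCompact_Icc (a := -|R|) (b := |R|))) ?_
  intro x hx
  have h1 : c ≤ x.1 := not_lt.1 fun h => hx (weightedMean_eq_zero_of_lt hy hc hfc h)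
  have h0 : 0 ≤ x.1 := hc.le.trans h1
  have h2 : x.1 + x.2 ^ 2 ≤ R ^ 2 := not_lt.1 fun h => hx (weightedMean_eq_zero_of_gt hy hR' h0 h)
  refine ⟨⟨h0, by have := sq_nonneg x.2; linarith⟩, abs_le.1 (sq_le_sq.1 (by linarith))⟩

/-- The term -(k - 1/2)B cancels the derivative of the weight, leaving s^{k-1/2} · 4s∂ₛu, and 2s∂ₛ =
ρ∂_ρ. -/
theorem radialFlux_weightedMean {k : ℕ} (hk : 1 ≤ k) (hn : n = 2 * k + 2) {y : RSpace n}
    (hy : y ≠ 0) {f : RSpace n → ℂ} (hf : ContDiff ℝ 1 f) {x : ℝ × ℝ} (hx : 0 < x.1) :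
    radialFlux k (weightedMean k y f) x = ((√x.1 ^ (2 * k - 1) : ℝ) : ℂ) * (2 * √x.1 *
      fderiv ℝ (fun x : ℝ × ℝ => sphMean y f x.1 x.2) (√x.1, x.2) (1, 0)) := by
  have hs : 0 < √x.1 := Real.sqrt_pos.2 hx
  have h1 : HasFDerivAt (fun x : ℝ × ℝ => √x.1) _ x := hasFDerivAt_fst.sqrt hx.ne'
  have h2 : HasFDerivAt (fun x : ℝ × ℝ => ((√x.1 ^ (2 * k - 1) : ℝ) : ℂ)) _ x :=
    Complex.ofRealCLM.hasFDerivAt.comp x (h1.pow (2 * k - 1))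
  have h3 : HasFDerivAt (fun x : ℝ × ℝ => sphMean y f (√x.1) x.2) _ x :=
    HasFDerivAt.comp (g := fun x : ℝ × ℝ => sphMean y f x.1 x.2) x
      (((contDiff_sphMean (r := 1) hn hy hf).differentiable one_ne_zero
        (√x.1, x.2)).hasFDerivAt) (h1.prodMk hasFDerivAt_snd)
  have h4 : HasFDerivAt (weightedMean k y f) _ x := h2.mul h3
  rw [radialFlux, partialFst, h4.fderiv, weightedMean]
  obtain ⟨k, rfl⟩ := Nat.exists_eq_add_of_le' hk
  simp only [show 2 * (k + 1) - 1 = 2 * k + 1 by omega, add_apply, smul_apply,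
    ContinuousLinearMap.comp_apply, ContinuousLinearMap.prod_apply, ContinuousLinearMap.coe_fst',
    ContinuousLinearMap.coe_snd', smul_eq_mul, Complex.ofRealCLM_apply, nsmul_eq_mul,
    Nat.add_sub_cancel]
  rw [show ((1 / (2 * √x.1) * 1, 0) : ℝ × ℝ) = (1 / (2 * √x.1)) • ((1, 0) : ℝ × ℝ) by simp,
    map_smul, Complex.real_smul]
  have hx2 : (x.1 : ℂ) = (√x.1 : ℂ) ^ 2 := by
    rw [← Complex.ofReal_pow, Real.sq_sqrt hx.le]
  have hs' : (√x.1 : ℂ) ≠ 0 := by exact_mod_cast hs.ne'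
  rw [hx2]
  push_cast
  field_simp
  ring

theorem partialSnd_weightedMean {k : ℕ} (hn : n = 2 * k + 2) {y : RSpace n}
    (hy : y ≠ 0) {f : RSpace n → ℂ} (hf : ContDiff ℝ 1 f) {x : ℝ × ℝ} (hx : 0 < x.1) :
    partialSnd (weightedMean k y f) x = ((√x.1 ^ (2 * k - 1) : ℝ) : ℂ) *
      fderiv ℝ (fun x : ℝ × ℝ => sphMean y f x.1 x.2) (√x.1, x.2) (0, 1) := by
  have h1 : HasFDerivAt (fun x : ℝ × ℝ => √x.1) _ x := hasFDerivAt_fst.sqrt hx.ne'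
  have h2 : HasFDerivAt (fun x : ℝ × ℝ => ((√x.1 ^ (2 * k - 1) : ℝ) : ℂ)) _ x :=
    Complex.ofRealCLM.hasFDerivAt.comp x (h1.pow (2 * k - 1))
  have h3 : HasFDerivAt (fun x : ℝ × ℝ => sphMean y f (√x.1) x.2) _ x :=
    HasFDerivAt.comp (g := fun x : ℝ × ℝ => sphMean y f x.1 x.2) x
      (((contDiff_sphMean (r := 1) hn hy hf).differentiable one_ne_zero
        (√x.1, x.2)).hasFDerivAt) (h1.prodMk hasFDerivAt_snd)
  have h4 : HasFDerivAt (weightedMean k y f) _ x := h2.mul h3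
  rw [partialSnd, h4.fderiv]
  simp

end Cylindrical

/-! ### Spherical means of the Laplacian -/

section Darboux

variable {n : ℕ}

theorem laplacian_eq_sum_fderiv {f : RSpace n → ℂ} (hf : ContDiff ℝ 2 f) (x : RSpace n) :
    Δ f x = ∑ i, fderiv ℝ (fun z => fderiv ℝ f z (EuclideanSpace.basisFun (Fin n) ℝ i)) x
      (EuclideanSpace.basisFun (Fin n) ℝ i) := by
  rw [InnerProductSpace.laplacian_eq_iteratedFDeriv_orthonormalBasis f
    (EuclideanSpace.basisFun (Fin n) ℝ)]
  refine Finset.sum_congr rfl fun i _ => ?_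
  rw [iteratedFDeriv_two_apply]
  have h : DifferentiableAt ℝ (fderiv ℝ f) x :=
    (hf.fderiv_right (m := 1) le_rfl).differentiable one_ne_zero x
  rw [(h.hasFDerivAt.clm_apply (hasFDerivAt_const _ x)).fderiv]
  simp

theorem continuous_laplacian {f : RSpace n → ℂ} (hf : ContDiff ℝ 2 f) : Continuous (Δ f) := by
  simp only [funext (laplacian_eq_sum_fderiv hf)]
  refine continuous_finsetSum _ fun i _ => ?_
  have h : ContDiff ℝ 1 (fun z => fderiv ℝ f z (EuclideanSpace.basisFun (Fin n) ℝ i)) :=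
    (hf.fderiv_right (m := 1) le_rfl).clm_apply contDiff_const
  exact (h.continuous_fderiv one_ne_zero).clm_apply continuous_const

theorem laplacian_eq_zero_of_eventuallyEq {f : RSpace n → ℂ} {x : RSpace n}
    (h : f =ᶠ[𝓝 x] fun _ => 0) : Δ f x = 0 := by
  rw [(InnerProductSpace.laplacian_congr_nhds h).eq_of_nhds, InnerProductSpace.laplacian_const]
  rfl

theorem hasCompactSupport_laplacian {f : RSpace n → ℂ} (hf : HasCompactSupport f) :
    HasCompactSupport (Δ f) := by
  refine HasCompactSupport.of_support_subset_isCompact hf.isCompact fun x hx => ?_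
  by_contra h
  exact hx (laplacian_eq_zero_of_eventuallyEq (notMem_tsupport_iff_eventuallyEq.1 h))

/-- Integration by parts for the Laplacian. -/
theorem integral_mul_laplacian {u f : RSpace n → ℂ} (hu : ContDiff ℝ 1 u) (hf : ContDiff ℝ 2 f)
    (hc : HasCompactSupport u ∨ HasCompactSupport f) :
    ∫ x, u x * Δ f x = -∫ x, ∑ i, fderiv ℝ u x (EuclideanSpace.basisFun (Fin n) ℝ i) *
      fderiv ℝ f x (EuclideanSpace.basisFun (Fin n) ℝ i) := by
  set b := EuclideanSpace.basisFun (Fin n) ℝ with hb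
  have hdf : ∀ i, ContDiff ℝ 1 (fun z => fderiv ℝ f z (b i)) := fun i =>
    (hf.fderiv_right (m := 1) le_rfl).clm_apply contDiff_const
  have hdu : ∀ i, Continuous (fun z => fderiv ℝ u z (b i)) := fun i =>
    (hu.continuous_fderiv one_ne_zero).clm_apply continuous_const
  have hddf : ∀ i, Continuous (fun x => fderiv ℝ (fun z => fderiv ℝ f z (b i)) x (b i)) :=
    fun i => ((hdf i).continuous_fderiv one_ne_zero).clm_apply continuous_const
  have hi1 : ∀ i, Integrable fun x => fderiv ℝ u x (b i) * fderiv ℝ f x (b i) := fun i => by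
    refine ((hdu i).mul (hdf i).continuous).integrable_of_hasCompactSupport ?_
    rcases hc with hc | hc
    · exact (hc.fderiv_apply ℝ (b i)).mul_right
    · exact (hc.fderiv_apply ℝ (b i)).mul_left
  have hi2 : ∀ i, Integrable fun x => u x * fderiv ℝ (fun z => fderiv ℝ f z (b i)) x (b i) :=
    fun i => by
    refine (hu.continuous.mul (hddf i)).integrable_of_hasCompactSupport ?_
    rcases hc with hc | hc
    · exact hc.mul_right
    · exact ((hc.fderiv_apply ℝ (b i)).fderiv_apply ℝ (b i)).mul_left
  have hi3 : ∀ i, Integrable fun x => u x * fderiv ℝ f x (b i) := fun i => by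
    refine (hu.continuous.mul (hdf i).continuous).integrable_of_hasCompactSupport ?_
    rcases hc with hc | hc
    · exact hc.mul_right
    · exact (hc.fderiv_apply ℝ (b i)).mul_left
  simp_rw [laplacian_eq_sum_fderiv hf, Finset.mul_sum]
  rw [integral_finsetSum _ fun i _ => hi2 i, integral_finsetSum _ fun i _ => hi1 i,
    ← Finset.sum_neg_distrib]
  exact Finset.sum_congr rfl fun i _ => integral_mul_fderiv_eq_neg_fderiv_mul_of_integrable
    (hi1 i) (hi2 i) (hi3 i) (fun x _ => hu.differentiable one_ne_zero x)
    (fun x _ => (hdf i).differentiable one_ne_zero x)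

/-- Green's second identity. -/
theorem integral_mul_laplacian_comm {u f : RSpace n → ℂ} (hu : ContDiff ℝ 2 u)
    (hf : ContDiff ℝ 2 f) (hc : HasCompactSupport f) :
    ∫ x, u x * Δ f x = ∫ x, f x * Δ u x := by
  rw [integral_mul_laplacian (hu.of_le one_le_two) hf (Or.inr hc),
    integral_mul_laplacian (hf.of_le one_le_two) hu (Or.inl hc)]
  simp_rw [mul_comm]

/-- The coordinates `(s, ζ)` of a point: squared distance from the axis, and height. -/
noncomputable def cylCoord (y x : RSpace n) : ℝ × ℝ := (perpSq y x, inner ℝ x (unitDir y))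

theorem contDiff_cylCoord {m : WithTop ℕ∞} (y : RSpace n) : ContDiff ℝ m (cylCoord y) :=
  (contDiff_perpSq y).prodMk (contDiff_id.inner ℝ contDiff_const)

theorem cylCoord_cylMap {y : RSpace n} (hy : y ≠ 0)
    (σ : Metric.sphere (0 : (Submodule.span ℝ {y})ᗮ) 1) (x : ℝ × ℝ) :
    cylCoord y (cylMap y σ x) = (x.1 ^ 2, x.2) := by
  rw [cylCoord, perpSq_cylMap hy, inner_cylMap_unitDir hy]

theorem fderiv_cylCoord_apply (y x v : RSpace n) : fderiv ℝ (cylCoord y) x v =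
    (2 * inner ℝ (x - (inner ℝ x (unitDir y) : ℝ) • unitDir y) v, inner ℝ v (unitDir y)) := by
  have h1 : HasFDerivAt (fun x : RSpace n => ‖x‖ ^ 2) _ x := (hasFDerivAt_id x).norm_sq
  have h2 : HasFDerivAt (fun x : RSpace n => inner ℝ x (unitDir y)) _ x :=
    (hasFDerivAt_id x).inner ℝ (hasFDerivAt_const (unitDir y) x)
  have h3 : HasFDerivAt (cylCoord y) _ x := (h1.sub (h2.pow 2)).prodMk h2
  rw [h3.fderiv]
  simp [inner_sub_left, inner_smul_left, real_inner_comm]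
  ring

/-- The pairing of the gradient of `x ↦ g (s, ζ)` with that of `f`. -/
theorem sum_fderiv_comp_cylCoord {y : RSpace n} {g : ℝ × ℝ → ℂ} (hg : ContDiff ℝ 1 g)
    (f' : RSpace n →L[ℝ] ℂ) (x : RSpace n) :
    ∑ i, fderiv ℝ (g ∘ cylCoord y) x (EuclideanSpace.basisFun (Fin n) ℝ i) *
      f' (EuclideanSpace.basisFun (Fin n) ℝ i) =
    2 * partialFst g (cylCoord y x) * f' (x - (inner ℝ x (unitDir y) : ℝ) • unitDir y) +
      partialSnd g (cylCoord y x) * f' (unitDir y) := by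
  set b := EuclideanSpace.basisFun (Fin n) ℝ
  have h1 : ∀ v, fderiv ℝ (g ∘ cylCoord y) x v =
      2 * ((inner ℝ v (x - (inner ℝ x (unitDir y) : ℝ) • unitDir y) : ℝ) : ℂ) *
        partialFst g (cylCoord y x) +
      ((inner ℝ v (unitDir y) : ℝ) : ℂ) * partialSnd g (cylCoord y x) := fun v => by
    rw [fderiv_comp x (hg.differentiable one_ne_zero _)
      ((contDiff_cylCoord (m := 1) y).differentiable one_ne_zero x),
      ContinuousLinearMap.comp_apply, fderiv_cylCoord_apply, real_inner_comm, partialFst,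
      partialSnd]
    set A := (inner ℝ v (x - (inner ℝ x (unitDir y) : ℝ) • unitDir y) : ℝ)
    set B := (inner ℝ v (unitDir y) : ℝ)
    rw [show ((2 * A, B) : ℝ × ℝ) = (2 * A) • ((1, 0) : ℝ × ℝ) + B • ((0, 1) : ℝ × ℝ) by simp,
      map_add, map_smul, map_smul, Complex.real_smul, Complex.real_smul]
    push_cast
    ring
  have h2 : ∀ w, f' w = ∑ i, ((inner ℝ (b i) w : ℝ) : ℂ) * f' (b i) := fun w => by
    conv_lhs => rw [← b.sum_repr' w]
    simp [map_sum]
  rw [h2 (x - _), h2 (unitDir y), Finset.mul_sum, Finset.mul_sum, ← Finset.sum_add_distrib]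
  refine Finset.sum_congr rfl fun i _ => ?_
  rw [h1]
  ring

theorem sphMean_comp_cylCoord_mul {y : RSpace n} (hy : y ≠ 0) (g : ℝ × ℝ → ℂ)
    (f : RSpace n → ℂ) (ρ ζ : ℝ) :
    sphMean y (fun x => g (cylCoord y x) * f x) ρ ζ = g (ρ ^ 2, ζ) * sphMean y f ρ ζ := by
  have h1 := sphMean_eq_integral y (fun x => g (cylCoord y x) * f x) (ρ, ζ)
  have h2 := sphMean_eq_integral y f (ρ, ζ)
  simp only [cylCoord_cylMap hy] at h1 h2
  rw [h1, h2, integral_const_mul]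

theorem integral_Ioi_eq_integral_prod {H : ℝ × ℝ → ℂ} (hH : Integrable H)
    (h0 : ∀ x : ℝ × ℝ, x.1 ≤ 0 → H x = 0) :
    ∫ ζ : ℝ, ∫ s in Set.Ioi (0 : ℝ), H (s, ζ) = ∫ x, H x := by
  rw [Measure.volume_eq_prod, integral_prod_symm _ hH]
  refine integral_congr_ae (Eventually.of_forall fun ζ => ?_)
  exact setIntegral_eq_integral_of_forall_compl_eq_zero fun s hs => h0 _ (not_lt.1 hs)

theorem integrable_mul_comp_cylCoord {y : RSpace n} {g : ℝ × ℝ → ℂ} (hg : Continuous g)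
    {h : RSpace n → ℂ} (hh : Continuous h) (hc : HasCompactSupport h) :
    Integrable fun x => g (cylCoord y x) * h x :=
  ((hg.comp (contDiff_cylCoord (m := 0) y).continuous).mul hh).integrable_of_hasCompactSupport
    hc.mul_left

theorem integrable_mul_of_hasCompactSupport {u v : ℝ × ℝ → ℂ} (hu : Continuous u)
    (hv : Continuous v) (hc : HasCompactSupport v) : Integrable fun x => u x * v x :=
  (hu.mul hv).integrable_of_hasCompactSupport hc.mul_left

/-- Integration by parts for the cylindrical Laplacian. -/
theorem integral_mul_cylLaplacian (k : ℕ) {B g : ℝ × ℝ → ℂ} (hB : ContDiff ℝ 2 B)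
    (hBs : HasCompactSupport B) (hg : ContDiff ℝ 1 g) :
    ∫ x, g x * cylLaplacian k B x =
      -∫ x, (partialFst g x * radialFlux k B x + partialSnd g x * partialSnd B x) := by
  have hR : ContDiff ℝ 1 (radialFlux k B) := hB.radialFlux k le_rfl
  have hS : ContDiff ℝ 1 (partialSnd B) := hB.partialSnd le_rfl
  have hRs : HasCompactSupport (radialFlux k B) :=
    HasCompactSupport.of_support_subset_isCompact hBs.isCompact fun x hx => by
      by_contra h
      exact hx (radialFlux_eq_zero h)
  have hSs : HasCompactSupport (partialSnd B) := hBs.fderiv_apply ℝ (0, 1)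
  have hg1 : Continuous (partialFst g) := (hg.partialFst (m := 0) (by norm_num)).continuous
  have hg2 : Continuous (partialSnd g) := (hg.partialSnd (m := 0) (by norm_num)).continuous
  have hR1 : Continuous (partialFst (radialFlux k B)) :=
    (hR.partialFst (m := 0) (by norm_num)).continuous
  have hS1 : Continuous (partialSnd (partialSnd B)) :=
    (hS.partialSnd (m := 0) (by norm_num)).continuous
  have i1 := integrable_mul_of_hasCompactSupport hg1 hR.continuous hRs
  have i2 := integrable_mul_of_hasCompactSupport hg2 hS.continuous hSs
  have i3 := integrable_mul_of_hasCompactSupport hg.continuous hR1 (hRs.fderiv_apply ℝ (1, 0))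
  have i4 := integrable_mul_of_hasCompactSupport hg.continuous hS1 (hSs.fderiv_apply ℝ (0, 1))
  have i5 := integrable_mul_of_hasCompactSupport hg.continuous hR.continuous hRs
  have i6 := integrable_mul_of_hasCompactSupport hg.continuous hS.continuous hSs
  rw [integral_add i1 i2, neg_add]
  simp_rw [cylLaplacian, mul_add]
  rw [integral_add i3 i4]
  congr 1
  · exact integral_mul_fderiv_eq_neg_fderiv_mul_of_integrable i1 i3 i5
      (fun x _ => hg.differentiable one_ne_zero x) (fun x _ => hR.differentiable one_ne_zero x)
  · exact integral_mul_fderiv_eq_neg_fderiv_mul_of_integrable i2 i4 i6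
      (fun x _ => hg.differentiable one_ne_zero x) (fun x _ => hS.differentiable one_ne_zero x)

/-- Weak form of Darboux's equation. -/
theorem integral_mul_weightedMean_laplacian {k : ℕ} (hk : 1 ≤ k) (hn : n = 2 * k + 2)
    {y : RSpace n} (hy : y ≠ 0) {f : RSpace n → ℂ} (hf : ContDiff ℝ 2 f)
    (hfs : HasCompactSupport f) {c : ℝ} (hc : 0 < c) (hfc : ∀ x, perpSq y x < c → f x = 0)
    {g : ℝ × ℝ → ℂ} (hg : ContDiff ℝ 1 g) :
    ∫ x, g x * weightedMean k y (Δ f) x =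
      ∫ x, g x * cylLaplacian k (weightedMean k y f) x := by
  have hLc : ∀ x, perpSq y x < c → Δ f x = 0 := fun x hx =>
    laplacian_eq_zero_of_eventuallyEq (by
      filter_upwards [((contDiff_perpSq (m := 0) y).continuous.isOpen_preimage _
        isOpen_Iio).mem_nhds hx] with z hz using hfc z hz)
  have hLs := hasCompactSupport_laplacian hfs
  have hLcont := continuous_laplacian hf
  have hB : ContDiff ℝ 2 (weightedMean k y f) := contDiff_weightedMean (r := 2) hn hy hf hc hfc
  have hBs : HasCompactSupport (weightedMean k y f) :=
    hasCompactSupport_weightedMean hy hfs hc hfc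
  have hB0 : ∀ x : ℝ × ℝ, x.1 ≤ 0 → x ∉ tsupport (weightedMean k y f) := fun x hx => by
    rw [notMem_tsupport_iff_eventuallyEq]
    filter_upwards [(isOpen_lt continuous_fst continuous_const).mem_nhds (hx.trans_lt hc)]
      with z hz
    exact weightedMean_eq_zero_of_lt hy hc hfc hz
  have hM : Continuous (weightedMean k y (Δ f)) :=
    (contDiff_weightedMean (r := 0) hn hy (contDiff_zero.2 hLcont) hc hLc).continuous
  have hMs : HasCompactSupport (weightedMean k y (Δ f)) :=
    hasCompactSupport_weightedMean hy hLs hc hLc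
  have hκ : (((orthSphereMeasure y).real Set.univ / 2 : ℝ) : ℂ) ≠ 0 := by
    rw [measureReal_orthSphere hn hy]
    have : 0 < Real.Gamma (k + 1 / 2) := Real.Gamma_pos_of_pos (by positivity)
    exact_mod_cast (by positivity : (2 * Real.pi ^ k * √Real.pi / Real.Gamma (k + 1 / 2) / 2) ≠ 0)
  have hg1 : Continuous (partialFst g) := (hg.partialFst (m := 0) (by norm_num)).continuous
  have hg2 : Continuous (partialSnd g) := (hg.partialSnd (m := 0) (by norm_num)).continuous
  -- Testing against functions of (s, ζ) avoids second derivatives along the spheres: one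
  -- integration by parts leaves first-order terms, whose spherical means are the ρ- and
  -- ζ-derivatives of f̄.
  have key := integral_mul_laplacian (u := g ∘ cylCoord y)
    (hg.comp (contDiff_cylCoord y)) hf (Or.inr hfs)
  simp_rw [sum_fderiv_comp_cylCoord hg] at key
  have hdf : Continuous (fderiv ℝ f) := hf.continuous_fderiv two_ne_zero
  have hdfs : HasCompactSupport (fderiv ℝ f) := hfs.fderiv ℝ
  have j1 : Integrable fun x => g (cylCoord y x) * Δ f x :=
    integrable_mul_comp_cylCoord hg.continuous hLcont hLs
  set R : RSpace n → ℂ := fun x =>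
    2 * fderiv ℝ f x (x - (inner ℝ x (unitDir y) : ℝ) • unitDir y) with hRdef
  set S : RSpace n → ℂ := fun x => fderiv ℝ f x (unitDir y) with hSdef
  have hRc : Continuous R := by
    have : Continuous fun x : RSpace n => (inner ℝ x (unitDir y) : ℝ) :=
      continuous_id.inner continuous_const
    exact continuous_const.mul (hdf.clm_apply (continuous_id.sub (this.smul continuous_const)))
  have hRs : HasCompactSupport R :=
    HasCompactSupport.of_support_subset_isCompact hdfs.isCompact fun x hx => by
      by_contra h
      exact hx (by simp [hRdef, image_eq_zero_of_notMem_tsupport h])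
  have hSc : Continuous S := hdf.clm_apply continuous_const
  have hSs : HasCompactSupport S := hfs.fderiv_apply ℝ _
  have j2 : Integrable fun x => partialFst g (cylCoord y x) * R x :=
    integrable_mul_comp_cylCoord hg1 hRc hRs
  have j3 : Integrable fun x => partialSnd g (cylCoord y x) * S x :=
    integrable_mul_comp_cylCoord hg2 hSc hSs
  have key2 : ∫ x, g (cylCoord y x) * Δ f x = -∫ x, (partialFst g (cylCoord y x) * R x +
      partialSnd g (cylCoord y x) * S x) := by
    refine key.trans (congrArg _ (integral_congr_ae (Eventually.of_forall fun x => ?_)))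
    simp only [hRdef, hSdef]
    ring
  have hmR : ∀ ρ ζ : ℝ, sphMean y R ρ ζ =
      2 * ρ * fderiv ℝ (fun x : ℝ × ℝ => sphMean y f x.1 x.2) (ρ, ζ) (1, 0) := fun ρ ζ => by
    have h1 := sphMean_eq_integral y R (ρ, ζ)
    simp only at h1
    rw [h1, fderiv_sphMean_apply hn hy (hf.of_le one_le_two), ← integral_const_mul]
    refine integral_congr_ae (Eventually.of_forall fun σ => ?_)
    simp only [hRdef, inner_cylMap_unitDir hy]
    rw [cylMap_apply, cylMap_apply]
    simp only [add_sub_cancel_right, one_smul, zero_smul, add_zero, map_smul, Complex.real_smul]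
    ring
  have hmS : ∀ ρ ζ : ℝ, sphMean y S ρ ζ =
      fderiv ℝ (fun x : ℝ × ℝ => sphMean y f x.1 x.2) (ρ, ζ) (0, 1) := fun ρ ζ => by
    have h1 := sphMean_eq_integral y S (ρ, ζ)
    simp only at h1
    rw [h1, fderiv_sphMean_apply hn hy (hf.of_le one_le_two)]
    refine integral_congr_ae (Eventually.of_forall fun σ => ?_)
    simp only [hSdef]
    rw [cylMap_apply y σ (0, 1)]
    simp
  rw [integral_add j2 j3, integral_cylindrical hk hn hy j1, integral_cylindrical hk hn hy j2,
    integral_cylindrical hk hn hy j3, ← mul_add, ← mul_neg] at key2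
  have key3 := mul_left_cancel₀ hκ key2
  simp_rw [sphMean_comp_cylCoord_mul hy, hmR, hmS] at key3
  have e1 : ∀ ζ : ℝ, ∫ s in Set.Ioi (0 : ℝ), ((√s ^ (2 * k - 1) : ℝ) : ℂ) *
      (g (√s ^ 2, ζ) * sphMean y (Δ f) (√s) ζ) =
      ∫ s in Set.Ioi (0 : ℝ), (fun x => g x * weightedMean k y (Δ f) x) (s, ζ) := fun ζ => by
    refine setIntegral_congr_fun measurableSet_Ioi fun s hs => ?_
    simp only [weightedMean, Real.sq_sqrt (le_of_lt hs)]
    ring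
  have e2 : ∀ ζ : ℝ, ∫ s in Set.Ioi (0 : ℝ), ((√s ^ (2 * k - 1) : ℝ) : ℂ) *
      (partialFst g (√s ^ 2, ζ) * (2 * (√s : ℝ) *
        fderiv ℝ (fun x : ℝ × ℝ => sphMean y f x.1 x.2) (√s, ζ) (1, 0))) =
      ∫ s in Set.Ioi (0 : ℝ),
        (fun x => partialFst g x * radialFlux k (weightedMean k y f) x) (s, ζ) := fun ζ => by
    refine setIntegral_congr_fun measurableSet_Ioi fun s hs => ?_
    simp only
    rw [radialFlux_weightedMean hk hn hy (hf.of_le one_le_two) (x := (s, ζ)) hs,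
      Real.sq_sqrt (le_of_lt hs)]
    ring
  have e3 : ∀ ζ : ℝ, ∫ s in Set.Ioi (0 : ℝ), ((√s ^ (2 * k - 1) : ℝ) : ℂ) *
      (partialSnd g (√s ^ 2, ζ) *
        fderiv ℝ (fun x : ℝ × ℝ => sphMean y f x.1 x.2) (√s, ζ) (0, 1)) =
      ∫ s in Set.Ioi (0 : ℝ),
        (fun x => partialSnd g x * partialSnd (weightedMean k y f) x) (s, ζ) := fun ζ => by
    refine setIntegral_congr_fun measurableSet_Ioi fun s hs => ?_
    simp only
    rw [partialSnd_weightedMean hn hy (hf.of_le one_le_two) (x := (s, ζ)) hs,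
      Real.sq_sqrt (le_of_lt hs)]
    ring
  simp_rw [e1, e2, e3] at key3
  have hRB : HasCompactSupport (radialFlux k (weightedMean k y f)) :=
    HasCompactSupport.of_support_subset_isCompact hBs.isCompact fun x hx => by
      by_contra h
      exact hx (radialFlux_eq_zero h)
  have l1 := integrable_mul_of_hasCompactSupport hg.continuous hM hMs
  have l2 := integrable_mul_of_hasCompactSupport hg1
    (hB.radialFlux (m := 1) k le_rfl).continuous hRB
  have l3 := integrable_mul_of_hasCompactSupport hg2
    (hB.partialSnd (m := 1) le_rfl).continuous (hBs.fderiv_apply ℝ (0, 1))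
  rw [integral_Ioi_eq_integral_prod l1 fun x hx => by
      simp [weightedMean_eq_zero_of_lt hy hc hLc (hx.trans_lt hc)],
    integral_Ioi_eq_integral_prod l2 fun x hx => by simp [radialFlux_eq_zero (hB0 x hx)],
    integral_Ioi_eq_integral_prod l3 fun x hx => by simp [partialSnd_eq_zero (hB0 x hx)],
    ← integral_add l2 l3] at key3
  rw [key3, integral_mul_cylLaplacian k hB hBs hg]

/-- Darboux's equation: the weighted spherical mean intertwines the Laplacian with the cylindrical
Laplacian. -/
theorem weightedMean_laplacian {k : ℕ} (hk : 1 ≤ k) (hn : n = 2 * k + 2)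
    {y : RSpace n} (hy : y ≠ 0) {f : RSpace n → ℂ} (hf : ContDiff ℝ 2 f)
    (hfs : HasCompactSupport f) {c : ℝ} (hc : 0 < c) (hfc : ∀ x, perpSq y x < c → f x = 0) :
    weightedMean k y (Δ f) = cylLaplacian k (weightedMean k y f) := by
  have hLc : ∀ x, perpSq y x < c → Δ f x = 0 := fun x hx =>
    laplacian_eq_zero_of_eventuallyEq (by
      filter_upwards [((contDiff_perpSq (m := 0) y).continuous.isOpen_preimage _
        isOpen_Iio).mem_nhds hx] with z hz using hfc z hz)
  have hB : ContDiff ℝ 2 (weightedMean k y f) := contDiff_weightedMean (r := 2) hn hy hf hc hfc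
  have hM : Continuous (weightedMean k y (Δ f)) :=
    (contDiff_weightedMean (r := 0) hn hy (contDiff_zero.2 (continuous_laplacian hf)) hc
      hLc).continuous
  have hC : Continuous (cylLaplacian k (weightedMean k y f)) :=
    (((hB.radialFlux (m := 1) k le_rfl).partialFst (m := 0) (by norm_num)).add
      ((hB.partialSnd (m := 1) le_rfl).partialSnd (m := 0) (by norm_num))).continuous
  refine (hM.ae_eq_iff_eq volume hC).1 ?_
  have h := ae_eq_zero_of_integral_contDiff_smul_eq_zero (μ := volume)
    (hM.sub hC).locallyIntegrable fun g hg hgs => by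
      have hg' : ContDiff ℝ 1 fun x => (g x : ℂ) :=
        Complex.ofRealCLM.contDiff.comp (hg.of_le (by exact_mod_cast le_top))
      have hgs' : HasCompactSupport fun x => (g x : ℂ) :=
        hgs.comp_left (g := fun r : ℝ => (r : ℂ)) Complex.ofReal_zero
      have hw := integral_mul_weightedMean_laplacian hk hn hy hf hfs hc hfc hg'
      simp only [Complex.real_smul, Pi.sub_apply, mul_sub]
      have h1 : Integrable fun x => (g x : ℂ) * weightedMean k y (Δ f) x :=
        (hg'.continuous.mul hM).integrable_of_hasCompactSupport hgs'.mul_right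
      have h2 : Integrable fun x => (g x : ℂ) * cylLaplacian k (weightedMean k y f) x :=
        (hg'.continuous.mul hC).integrable_of_hasCompactSupport hgs'.mul_right
      rw [integral_sub h1 h2, hw, sub_self]
  filter_upwards [h] with x hx using sub_eq_zero.1 hx

end Darboux

/-! ### The regularized source as an integral outside the spheroid -/

section Regularized

variable {n : ℕ}

theorem complexSq_eq_cylSq {y : RSpace n} (hy : y ≠ 0) (x : RSpace n) :
    complexSq x y = cylSq ‖y‖ (cylCoord y x) := by
  have hy' : ‖y‖ ≠ 0 := norm_ne_zero_iff.2 hy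
  have h : (inner ℝ x y : ℝ) = ‖y‖ * inner ℝ x (unitDir y) := by
    rw [unitDir, inner_smul_right]
    field_simp
  rw [complexSq, cylSq, cylCoord, perpSq, h]
  push_cast
  ring_nf
  rw [Complex.I_sq]
  ring

theorem complexLength_sq (x y : RSpace n) : complexLength x y ^ 2 = complexSq x y := by
  rw [complexLength, ← Complex.cpow_nat_mul]
  simp

theorem complexLength_re_nonneg (x y : RSpace n) : 0 ≤ (complexLength x y).re := by
  rw [complexLength, show (1 / 2 : ℂ) = 2⁻¹ by norm_num, Complex.cpow_inv_two_re]
  positivity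

/-- If p > 0, then s is the height at ζ of the spheroid of parameter p, and its excess over that of
parameter ε is p - ε times a positive factor. If p = 0, then ζ = 0 and s = a² - q², which is below
a² + ε². -/
theorem lt_complexLength_re_iff {y : RSpace n} (hy : y ≠ 0) {ε : ℝ} (hε : 0 < ε) (x : RSpace n) :
    ε < (complexLength x y).re ↔ spheroidGraph ‖y‖ ε (cylCoord y x).2 < (cylCoord y x).1 := by
  have ha : 0 < ‖y‖ := norm_pos_iff.2 hy
  have hsq := complexLength_sq x y
  rw [complexSq_eq_cylSq hy] at hsq
  have hp := complexLength_re_nonneg x y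
  have hre := congrArg Complex.re hsq
  have him := congrArg Complex.im hsq
  generalize complexLength x y = γ at *
  generalize cylCoord y x = z at *
  obtain ⟨s, ζ⟩ := z
  obtain ⟨p, q⟩ := γ
  simp only [cylSq, pow_two, Complex.mul_re, Complex.mul_im, Complex.add_re, Complex.add_im,
    Complex.ofReal_re, Complex.ofReal_im, Complex.I_re, Complex.I_im] at hre him hp ⊢
  ring_nf at hre him
  have hpq : p * q = ζ * ‖y‖ := by linarith
  generalize ‖y‖ = a at *
  rw [spheroidGraph]
  rcases hp.eq_or_lt with h0 | h0
  · subst h0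
    have hζ : ζ = 0 := by
      rw [zero_mul] at hpq
      exact (mul_eq_zero.1 hpq.symm).resolve_right ha.ne'
    subst hζ
    refine ⟨fun h => absurd h (not_lt.2 hε.le), fun h => ?_⟩
    ring_nf at h
    nlinarith
  · have hq : q = ζ * a / p := by field_simp; linarith
    have hs : s = (a ^ 2 + p ^ 2) * (1 - ζ ^ 2 / p ^ 2) := by
      have : s = p ^ 2 - q ^ 2 - ζ ^ 2 + a ^ 2 := by linarith
      rw [this, hq]
      field_simp
      ring
    have hd : s - (a ^ 2 + ε ^ 2) * (1 - ζ ^ 2 / ε ^ 2) =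
        (p - ε) * ((p + ε) * (1 + a ^ 2 * ζ ^ 2 / (p ^ 2 * ε ^ 2))) := by
      rw [hs]
      field_simp
      ring
    have hpos : 0 < (p + ε) * (1 + a ^ 2 * ζ ^ 2 / (p ^ 2 * ε ^ 2)) := by positivity
    rw [← sub_pos, ← sub_pos (b := (a ^ 2 + ε ^ 2) * (1 - ζ ^ 2 / ε ^ 2)), hd,
      mul_pos_iff_of_pos_right hpos]

/-- Evenness of n enters here: 2 - n = -2k, so only γ² = w appears and the branch of the root is
irrelevant to φ. -/
theorem holPotential_eq {k : ℕ} (hn : n = 2 * k + 2) {y : RSpace n} (hy : y ≠ 0) (x : RSpace n) :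
    holPotential x y = (cylSq ‖y‖ (cylCoord y x) ^ k)⁻¹ / ((2 - (n : ℂ)) * (sphereArea n : ℂ)) := by
  rw [holPotential, ← complexSq_eq_cylSq hy, ← complexLength_sq, ← pow_mul,
    show (2 - (n : ℤ)) = -((2 * k : ℕ) : ℤ) by rw [hn]; push_cast; ring, zpow_neg, zpow_natCast]

open Classical in
theorem regPotential_eq {k : ℕ} (hn : n = 2 * k + 2) {y : RSpace n} (hy : y ≠ 0) {ε : ℝ}
    (hε : 0 < ε) (x : RSpace n) :
    regPotential y ε x = if spheroidGraph ‖y‖ ε (cylCoord y x).2 < (cylCoord y x).1 then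
      (cylSq ‖y‖ (cylCoord y x) ^ k)⁻¹ / ((2 - (n : ℂ)) * (sphereArea n : ℂ)) else 0 := by
  rw [regPotential, holPotential_eq hn hy]
  simp only [lt_complexLength_re_iff hy hε]

theorem measurable_regPotential {k : ℕ} (hn : n = 2 * k + 2) {y : RSpace n} (hy : y ≠ 0) {ε : ℝ}
    (hε : 0 < ε) : Measurable (regPotential y ε) := by
  rw [funext (regPotential_eq hn hy hε)]
  have h1 : Continuous (cylCoord y) := (contDiff_cylCoord (m := 0) y).continuous
  have h2 : Continuous (spheroidGraph ‖y‖ ε) := by unfold spheroidGraph; fun_prop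
  refine Measurable.ite ?_ ?_ measurable_const
  · exact (isOpen_lt (h2.comp (continuous_snd.comp h1)) (continuous_fst.comp h1)).measurableSet
  · exact ((((contDiff_cylSq (n := 0) ‖y‖).continuous.comp h1).pow k).measurable.inv).div_const _

theorem norm_regPotential_le {k : ℕ} (hn : n = 2 * k + 2) (y : RSpace n) {ε : ℝ}
    (hε : 0 < ε) (x : RSpace n) :
    ‖regPotential y ε x‖ ≤ (ε ^ (2 * k))⁻¹ / ‖(2 - (n : ℂ)) * (sphereArea n : ℂ)‖ := by
  rw [regPotential]
  split_ifs with h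
  · rw [holPotential, norm_div,
      show (2 - (n : ℤ)) = -((2 * k : ℕ) : ℤ) by rw [hn]; push_cast; ring, zpow_neg, zpow_natCast,
      norm_inv, norm_pow]
    have : ε ≤ ‖complexLength x y‖ := h.le.trans (Complex.re_le_norm _)
    gcongr
  · rw [norm_zero]
    positivity

theorem integrable_regPotential_mul {k : ℕ} (hn : n = 2 * k + 2) {y : RSpace n} (hy : y ≠ 0)
    {ε : ℝ} (hε : 0 < ε) {h : RSpace n → ℂ} (hh : Integrable h) :
    Integrable fun x => regPotential y ε x * h x :=
  hh.bdd_mul (c := (ε ^ (2 * k))⁻¹ / ‖(2 - (n : ℂ)) * (sphereArea n : ℂ)‖)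
    (measurable_regPotential hn hy hε).aestronglyMeasurable
    (Eventually.of_forall fun x => norm_regPotential_le hn y hε x)

theorem regSource_eq {k : ℕ} (hk : 1 ≤ k) (hn : n = 2 * k + 2) {y : RSpace n} (hy : y ≠ 0)
    {ε : ℝ} (hε : 0 < ε) {f : RSpace n → ℂ} (hf : ContDiff ℝ 2 f) (hfs : HasCompactSupport f)
    {c : ℝ} (hc : 0 < c) (hfc : ∀ x, perpSq y x < c → f x = 0) :
    regSource y ε f = (((orthSphereMeasure y).real Set.univ / 2 : ℝ) : ℂ) /
      ((2 - (n : ℂ)) * (sphereArea n : ℂ)) * ∫ ζ : ℝ, ∫ s in Set.Ioi (spheroidGraph ‖y‖ ε ζ),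
        (cylSq ‖y‖ (s, ζ) ^ k)⁻¹ * cylLaplacian k (weightedMean k y f) (s, ζ) := by
  classical
  set D : ℂ := (2 - (n : ℂ)) * (sphereArea n : ℂ) with hD
  rw [regSource, integral_cylindrical hk hn hy (integrable_regPotential_mul hn hy hε
    ((continuous_laplacian hf).integrable_of_hasCompactSupport (hasCompactSupport_laplacian hfs))),
    div_eq_mul_inv _ D, mul_assoc, ← integral_const_mul D⁻¹]
  refine congrArg _ ?_
  refine integral_congr_ae (Eventually.of_forall fun ζ => ?_)
  simp only
  rw [← weightedMean_laplacian hk hn hy hf hfs hc hfc, ← integral_const_mul D⁻¹]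
  set Φ : ℝ × ℝ → ℂ := fun z => if spheroidGraph ‖y‖ ε z.2 < z.1 then
    (cylSq ‖y‖ z ^ k)⁻¹ / D else 0 with hΦ
  have hreg : ∀ x, regPotential y ε x = Φ (cylCoord y x) := regPotential_eq hn hy hε
  simp_rw [hreg, sphMean_comp_cylCoord_mul hy]
  have hLc : ∀ x, perpSq y x < c → Δ f x = 0 := fun x hx =>
    laplacian_eq_zero_of_eventuallyEq (by
      filter_upwards [((contDiff_perpSq (m := 0) y).continuous.isOpen_preimage _
        isOpen_Iio).mem_nhds hx] with z hz using hfc z hz)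
  have h0 : ∀ s : ℝ, s ≤ 0 → weightedMean k y (Δ f) (s, ζ) = 0 := fun s hs =>
    weightedMean_eq_zero_of_lt hy hc hLc (hs.trans_lt hc)
  calc ∫ s in Set.Ioi (0 : ℝ), ((√s ^ (2 * k - 1) : ℝ) : ℂ) *
        (Φ (√s ^ 2, ζ) * sphMean y (Δ f) (√s) ζ)
      = ∫ s in Set.Ioi (0 : ℝ), Φ (s, ζ) * weightedMean k y (Δ f) (s, ζ) := by
        refine setIntegral_congr_fun measurableSet_Ioi fun s hs => ?_
        simp only [weightedMean, Real.sq_sqrt (le_of_lt hs)]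
        ring
    _ = ∫ s : ℝ, Φ (s, ζ) * weightedMean k y (Δ f) (s, ζ) :=
        setIntegral_eq_integral_of_forall_compl_eq_zero fun s hs => by
          rw [h0 s (not_lt.1 hs), mul_zero]
    _ = ∫ s in Set.Ioi (spheroidGraph ‖y‖ ε ζ),
          Φ (s, ζ) * weightedMean k y (Δ f) (s, ζ) :=
        (setIntegral_eq_integral_of_forall_compl_eq_zero fun s hs => by
          rw [hΦ]
          simp only
          rw [if_neg (by exact hs), zero_mul]).symm
    _ = _ := by
        refine setIntegral_congr_fun measurableSet_Ioi fun s hs => ?_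
        simp only [hΦ]
        rw [if_pos (by exact hs)]
        ring

/-- The value of the source distribution on `f`, in terms of the weighted spherical mean. -/
noncomputable def sourceValue (k : ℕ) (y : RSpace n) (f : RSpace n → ℂ) : ℂ :=
  ((‖y‖ * √Real.pi / Real.Gamma (k + 1 / 2) : ℝ) : ℂ) *
    (iteratedDeriv k (fun s : ℝ => weightedMean k y f (s, 0)) (‖y‖ ^ 2) -
      Complex.I / (2 * ‖y‖) *
        iteratedDeriv (k - 1) (fun s : ℝ => partialSnd (weightedMean k y f) (s, 0)) (‖y‖ ^ 2))

theorem tendsto_regSource_of_perpSq {k : ℕ} (hk : 1 ≤ k) (hn : n = 2 * k + 2) {y : RSpace n}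
    (hy : y ≠ 0) {f : RSpace n → ℂ} (hf : ContDiff ℝ 2 f) (hfk : ContDiff ℝ k f)
    (hfs : HasCompactSupport f) {c : ℝ} (hc : 0 < c) (hfc : ∀ x, perpSq y x < c → f x = 0) :
    Tendsto (fun ε : ℝ => regSource y ε f) (𝓝[>] 0) (𝓝 (sourceValue k y f)) := by
  have ha : 0 < ‖y‖ := norm_pos_iff.2 hy
  obtain ⟨i, rfl⟩ := Nat.exists_eq_add_of_le' hk
  have h := tendsto_integral_exterior ha i (contDiff_weightedMean (r := 2) hn hy hf hc hfc)
    (contDiff_weightedMean hn hy hfk hc hfc) (hasCompactSupport_weightedMean hy hfs hc hfc) hc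
    (fun x hx => weightedMean_eq_zero_of_lt hy hc hfc hx)
  have h2 := h.const_mul ((((orthSphereMeasure y).real Set.univ / 2 : ℝ) : ℂ) /
      ((2 - (n : ℂ)) * (sphereArea n : ℂ)))
  -- With k = i + 1 and I the imaginary unit, the prefactors collapse to -(I/2)√π/Γ(k+1/2);
  -- multiplied by 2aI this is a√π/Γ(k+1/2).
  have hval : (((orthSphereMeasure y).real Set.univ / 2 : ℝ) : ℂ) /
      ((2 - (n : ℂ)) * (sphereArea n : ℂ)) * (2 * Real.pi * Complex.I / i.factorial *
        (iteratedDeriv i (fun s : ℝ => partialSnd (weightedMean (i + 1) y f) (s, 0)) (‖y‖ ^ 2) +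
          2 * ‖y‖ * Complex.I * iteratedDeriv (i + 1)
            (fun s : ℝ => weightedMean (i + 1) y f (s, 0)) (‖y‖ ^ 2))) =
      sourceValue (i + 1) y f := by
    rw [sourceValue, measureReal_orthSphere hn hy, sphereArea, Nat.add_sub_cancel]
    generalize iteratedDeriv i (fun s : ℝ => partialSnd (weightedMean (i + 1) y f) (s, 0)) _ = X
    generalize iteratedDeriv (i + 1) (fun s : ℝ => weightedMean (i + 1) y f (s, 0)) _ = Y
    have e1 : ((n : ℝ) / 2) = ((i + 1 : ℕ) : ℝ) + 1 := by rw [hn]; push_cast; ring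
    have e2 : (n : ℂ) = 2 * (i + 1) + 2 := by rw [hn]; push_cast; ring
    have e3 : Real.Gamma ((((i + 1 : ℕ) : ℝ)) + 1) = (i + 1) * (i.factorial : ℝ) := by
      rw [Real.Gamma_nat_eq_factorial, Nat.factorial_succ]
      push_cast
      ring
    have e4 : Real.pi ^ (((i + 1 : ℕ) : ℝ) + 1) = Real.pi ^ (i + 1) * Real.pi := by
      rw [← Nat.cast_add_one, Real.rpow_natCast, pow_succ]
    rw [e1, e3, e4, e2]
    have hG : (Real.Gamma (((i + 1 : ℕ) : ℝ) + 1 / 2) : ℂ) ≠ 0 := by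
      exact_mod_cast (Real.Gamma_pos_of_pos (by positivity)).ne'
    have ha' : (‖y‖ : ℂ) ≠ 0 := by exact_mod_cast ha.ne'
    have hp : (Real.pi : ℂ) ≠ 0 := by exact_mod_cast Real.pi_ne_zero
    have hfa : (i.factorial : ℂ) ≠ 0 := by exact_mod_cast i.factorial_ne_zero
    have hi : (i : ℂ) + 1 ≠ 0 := by exact_mod_cast i.succ_ne_zero
    generalize Real.Gamma (((i + 1 : ℕ) : ℝ) + 1 / 2) = G at *
    push_cast
    rw [show (2 : ℂ) - (2 * (i + 1) + 2) = -(2 * (i + 1)) by ring]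
    field_simp
    ring_nf
    simp only [Complex.I_sq]
    ring
  rw [hval] at h2
  refine h2.congr' ?_
  filter_upwards [self_mem_nhdsWithin] with ε hε
  exact (regSource_eq hk hn hy hε hf hfs hc hfc).symm

end Regularized

/-! ### Harmonicity of the potential away from the ring -/

section Harmonic

variable {n : ℕ}

theorem hasFDerivAt_complexSq (y x : RSpace n) : HasFDerivAt (fun x => complexSq x y)
    ((2 : ℂ) • (Complex.ofRealCLM.comp (innerSL ℝ x) +
      Complex.I • Complex.ofRealCLM.comp (innerSL ℝ y))) x := by
  have h1 : HasFDerivAt (fun x : RSpace n => ‖x‖ ^ 2) _ x := (hasFDerivAt_id x).norm_sq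
  have h2 : HasFDerivAt (fun x : RSpace n => inner ℝ x y) _ x :=
    (hasFDerivAt_id x).inner ℝ (hasFDerivAt_const y x)
  have h3 : HasFDerivAt (fun x => complexSq x y) _ x :=
    (Complex.ofRealCLM.hasFDerivAt.comp x (h1.sub_const (‖y‖ ^ 2))).add
      (((Complex.ofRealCLM.hasFDerivAt.comp x h2).const_mul 2).mul_const Complex.I)
  refine h3.congr_fderiv ?_
  ext v
  simp [real_inner_comm]
  ring

theorem contDiff_complexSq {m : WithTop ℕ∞} (y : RSpace n) :
    ContDiff ℝ m (fun x => complexSq x y) :=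
  (Complex.ofRealCLM.contDiff.comp ((contDiff_norm_sq ℝ).sub contDiff_const)).add
    ((contDiff_const.mul (Complex.ofRealCLM.contDiff.comp
      (contDiff_id.inner ℝ contDiff_const))).mul contDiff_const)

theorem fderiv_inv_complexSq_pow_apply {y x : RSpace n} (hx : complexSq x y ≠ 0) (k : ℕ)
    (v : RSpace n) : fderiv ℝ (fun x => (complexSq x y ^ k)⁻¹) x v =
      -k * (complexSq x y ^ (k + 1))⁻¹ * (2 * (inner ℝ x v + Complex.I * inner ℝ y v)) := by
  have h1 := (hasDerivAt_inv_pow k hx).comp_hasFDerivAt x (hasFDerivAt_complexSq y x)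
  have h : HasFDerivAt (fun x => (complexSq x y ^ k)⁻¹) _ x := h1
  rw [h.fderiv]
  simp
  ring

/-- As ∇w = 2(x + iy), this says that ∇w · ∇w = 4w. With Δw = 2n it gives Δ(w^{-k}) = (4k(k+1) -
2nk) w^{-k-1}, which is 0 for n = 2k + 2. -/
theorem sum_inner_add_I_mul_inner_sq (x y : RSpace n) :
    ∑ i, ((inner ℝ x (EuclideanSpace.basisFun (Fin n) ℝ i) : ℝ) +
      Complex.I * (inner ℝ y (EuclideanSpace.basisFun (Fin n) ℝ i) : ℝ)) ^ 2 =
      complexSq x y := by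
  set b := EuclideanSpace.basisFun (Fin n) ℝ
  have h : ∀ u v : RSpace n, ∑ i, ((inner ℝ u (b i) : ℝ) : ℂ) * ((inner ℝ v (b i) : ℝ) : ℂ) =
      ((inner ℝ u v : ℝ) : ℂ) := fun u v => by
    rw [← b.sum_inner_mul_inner u v]
    push_cast
    simp_rw [real_inner_comm]
  have h2 : ∀ i, ((inner ℝ x (b i) : ℝ) + Complex.I * (inner ℝ y (b i) : ℝ)) ^ 2 =
      ((inner ℝ x (b i) : ℝ) : ℂ) * ((inner ℝ x (b i) : ℝ) : ℂ) -
      ((inner ℝ y (b i) : ℝ) : ℂ) * ((inner ℝ y (b i) : ℝ) : ℂ) +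
      2 * Complex.I * (((inner ℝ x (b i) : ℝ) : ℂ) * ((inner ℝ y (b i) : ℝ) : ℂ)) := fun i => by
    ring_nf
    rw [Complex.I_sq]
    ring
  simp_rw [h2]
  rw [Finset.sum_add_distrib, Finset.sum_sub_distrib, ← Finset.mul_sum, h, h, h, complexSq,
    real_inner_self_eq_norm_sq, real_inner_self_eq_norm_sq]
  push_cast
  ring

/-- The potential `(z · z)^{-k}` is harmonic in dimension `2k + 2`. -/
theorem laplacian_eq_zero_of_eventuallyEq_potential {k : ℕ} (hn : n = 2 * k + 2) {y x : RSpace n}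
    (hx : complexSq x y ≠ 0) {u : RSpace n → ℂ} (hu : ContDiff ℝ 2 u) {c : ℂ}
    (hux : u =ᶠ[𝓝 x] fun x => c * (complexSq x y ^ k)⁻¹) : Δ u x = 0 := by
  rw [laplacian_eq_sum_fderiv hu]
  set b := EuclideanSpace.basisFun (Fin n) ℝ with hb
  have hne : ∀ᶠ z in 𝓝 x, complexSq z y ≠ 0 :=
    (contDiff_complexSq (m := 0) y).continuous.continuousAt.eventually_ne hx
  have h1 : ∀ v, (fun z => fderiv ℝ u z v) =ᶠ[𝓝 x] fun z => (c * (-k)) *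
      ((complexSq z y ^ (k + 1))⁻¹ * (2 * ((inner ℝ z v : ℝ) + Complex.I * (inner ℝ y v : ℝ)))) :=
    fun v => by
    filter_upwards [hux.fderiv (𝕜 := ℝ), hne] with z hz hz0
    have hd : DifferentiableAt ℝ (fun x => (complexSq x y ^ k)⁻¹) z :=
      (((contDiff_complexSq (m := 1) y).contDiffAt.pow k).inv
        (pow_ne_zero _ hz0)).differentiableAt one_ne_zero
    rw [hz, fderiv_const_mul hd, smul_apply, fderiv_inv_complexSq_pow_apply hz0,
      smul_eq_mul]
    ring
  have h2 : ∀ v, fderiv ℝ (fun z => fderiv ℝ u z v) x v = (c * (-k)) *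
      (-(k + 1) * (complexSq x y ^ (k + 2))⁻¹ * 4 *
        ((inner ℝ x v : ℝ) + Complex.I * (inner ℝ y v : ℝ)) ^ 2 +
        (complexSq x y ^ (k + 1))⁻¹ * (2 * (inner ℝ v v : ℝ))) := fun v => by
    rw [(h1 v).fderiv_eq]
    have hd : HasFDerivAt (fun x => (complexSq x y ^ (k + 1))⁻¹)
        (fderiv ℝ (fun x => (complexSq x y ^ (k + 1))⁻¹) x) x :=
      ((((contDiff_complexSq (m := 1) y).contDiffAt.pow (k + 1)).inv
        (pow_ne_zero _ hx)).differentiableAt one_ne_zero).hasFDerivAt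
    have hi : HasFDerivAt (fun x : RSpace n => ((inner ℝ x v : ℝ) : ℂ))
        (Complex.ofRealCLM.comp (innerSL ℝ v)) x := by
      have : (fun x : RSpace n => ((inner ℝ x v : ℝ) : ℂ)) =
          Complex.ofRealCLM.comp (innerSL ℝ v) := by
        ext z
        simp [real_inner_comm]
      rw [this]
      exact ContinuousLinearMap.hasFDerivAt _
    have hm : HasFDerivAt (fun z => (c * (-k)) * ((complexSq z y ^ (k + 1))⁻¹ *
        (2 * ((inner ℝ z v : ℝ) + Complex.I * (inner ℝ y v : ℝ))))) _ x :=
      (hd.mul ((hi.add_const (Complex.I * (inner ℝ y v : ℝ))).const_mul 2)).const_mul (c * (-k))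
    rw [hm.fderiv]
    simp only [smul_apply, add_apply, smul_eq_mul, fderiv_inv_complexSq_pow_apply hx,
      ContinuousLinearMap.comp_apply, Complex.ofRealCLM_apply, innerSL_apply_apply]
    push_cast
    ring
  simp_rw [h2]
  rw [← Finset.mul_sum, Finset.sum_add_distrib, ← Finset.mul_sum, sum_inner_add_I_mul_inner_sq]
  have h3 : ∑ i, (complexSq x y ^ (k + 1))⁻¹ * (2 * ((inner ℝ (b i) (b i) : ℝ) : ℂ)) =
      (complexSq x y ^ (k + 1))⁻¹ * (2 * n) := by
    simp
    ring
  have hn' : (n : ℂ) = 2 * k + 2 := by rw [hn]; push_cast; ring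
  rw [h3, hn', pow_succ _ (k + 1)]
  field_simp
  ring

theorem complexSq_ne_zero_of_perpSq_lt {y x : RSpace n} (hy : y ≠ 0)
    (hx : perpSq y x < ‖y‖ ^ 2) : complexSq x y ≠ 0 := by
  rw [complexSq_eq_cylSq hy]
  refine cylSq_ne_zero (norm_ne_zero_iff.2 hy) fun h => hx.ne ?_
  exact congrArg Prod.fst h

/-- Away from the ring, the potential agrees with a globally smooth function. -/
theorem exists_contDiff_eq_holPotential {k : ℕ} (hn : n = 2 * k + 2) {y : RSpace n} (hy : y ≠ 0)
    {c : ℝ} (hc : c < ‖y‖ ^ 2) : ∃ u : RSpace n → ℂ, ContDiff ℝ 2 u ∧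
      (∀ x, perpSq y x ≤ c → u x = holPotential x y) ∧ ∀ x, perpSq y x < c → Δ u x = 0 := by
  obtain ⟨d, hcd, hd⟩ := exists_between hc
  have hdc : 0 < d - c := sub_pos.2 hcd
  set D : ℂ := (2 - (n : ℂ)) * (sphereArea n : ℂ) with hD
  -- This cutoff is 1 for s ≤ c and 0 for s ≥ d; since d < a², the product extends by zero across
  -- the ring.
  set η : RSpace n → ℝ := fun x => Real.smoothTransition ((d - perpSq y x) / (d - c)) with hη
  have hηc : ContDiff ℝ 2 fun x => (η x : ℂ) :=
    Complex.ofRealCLM.contDiff.comp (Real.smoothTransition.contDiff.comp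
      ((contDiff_const.sub (contDiff_perpSq y)).div_const _))
  have hη1 : ∀ x, perpSq y x ≤ c → η x = 1 := fun x hx =>
    Real.smoothTransition.one_of_one_le (by rw [le_div_iff₀ hdc]; linarith)
  have hη0 : ∀ x, d ≤ perpSq y x → η x = 0 := fun x hx =>
    Real.smoothTransition.zero_of_nonpos (div_nonpos_of_nonpos_of_nonneg (by linarith) hdc.le)
  have hcont : Continuous (perpSq y) := (contDiff_perpSq (m := 0) y).continuous
  set u : RSpace n → ℂ := fun x => η x * (D⁻¹ * (complexSq x y ^ k)⁻¹) with hu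
  have huC : ContDiff ℝ 2 u := by
    refine contDiff_iff_contDiffAt.2 fun x => ?_
    rcases lt_or_ge (perpSq y x) (‖y‖ ^ 2) with hx | hx
    · exact hηc.contDiffAt.mul (contDiffAt_const.mul
        (((contDiff_complexSq y).contDiffAt.pow k).inv
          (pow_ne_zero _ (complexSq_ne_zero_of_perpSq_lt hy hx))))
    · refine contDiffAt_const (c := (0 : ℂ)) |>.congr_of_eventuallyEq ?_
      filter_upwards [(hcont.isOpen_preimage _ isOpen_Ioi).mem_nhds
        (show x ∈ perpSq y ⁻¹' Set.Ioi d from hd.trans_le hx)] with z hz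
      simp [hu, hη0 z (le_of_lt hz)]
  refine ⟨u, huC, fun x hx => ?_, fun x hx => ?_⟩
  · rw [hu, holPotential_eq hn hy, ← complexSq_eq_cylSq hy]
    simp only [hη1 x hx, Complex.ofReal_one, one_mul, div_eq_mul_inv, ← hD]
    ring
  · refine laplacian_eq_zero_of_eventuallyEq_potential hn
      (complexSq_ne_zero_of_perpSq_lt hy (hx.trans hc)) huC (c := D⁻¹) ?_
    filter_upwards [(hcont.isOpen_preimage _ isOpen_Iio).mem_nhds
        (show x ∈ perpSq y ⁻¹' Set.Iio c from hx)] with z hz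
    simp [hu, hη1 z (le_of_lt hz)]

/-- Im γ² = 2pq = 2x·y, so p = 0 confines x to the hyperplane orthogonal to y, a null set. -/
theorem ae_complexLength_re_pos {y : RSpace n} (hy : y ≠ 0) :
    ∀ᵐ x : RSpace n, 0 < (complexLength x y).re := by
  have h0 : volume ((Submodule.span ℝ {y})ᗮ : Set (RSpace n)) = 0 := by
    refine Measure.addHaar_submodule _ _ fun h => hy ?_
    have : y ∈ (Submodule.span ℝ {y})ᗮ := h ▸ Submodule.mem_top
    rw [Submodule.mem_orthogonal_singleton_iff_inner_right] at this
    exact inner_self_eq_zero.1 this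
  filter_upwards [compl_mem_ae_iff.2 h0] with x hx
  refine lt_of_le_of_ne (complexLength_re_nonneg x y) fun h => hx ?_
  rw [SetLike.mem_coe, Submodule.mem_orthogonal_singleton_iff_inner_left]
  have him := congrArg Complex.im (complexLength_sq x y)
  rw [pow_two, Complex.mul_im, ← h, complexSq] at him
  simp only [Complex.add_im, Complex.ofReal_im, Complex.mul_im, Complex.mul_re, Complex.ofReal_re,
    Complex.I_re, Complex.I_im, Complex.re_ofNat, Complex.im_ofNat] at him
  linarith

/-- The regularized sources vanish in the limit away from the ring. -/
theorem tendsto_regSource_zero {k : ℕ} (hn : n = 2 * k + 2) {y : RSpace n} (hy : y ≠ 0)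
    {g : RSpace n → ℂ} (hg : ContDiff ℝ 2 g) (hgs : HasCompactSupport g) {c : ℝ}
    (hc : c < ‖y‖ ^ 2) (hgc : ∀ x, c ≤ perpSq y x → g x = 0) :
    Tendsto (fun ε : ℝ => regSource y ε g) (𝓝[>] 0) (𝓝 0) := by
  obtain ⟨u, hu, hueq, hu0⟩ := exists_contDiff_eq_holPotential hn hy hc
  have hL0 : ∀ x, c < perpSq y x → Δ g x = 0 := fun x hx =>
    laplacian_eq_zero_of_eventuallyEq (by
      filter_upwards [((contDiff_perpSq (m := 0) y).continuous.isOpen_preimage _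
        isOpen_Ioi).mem_nhds hx] with z hz using hgc z (le_of_lt hz))
  have hmul : ∀ x, holPotential x y * Δ g x = u x * Δ g x := fun x => by
    rcases le_or_gt (perpSq y x) c with hx | hx
    · rw [hueq x hx]
    · rw [hL0 x hx, mul_zero, mul_zero]
  have hint : ∫ x, u x * Δ g x = 0 := by
    rw [integral_mul_laplacian_comm hu hg hgs,
      integral_congr_ae (g := fun _ => (0 : ℂ)) (Eventually.of_forall fun x => ?_), integral_zero]
    simp only
    rcases lt_or_ge (perpSq y x) c with hx | hx
    · rw [hu0 x hx, mul_zero]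
    · rw [hgc x hx, zero_mul]
  rw [← hint]
  have hLi : Integrable (Δ g) :=
    (continuous_laplacian hg).integrable_of_hasCompactSupport (hasCompactSupport_laplacian hgs)
  have hui : Integrable fun x => u x * Δ g x :=
    (hu.continuous.mul (continuous_laplacian hg)).integrable_of_hasCompactSupport
      (hasCompactSupport_laplacian hgs).mul_left
  -- Wherever Δg ≠ 0 the potential agrees with the continuous u, so the truncations are dominated
  -- uniformly in ε and converge off the null set p = 0.
  refine tendsto_integral_filter_of_dominated_convergence (fun x => ‖u x * Δ g x‖) ?_ ?_
    hui.norm ?_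
  · filter_upwards [self_mem_nhdsWithin] with ε hε
    exact (integrable_regPotential_mul hn hy hε hLi).aestronglyMeasurable
  · refine Eventually.of_forall fun ε => Eventually.of_forall fun x => ?_
    rw [← hmul, regPotential]
    split_ifs with h
    · exact le_rfl
    · rw [zero_mul, norm_zero]
      exact norm_nonneg _
  · filter_upwards [ae_complexLength_re_pos hy] with x hx
    refine tendsto_const_nhds.congr' ?_
    filter_upwards [nhdsWithin_le_nhds (Iio_mem_nhds hx)] with ε hε
    rw [regPotential, if_pos (by exact hε), hmul]

end Harmonic

/-! ### Convergence on general test functions -/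

section Limit

variable {n : ℕ}

theorem sphMean_congr {y : RSpace n} (hy : y ≠ 0) {f g : RSpace n → ℂ} {ρ ζ : ℝ}
    (h : ∀ x, perpSq y x = ρ ^ 2 → f x = g x) : sphMean y f ρ ζ = sphMean y g ρ ζ := by
  have h1 := sphMean_eq_integral y f (ρ, ζ)
  have h2 := sphMean_eq_integral y g (ρ, ζ)
  simp only at h1 h2
  rw [h1, h2]
  exact integral_congr_ae (Eventually.of_forall fun σ => h _ (perpSq_cylMap hy σ _))

/-- The source value depends only on the values of the function near the cylinder over the
ring. -/
theorem sourceValue_congr {k : ℕ} {y : RSpace n} (hy : y ≠ 0) {f g : RSpace n → ℂ} {c : ℝ}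
    (hc : c < ‖y‖ ^ 2) (h : ∀ x, c < perpSq y x → f x = g x) :
    sourceValue k y f = sourceValue k y g := by
  have ha : 0 < ‖y‖ ^ 2 := by have := norm_pos_iff.2 hy; positivity
  -- The number c may be negative, whereas (√s)² = s needs s ≥ 0; hence the maximum.
  have hW : ∀ x : ℝ × ℝ, max c 0 < x.1 → weightedMean k y f x = weightedMean k y g x :=
    fun x hx => by
    rw [weightedMean, weightedMean, sphMean_congr hy fun z hz => h z ?_]
    rw [hz, Real.sq_sqrt ((le_max_right _ _).trans hx.le)]
    exact (le_max_left _ _).trans_lt hx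
  have hm : max c 0 < ‖y‖ ^ 2 := max_lt hc ha
  rw [sourceValue, sourceValue]
  congr 2
  · refine Filter.EventuallyEq.iteratedDeriv_eq k ?_
    filter_upwards [Ioi_mem_nhds hm] with s hs using hW (s, 0) hs
  · congr 1
    refine Filter.EventuallyEq.iteratedDeriv_eq (k - 1) ?_
    filter_upwards [Ioi_mem_nhds hm] with s hs
    rw [partialSnd, partialSnd]
    congr 1
    refine Filter.EventuallyEq.fderiv_eq ?_
    filter_upwards [(isOpen_lt continuous_const continuous_fst).mem_nhds
      (show max c 0 < ((s, (0 : ℝ)) : ℝ × ℝ).1 from hs)] with z hz using hW z hz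

/-- The regularized sources converge on compactly supported test functions. -/
theorem tendsto_regSource {k : ℕ} (hk : 1 ≤ k) (hn : n = 2 * k + 2) {y : RSpace n}
    (hy : y ≠ 0) {f : RSpace n → ℂ} (hf : ContDiff ℝ 2 f) (hfk : ContDiff ℝ k f)
    (hfs : HasCompactSupport f) :
    Tendsto (fun ε : ℝ => regSource y ε f) (𝓝[>] 0) (𝓝 (sourceValue k y f)) := by
  have ha : 0 < ‖y‖ ^ 2 := by have := norm_pos_iff.2 hy; positivity
  set a2 := ‖y‖ ^ 2 with ha2
  -- η is 0 for s ≤ a²/4 and 1 for s ≥ a²/2: ηf avoids the axis, where √s is not smooth, and (1 -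
  -- η)f avoids the ring, where φ is singular.
  set η : RSpace n → ℝ := fun x => Real.smoothTransition ((perpSq y x - a2 / 4) / (a2 / 4))
    with hη
  have hηc : ∀ m : ℕ, ContDiff ℝ m fun x => (η x : ℂ) := fun m =>
    Complex.ofRealCLM.contDiff.comp ((Real.smoothTransition.contDiff (n := m)).comp
      (((contDiff_perpSq y).sub contDiff_const).div_const _))
  have hη1 : ∀ x, a2 / 2 ≤ perpSq y x → η x = 1 := fun x hx =>
    Real.smoothTransition.one_of_one_le (by rw [le_div_iff₀ (by positivity)]; linarith)
  have hη0 : ∀ x, perpSq y x < a2 / 4 → η x = 0 := fun x hx =>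
    Real.smoothTransition.zero_of_nonpos
      (div_nonpos_of_nonpos_of_nonneg (by linarith) (by positivity))
  set f1 : RSpace n → ℂ := fun x => η x * f x with hf1
  set f2 : RSpace n → ℂ := fun x => (1 - η x) * f x with hf2
  have h1 : ContDiff ℝ 2 f1 := (hηc 2).mul hf
  have h1k : ContDiff ℝ k f1 := (hηc k).mul hfk
  have h2 : ContDiff ℝ 2 f2 := (contDiff_const.sub (hηc 2)).mul hf
  have h1s : HasCompactSupport f1 := hfs.mul_left
  have h2s : HasCompactSupport f2 := hfs.mul_left
  have hsum : f = f1 + f2 := by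
    ext x
    simp only [hf1, hf2, Pi.add_apply]
    ring
  have l1 := tendsto_regSource_of_perpSq hk hn hy h1 h1k h1s (c := a2 / 4) (by positivity)
    fun x hx => by simp [hf1, hη0 x hx]
  have l2 := tendsto_regSource_zero hn hy h2 h2s (c := a2 / 2) (by linarith)
    fun x hx => by simp [hf2, hη1 x hx]
  have hv : sourceValue k y f1 = sourceValue k y f :=
    sourceValue_congr hy (c := a2 / 2) (by linarith) fun x hx => by simp [hf1, hη1 x hx.le]
  have l3 := l1.add l2
  rw [hv, add_zero] at l3
  refine l3.congr' ?_
  filter_upwards [self_mem_nhdsWithin] with ε hε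
  have i1 := integrable_regPotential_mul hn hy hε
    ((continuous_laplacian h1).integrable_of_hasCompactSupport (hasCompactSupport_laplacian h1s))
  have i2 := integrable_regPotential_mul hn hy hε
    ((continuous_laplacian h2).integrable_of_hasCompactSupport (hasCompactSupport_laplacian h2s))
  rw [regSource, regSource, regSource, ← integral_add i1 i2]
  refine integral_congr_ae (Eventually.of_forall fun x => ?_)
  simp only
  rw [hsum, ContDiffAt.laplacian_add h1.contDiffAt h2.contDiffAt, mul_add]

end Limit

/-! ### Rewriting the limit as D_ρ^k F -/

section Formula

variable {n : ℕ}

/-- The derivative of the spherical mean in the direction of `y`. -/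
noncomputable def sphMeanDeriv (y : RSpace n) (f : RSpace n → ℂ) (x : ℝ × ℝ) : ℂ :=
  partialSnd (fun x : ℝ × ℝ => sphMean y f x.1 x.2) x

theorem contDiff_sphMeanDeriv {k : ℕ} (hk : 1 ≤ k) (hn : n = 2 * k + 2) {y : RSpace n}
    (hy : y ≠ 0) {f : RSpace n → ℂ} (hf : ContDiff ℝ k f) :
    ContDiff ℝ (k - 1 : ℕ) (sphMeanDeriv y f) :=
  (contDiff_sphMean hn hy hf).partialSnd (by exact_mod_cast (by omega : k - 1 + 1 ≤ k))

theorem hasDerivAt_sphMean {k : ℕ} (hk : 1 ≤ k) (hn : n = 2 * k + 2) {y : RSpace n}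
    (hy : y ≠ 0) {f : RSpace n → ℂ} (hf : ContDiff ℝ k f) (ρ ζ : ℝ) :
    HasDerivAt (fun ζ : ℝ => sphMean y f ρ ζ) (sphMeanDeriv y f (ρ, ζ)) ζ := by
  have h1 : HasFDerivAt (fun x : ℝ × ℝ => sphMean y f x.1 x.2) _ (ρ, ζ) :=
    ((contDiff_sphMean hn hy hf).differentiable (by exact_mod_cast (by omega : k ≠ 0))
      (ρ, ζ)).hasFDerivAt
  exact h1.comp_hasDerivAt ζ ((hasDerivAt_const ζ ρ).prodMk (hasDerivAt_id ζ))

/-- A function on the half-plane, weighted and restricted to the axis `ζ = 0`, as a function of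
`s = ρ²`. -/
noncomputable def weightedAxis (k : ℕ) (h : ℝ × ℝ → ℂ) (s : ℝ) : ℂ :=
  ((√s ^ (2 * k - 1) : ℝ) : ℂ) * h (√s, 0)

theorem contDiffAt_weightedAxis (k : ℕ) {r : ℕ} {h : ℝ × ℝ → ℂ} (hh : ContDiff ℝ r h) {s : ℝ}
    (hs : 0 < s) : ContDiffAt ℝ r (weightedAxis k h) s := by
  have h1 : ContDiffAt ℝ r (fun s : ℝ => √s) s := contDiffAt_id.sqrt hs.ne'
  exact (Complex.ofRealCLM.contDiff.contDiffAt.comp s (h1.pow _)).mul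
    (hh.contDiffAt.comp s (h1.prodMk contDiffAt_const))

theorem sourceValue_eq {k : ℕ} (hk : 1 ≤ k) (hn : n = 2 * k + 2) {y : RSpace n}
    (hy : y ≠ 0) {f : RSpace n → ℂ} (hf : ContDiff ℝ k f) :
    sourceValue k y f = ((‖y‖ * √Real.pi / Real.Gamma (k + 1 / 2) : ℝ) : ℂ) *
      (iteratedDeriv k (weightedAxis k fun x => sphMean y f x.1 x.2) (‖y‖ ^ 2) -
        Complex.I / (2 * ‖y‖) *
          iteratedDeriv (k - 1) (weightedAxis k (sphMeanDeriv y f)) (‖y‖ ^ 2)) := by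
  have ha : 0 < ‖y‖ ^ 2 := by have := norm_pos_iff.2 hy; positivity
  rw [sourceValue]
  congr 3
  refine Filter.EventuallyEq.iteratedDeriv_eq (k - 1) ?_
  filter_upwards [Ioi_mem_nhds ha] with s hs
  exact partialSnd_weightedMean hn hy (hf.of_le (by exact_mod_cast hk)) (x := (s, 0)) hs

theorem hasDerivAt_comp_sq {H : ℝ → ℂ} {H' : ℂ} {ρ : ℝ} (h : HasDerivAt H H' (ρ ^ 2)) :
    HasDerivAt (fun ρ : ℝ => H (ρ ^ 2)) (2 * ρ * H') ρ := by
  have h1 := HasDerivAt.scomp (h := fun r : ℝ => r ^ 2) ρ h (hasDerivAt_pow 2 ρ)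
  refine h1.congr_deriv ?_
  simp

theorem Drho_eq_of_hasDerivAt {G H : ℝ → ℂ} {H' : ℂ} {ρ : ℝ} (hρ : 0 < ρ)
    (hG : ∀ r : ℝ, 0 < r → G r = H (r ^ 2)) (h : HasDerivAt H H' (ρ ^ 2)) : Drho G ρ = H' := by
  have h1 : G =ᶠ[𝓝 ρ] fun r => H (r ^ 2) := by
    filter_upwards [Ioi_mem_nhds hρ] with r hr using hG r hr
  have hρ' : (ρ : ℂ) ≠ 0 := by exact_mod_cast hρ.ne'
  rw [Drho, h1.deriv_eq, (hasDerivAt_comp_sq h).deriv]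
  field_simp

/-- In the variable s = ρ² > 0 the operator D_ρ is d/ds. -/
theorem Drho_iterate_eq {G H : ℝ → ℂ} (hG : ∀ r : ℝ, 0 < r → G r = H (r ^ 2)) {m : ℕ}
    (hH : ∀ s : ℝ, 0 < s → ContDiffAt ℝ m H s) (j : ℕ) (hj : j ≤ m) (ρ : ℝ) (hρ : 0 < ρ) :
    Drho^[j] G ρ = iteratedDeriv j H (ρ ^ 2) := by
  induction j generalizing ρ with
  | zero => simpa using hG ρ hρ
  | succ j ih =>
    rw [Function.iterate_succ_apply', iteratedDeriv_succ]
    refine Drho_eq_of_hasDerivAt hρ (fun r hr => ih (by omega) r hr) ?_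
    have h1 : ContDiffAt ℝ ((1 + j : ℕ)) H (ρ ^ 2) :=
      (hH _ (by positivity)).of_le (by exact_mod_cast (by omega : 1 + j ≤ m))
    exact (h1.contDiffAt_iteratedDeriv.differentiableAt (by simp)).hasDerivAt

/-- `F` as a function of `s = ρ²`. -/
noncomputable def cylFSq (k : ℕ) (y : RSpace n) (f : RSpace n → ℂ) (s : ℝ) : ℂ :=
  weightedAxis k (fun x => sphMean y f x.1 x.2) s -
    Complex.I / (2 * k * ‖y‖) *
      (((s - ‖y‖ ^ 2 : ℝ) : ℂ) * weightedAxis k (sphMeanDeriv y f) s)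

theorem cylF_eq_cylFSq {k : ℕ} (hk : 1 ≤ k) (hn : n = 2 * k + 2) {y : RSpace n}
    (hy : y ≠ 0) {f : RSpace n → ℂ} (hf : ContDiff ℝ k f) {ρ : ℝ} (hρ : 0 < ρ) :
    cylF k y f ρ = cylFSq k y f (ρ ^ 2) := by
  rw [cylF, cylFSq, weightedAxis, weightedAxis, Real.sqrt_sq hρ.le,
    (hasDerivAt_sphMean hk hn hy hf ρ 0).deriv]
  have hy' : (‖y‖ : ℂ) ≠ 0 := by exact_mod_cast norm_ne_zero_iff.2 hy
  have hk' : (k : ℂ) ≠ 0 := by exact_mod_cast (by omega : k ≠ 0)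
  push_cast
  field_simp
  ring

theorem contDiffAt_cylFSq {k : ℕ} (hk : 1 ≤ k) (hn : n = 2 * k + 2) {y : RSpace n}
    (hy : y ≠ 0) {f : RSpace n → ℂ} (hf : ContDiff ℝ k f) {s : ℝ} (hs : 0 < s) :
    ContDiffAt ℝ (k - 1 : ℕ) (cylFSq k y f) s := by
  have h1 := (contDiffAt_weightedAxis k (contDiff_sphMean hn hy hf) hs).of_le
    (show (((k - 1 : ℕ) : WithTop ℕ∞)) ≤ k by exact_mod_cast (by omega : k - 1 ≤ k))
  have h2 := contDiffAt_weightedAxis k (contDiff_sphMeanDeriv hk hn hy hf) hs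
  exact h1.sub (contDiffAt_const.mul ((Complex.ofRealCLM.contDiff.contDiffAt.comp s
    (contDiffAt_id.sub contDiffAt_const)).mul h2))

/-- In general f̄_ζ has only k - 1 derivatives, but at s = a² the factor s - a² supplies the missing
one. It yields k times the (k-1)-st derivative, and this k cancels the 1/k in F. -/
theorem hasDerivAt_iteratedDeriv_cylFSq {k : ℕ} (hk : 1 ≤ k) (hn : n = 2 * k + 2) {y : RSpace n}
    (hy : y ≠ 0) {f : RSpace n → ℂ} (hf : ContDiff ℝ k f) :
    HasDerivAt (iteratedDeriv (k - 1) (cylFSq k y f))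
      (iteratedDeriv k (weightedAxis k fun x => sphMean y f x.1 x.2) (‖y‖ ^ 2) -
        Complex.I / (2 * ‖y‖) *
          iteratedDeriv (k - 1) (weightedAxis k (sphMeanDeriv y f)) (‖y‖ ^ 2)) (‖y‖ ^ 2) := by
  have ha : 0 < ‖y‖ ^ 2 := by have := norm_pos_iff.2 hy; positivity
  obtain ⟨m, rfl⟩ := Nat.exists_eq_add_of_le' hk
  simp only [Nat.add_sub_cancel]
  set A := weightedAxis (m + 1) fun x : ℝ × ℝ => sphMean y f x.1 x.2 with hA
  set B := weightedAxis (m + 1) (sphMeanDeriv y f) with hB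
  have hAc : ∀ s : ℝ, 0 < s → ContDiffAt ℝ (m + 1 : ℕ) A s := fun s hs =>
    contDiffAt_weightedAxis _ (contDiff_sphMean hn hy hf) hs
  have hBc : ∀ s : ℝ, 0 < s → ContDiffAt ℝ m B s := fun s hs =>
    contDiffAt_weightedAxis _ (contDiff_sphMeanDeriv hk hn hy hf) hs
  have hA' : HasDerivAt (iteratedDeriv m A) (iteratedDeriv (m + 1) A (‖y‖ ^ 2)) (‖y‖ ^ 2) := by
    have h1 : ContDiffAt ℝ ((1 + m : ℕ)) A (‖y‖ ^ 2) := by rw [add_comm]; exact hAc _ ha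
    rw [iteratedDeriv_succ]
    exact (h1.contDiffAt_iteratedDeriv.differentiableAt (by simp)).hasDerivAt
  have hB' := (hasDerivAt_iteratedDeriv_sub_mul (hBc _ ha)).const_mul
    (Complex.I / (2 * (m + 1 : ℕ) * ‖y‖))
  have hev : iteratedDeriv m (cylFSq (m + 1) y f) =ᶠ[𝓝 (‖y‖ ^ 2)] fun s =>
      iteratedDeriv m A s - Complex.I / (2 * (m + 1 : ℕ) * ‖y‖) *
        iteratedDeriv m (fun s : ℝ => ((s - ‖y‖ ^ 2 : ℝ) : ℂ) * B s) s := by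
    filter_upwards [Ioi_mem_nhds ha] with s hs
    have c1 : ContDiffAt ℝ m A s := (hAc s hs).of_le (by exact_mod_cast m.le_succ)
    have c2 : ContDiffAt ℝ m (fun s : ℝ => ((s - ‖y‖ ^ 2 : ℝ) : ℂ) * B s) s :=
      (Complex.ofRealCLM.contDiff.contDiffAt.comp s
        (contDiffAt_id.sub contDiffAt_const)).mul (hBc s hs)
    have e1 : cylFSq (m + 1) y f = A - fun s => Complex.I / (2 * (m + 1 : ℕ) * ‖y‖) *
        (((s - ‖y‖ ^ 2 : ℝ) : ℂ) * B s) := rfl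
    rw [e1, iteratedDeriv_sub c1 (contDiffAt_const.mul c2), iteratedDeriv_const_mul_field]
  refine ((hA'.sub hB').congr_of_eventuallyEq hev).congr_deriv ?_
  have hy' : (‖y‖ : ℂ) ≠ 0 := by exact_mod_cast norm_ne_zero_iff.2 hy
  have hm : (m : ℂ) + 1 ≠ 0 := by exact_mod_cast m.succ_ne_zero
  push_cast
  field_simp

end Formula

/-! ### Linearity and boundedness of the limit functional -/

section Functional

variable {n : ℕ}

theorem sphMean_add {k : ℕ} (hn : n = 2 * k + 2) {y : RSpace n} (hy : y ≠ 0)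
    {f g : RSpace n → ℂ} (hf : Continuous f) (hg : Continuous g) (x : ℝ × ℝ) :
    sphMean y (f + g) x.1 x.2 = sphMean y f x.1 x.2 + sphMean y g x.1 x.2 := by
  have := isProbabilityMeasure_orthSphereProb hn hy
  have hc : Continuous fun σ => cylMap y σ x := (continuous_cylMap y).clm_apply continuous_const
  rw [sphMean_eq_integral, sphMean_eq_integral, sphMean_eq_integral]
  exact integral_add (integrable_of_continuous_compactSpace (hf.comp hc))
    (integrable_of_continuous_compactSpace (hg.comp hc))

theorem sphMean_smul (y : RSpace n) (c : ℂ) (f : RSpace n → ℂ) (x : ℝ × ℝ) :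
    sphMean y (c • f) x.1 x.2 = c * sphMean y f x.1 x.2 := by
  rw [sphMean_eq_integral, sphMean_eq_integral]
  exact integral_const_mul _ _

theorem weightedAxis_add (k : ℕ) (g h : ℝ × ℝ → ℂ) :
    weightedAxis k (g + h) = weightedAxis k g + weightedAxis k h := by
  ext s
  simp only [weightedAxis, Pi.add_apply, mul_add]

theorem weightedAxis_const_mul (k : ℕ) (c : ℂ) (h : ℝ × ℝ → ℂ) :
    weightedAxis k (fun x => c * h x) = fun s => c * weightedAxis k h s := by
  ext s
  simp only [weightedAxis]
  ring

/-- The source distribution as a linear functional. -/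
noncomputable def sourceFunctional {k : ℕ} (hk : 1 ≤ k) (hn : n = 2 * k + 2) {y : RSpace n}
    (hy : y ≠ 0) : CkFun n k →ₗ[ℂ] ℂ where
  toFun f := sourceValue k y f
  map_add' := fun ⟨f, hf⟩ ⟨g, hg⟩ => by
    have hf : ContDiff ℝ k f := hf
    have hg : ContDiff ℝ k g := hg
    have ha : 0 < ‖y‖ ^ 2 := by have := norm_pos_iff.2 hy; positivity
    have hk0 : ((k : ℕ) : WithTop ℕ∞) ≠ 0 := by exact_mod_cast (by omega : k ≠ 0)
    have h1 : (fun x : ℝ × ℝ => sphMean y (f + g) x.1 x.2) =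
        (fun x : ℝ × ℝ => sphMean y f x.1 x.2) + fun x : ℝ × ℝ => sphMean y g x.1 x.2 :=
      funext fun x => sphMean_add hn hy hf.continuous hg.continuous x
    have h2 : sphMeanDeriv y (f + g) = sphMeanDeriv y f + sphMeanDeriv y g := by
      ext x
      rw [sphMeanDeriv, partialSnd, h1,
        fderiv_add ((contDiff_sphMean hn hy hf).differentiable hk0 x)
          ((contDiff_sphMean hn hy hg).differentiable hk0 x)]
      rfl
    change sourceValue k y (f + g) = sourceValue k y f + sourceValue k y g
    rw [sourceValue_eq hk hn hy (f := f + g) (hf.add hg), sourceValue_eq hk hn hy hf,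
      sourceValue_eq hk hn hy hg, h1, h2, weightedAxis_add, weightedAxis_add,
      iteratedDeriv_add (contDiffAt_weightedAxis k (contDiff_sphMean hn hy hf) ha)
        (contDiffAt_weightedAxis k (contDiff_sphMean hn hy hg) ha),
      iteratedDeriv_add (contDiffAt_weightedAxis k (contDiff_sphMeanDeriv hk hn hy hf) ha)
        (contDiffAt_weightedAxis k (contDiff_sphMeanDeriv hk hn hy hg) ha)]
    ring
  map_smul' := fun c ⟨f, hf⟩ => by
    have hf : ContDiff ℝ k f := hf
    have hk0 : ((k : ℕ) : WithTop ℕ∞) ≠ 0 := by exact_mod_cast (by omega : k ≠ 0)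
    have h1 : (fun x : ℝ × ℝ => sphMean y (c • f) x.1 x.2) =
        fun x : ℝ × ℝ => c * sphMean y f x.1 x.2 := funext fun x => sphMean_smul y c f x
    have h2 : sphMeanDeriv y (c • f) = fun x => c * sphMeanDeriv y f x := by
      ext x
      rw [sphMeanDeriv, partialSnd, h1,
        fderiv_const_mul ((contDiff_sphMean hn hy hf).differentiable hk0 x)]
      rfl
    change sourceValue k y (c • f) = c • sourceValue k y f
    rw [sourceValue_eq hk hn hy (f := c • f) (hf.const_smul c), sourceValue_eq hk hn hy hf,
      h1, h2, weightedAxis_const_mul, weightedAxis_const_mul, iteratedDeriv_const_mul_field,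
      iteratedDeriv_const_mul_field, smul_eq_mul]
    ring

/-- Leibniz's rule for the weight and the Faà di Bruno bound for s ↦ (√s, 0). The point is that C
depends on k, N, s only, and that h is controlled at a single point. -/
theorem exists_norm_iteratedDeriv_weightedAxis_le (k N : ℕ) {s : ℝ} (hs : 0 < s) :
    ∃ C : ℝ, 0 ≤ C ∧ ∀ (h : ℝ × ℝ → ℂ) (M : ℝ), ContDiff ℝ N h → 0 ≤ M →
      (∀ i ≤ N, ‖iteratedFDeriv ℝ i h (√s, 0)‖ ≤ M) →
      ‖iteratedDeriv N (weightedAxis k h) s‖ ≤ C * M := by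
  set U : Set ℝ := Set.Ioi 0 with hU
  have hUu : UniqueDiffOn ℝ U := uniqueDiffOn_Ioi 0
  set q : ℝ → ℝ × ℝ := fun s => (√s, 0) with hq
  set p : ℝ → ℂ := fun s => ((√s ^ (2 * k - 1) : ℝ) : ℂ) with hp
  have hsq : ContDiffOn ℝ N (fun s : ℝ => √s) U := fun x hx =>
    (contDiffAt_id.sqrt (ne_of_gt hx)).contDiffWithinAt
  have hqc : ContDiffOn ℝ N q U := hsq.prodMk contDiffOn_const
  have hpc : ContDiffOn ℝ N p U := Complex.ofRealCLM.contDiff.comp_contDiffOn (hsq.pow _)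
  -- The composition estimate requires the i-th derivative of q to be at most Dⁱ; the summand 1
  -- ensures D ≤ Dⁱ for i ≥ 1.
  set D : ℝ := 1 + ∑ i ∈ Finset.range (N + 1), ‖iteratedFDerivWithin ℝ i q U s‖ with hD
  have hD1 : 1 ≤ D := le_add_of_nonneg_right (Finset.sum_nonneg fun _ _ => norm_nonneg _)
  refine ⟨∑ i ∈ Finset.range (N + 1), (N.choose i : ℝ) * ‖iteratedFDerivWithin ℝ i p U s‖ *
    (N.factorial * D ^ N), by positivity, fun h M hh hM hb => ?_⟩
  have hcomp : ∀ j ≤ N, ‖iteratedFDerivWithin ℝ j (h ∘ q) U s‖ ≤ N.factorial * D ^ N * M := by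
    intro j hj
    have h1 := norm_iteratedFDerivWithin_comp_le (C := M) (D := D) (n := j)
      (contDiffOn_univ.2 hh) hqc (by exact_mod_cast hj) uniqueDiffOn_univ hUu
      (Set.mapsTo_univ _ _) (show s ∈ U from hs)
      (fun i hi => by rw [iteratedFDerivWithin_univ]; exact hb i (hi.trans hj))
      (fun i hi hij => by
        refine le_trans ?_ (le_self_pow₀ hD1 (by omega))
        refine le_trans ?_ (le_add_of_nonneg_left zero_le_one)
        exact Finset.single_le_sum (f := fun i => ‖iteratedFDerivWithin ℝ i q U s‖)
          (fun _ _ => norm_nonneg _) (Finset.mem_range.2 (by omega)))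
    refine h1.trans ?_
    have h2 : (j.factorial : ℝ) ≤ N.factorial := by exact_mod_cast Nat.factorial_le hj
    have h3 : D ^ j ≤ D ^ N := pow_le_pow_right₀ hD1 hj
    calc (j.factorial : ℝ) * M * D ^ j ≤ N.factorial * M * D ^ N := by gcongr
      _ = _ := by ring
  rw [← norm_iteratedFDeriv_eq_norm_iteratedDeriv,
    ← iteratedFDerivWithin_of_isOpen N isOpen_Ioi (show s ∈ U from hs)]
  have hhq : ContDiffOn ℝ N (h ∘ q) U := hh.comp_contDiffOn hqc
  refine (norm_iteratedFDerivWithin_mul_le hpc hhq hUu (show s ∈ U from hs) le_rfl).trans ?_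
  rw [Finset.sum_mul]
  refine Finset.sum_le_sum fun i _ => ?_
  rw [mul_assoc _ _ M]
  exact mul_le_mul_of_nonneg_left (hcomp _ (Nat.sub_le _ _)) (by positivity)

theorem isBoundedFunctional_sourceFunctional {k : ℕ} (hk : 1 ≤ k) (hn : n = 2 * k + 2)
    {y : RSpace n} (hy : y ≠ 0) : IsBoundedFunctional (sourceFunctional hk hn hy) := by
  have ha : 0 < ‖y‖ := norm_pos_iff.2 hy
  obtain ⟨C₁, hC₁, h₁⟩ := exists_norm_iteratedDeriv_weightedAxis_le k k
    (show 0 < ‖y‖ ^ 2 by positivity)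
  obtain ⟨C₂, hC₂, h₂⟩ := exists_norm_iteratedDeriv_weightedAxis_le k (k - 1)
    (show 0 < ‖y‖ ^ 2 by positivity)
  set c : ℂ := ((‖y‖ * √Real.pi / Real.Gamma (k + 1 / 2) : ℝ) : ℂ) with hc
  set d : ℂ := Complex.I / (2 * ‖y‖) with hd
  -- Only derivatives of f at the ring points aσ, of norm a, are needed. The factor 2^k comes from
  -- `norm_cylMap_le`.
  refine ⟨Metric.closedBall 0 ‖y‖, ‖c‖ * (C₁ + ‖d‖ * C₂) * 2 ^ k, isCompact_closedBall _ _,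
    fun f M hM hb => ?_⟩
  have hf : ContDiff ℝ k (f : RSpace n → ℂ) := f.2
  have hm : ∀ i ≤ k, ‖iteratedFDeriv ℝ i (fun x : ℝ × ℝ => sphMean y f x.1 x.2)
      (√(‖y‖ ^ 2), 0)‖ ≤ M * 2 ^ k := fun i hi => by
    refine (norm_iteratedFDeriv_sphMean_le hn hy hf hi _ fun σ => hb i hi _ ?_).trans ?_
    · rw [mem_closedBall_zero_iff, ← sq_le_sq₀ (norm_nonneg _) ha.le, norm_cylMap_apply_sq hy,
        Real.sqrt_sq ha.le]
      simp
    · gcongr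
      norm_num
  have hm' : ∀ i ≤ k - 1, ‖iteratedFDeriv ℝ i (sphMeanDeriv y f) (√(‖y‖ ^ 2), 0)‖ ≤
      M * 2 ^ k := fun i hi => by
    have hD : ContDiff ℝ (k - 1 : ℕ) (fderiv ℝ fun x : ℝ × ℝ => sphMean y f x.1 x.2) :=
      (contDiff_sphMean hn hy hf).fderiv_right (by exact_mod_cast (by omega : k - 1 + 1 ≤ k))
    refine (norm_iteratedFDeriv_clm_apply_const hD.contDiffAt (by exact_mod_cast hi)).trans ?_
    rw [norm_iteratedFDeriv_fderiv]
    refine le_trans ?_ (hm (i + 1) (by omega))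
    simp
  have b₁ := h₁ _ _ (contDiff_sphMean hn hy hf) (by positivity) hm
  have b₂ := h₂ _ _ (contDiff_sphMeanDeriv hk hn hy hf) (by positivity) hm'
  change ‖sourceValue k y f‖ ≤ _
  rw [sourceValue_eq hk hn hy hf, norm_mul]
  calc _ ≤ ‖c‖ * (C₁ * (M * 2 ^ k) + ‖d‖ * (C₂ * (M * 2 ^ k))) := by
        refine mul_le_mul_of_nonneg_left ((norm_sub_le _ _).trans (add_le_add b₁ ?_))
          (norm_nonneg _)
        rw [norm_mul]
        exact mul_le_mul_of_nonneg_left b₂ (norm_nonneg _)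
    _ = _ := by ring

theorem sourceFunctional_formula {k : ℕ} (hk : 1 ≤ k) (hn : n = 2 * k + 2) {y : RSpace n}
    (hy : y ≠ 0) {f : RSpace n → ℂ} (hf : ContDiff ℝ k f) :
    ContDiffAt ℝ (k - 1 : ℕ) (cylF k y f) ‖y‖ ∧
      DifferentiableAt ℝ (Drho^[k - 1] (cylF k y f)) ‖y‖ ∧
      sourceValue k y f = ((‖y‖ * √Real.pi / Real.Gamma (k + 1 / 2) : ℝ) : ℂ) *
        (Drho^[k] (cylF k y f)) ‖y‖ := by
  have ha : 0 < ‖y‖ := norm_pos_iff.2 hy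
  have hF : ∀ ρ : ℝ, 0 < ρ → cylF k y f ρ = cylFSq k y f (ρ ^ 2) := fun ρ hρ =>
    cylF_eq_cylFSq hk hn hy hf hρ
  have hD : ∀ ρ : ℝ, 0 < ρ → Drho^[k - 1] (cylF k y f) ρ =
      iteratedDeriv (k - 1) (cylFSq k y f) (ρ ^ 2) := fun ρ hρ =>
    Drho_iterate_eq hF (fun s hs => contDiffAt_cylFSq hk hn hy hf hs) (k - 1) le_rfl ρ hρ
  have hlast := hasDerivAt_iteratedDeriv_cylFSq hk hn hy hf
  refine ⟨?_, ?_, ?_⟩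
  · refine ContDiffAt.congr_of_eventuallyEq (f := cylFSq k y f ∘ fun ρ : ℝ => ρ ^ 2) ?_ ?_
    · exact (contDiffAt_cylFSq hk hn hy hf (by positivity)).comp _ (contDiffAt_id.pow 2)
    · filter_upwards [Ioi_mem_nhds ha] with ρ hρ using hF ρ hρ
  · refine (hasDerivAt_comp_sq hlast).differentiableAt.congr_of_eventuallyEq ?_
    filter_upwards [Ioi_mem_nhds ha] with ρ hρ using hD ρ hρ
  · rw [sourceValue_eq hk hn hy hf]
    have hk' : k = (k - 1) + 1 := by omega
    conv_rhs => rw [hk', Function.iterate_succ_apply', ← hk']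
    rw [Drho_eq_of_hasDerivAt ha hD hlast]

end Functional

/-! ### Uniqueness by density -/

section Uniqueness

variable {n : ℕ}

theorem norm_iteratedFDeriv_sub_le_of_le_one {E F : Type*} [NormedAddCommGroup E]
    [NormedSpace ℝ E] [NormedAddCommGroup F] [NormedSpace ℝ F] {f g : E → F}
    (hf : Differentiable ℝ f) (hg : Differentiable ℝ g) {x : E} {M : ℝ}
    (h0 : ‖f x - g x‖ ≤ M) (h1 : ‖fderiv ℝ f x - fderiv ℝ g x‖ ≤ M) {j : ℕ} (hj : j ≤ 1) :
    ‖iteratedFDeriv ℝ j (f - g) x‖ ≤ M := by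
  interval_cases j
  · simpa using h0
  · rw [← norm_iteratedFDeriv_fderiv, norm_iteratedFDeriv_zero, fderiv_sub (hf x) (hg x)]
    exact h1

/-- Uniform approximation in `C¹` of compactly supported functions by smooth ones. -/
theorem exists_contDiff_two_approx {f : RSpace n → ℂ} (hf : ContDiff ℝ 1 f)
    (hfs : HasCompactSupport f) {M : ℝ} (hM : 0 < M) :
    ∃ g : RSpace n → ℂ, ContDiff ℝ 2 g ∧ HasCompactSupport g ∧
      ∀ j ≤ 1, ∀ x, ‖iteratedFDeriv ℝ j (f - g) x‖ ≤ M := by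
  have hdf : Continuous (fderiv ℝ f) := hf.continuous_fderiv one_ne_zero
  obtain ⟨δ₁, hδ₁, h₁⟩ := Metric.uniformContinuous_iff.1
    (hfs.uniformContinuous_of_continuous hf.continuous) M hM
  obtain ⟨δ₂, hδ₂, h₂⟩ := Metric.uniformContinuous_iff.1
    ((hfs.fderiv ℝ).uniformContinuous_of_continuous hdf) M hM
  have hδ : 0 < min δ₁ δ₂ := lt_min hδ₁ hδ₂
  -- One radius serves both f and f', since differentiating the convolution puts the derivative on
  -- f.
  let φ : ContDiffBump (0 : RSpace n) := ⟨min δ₁ δ₂ / 2, min δ₁ δ₂, by positivity, by linarith⟩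
  set g : RSpace n → ℂ :=
    convolution (φ.normed volume) f (ContinuousLinearMap.lsmul ℝ ℝ) volume with hg
  have hgd : ∀ x, HasFDerivAt g (convolution (φ.normed volume) (fderiv ℝ f)
      (ContinuousLinearMap.lsmul ℝ ℝ) volume x) x := fun x =>
    hfs.hasFDerivAt_convolution_right _ φ.continuous_normed.locallyIntegrable hf x
  refine ⟨g, φ.hasCompactSupport_normed.contDiff_convolution_left _ φ.contDiff_normed
    hf.continuous.locallyIntegrable, φ.hasCompactSupport_normed.convolution _ hfs,
    fun j hj x => norm_iteratedFDeriv_sub_le_of_le_one (hf.differentiable one_ne_zero)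
      (fun x => (hgd x).differentiableAt) ?_ ?_ hj⟩
  · rw [← dist_eq_norm, dist_comm]
    exact ContDiffBump.dist_normed_convolution_le hf.continuous.aestronglyMeasurable
      fun z hz => (h₁ (lt_of_lt_of_le hz (min_le_left _ _))).le
  · rw [(hgd x).fderiv, ← dist_eq_norm, dist_comm]
    exact ContDiffBump.dist_normed_convolution_le hdf.aestronglyMeasurable
      fun z hz => (h₂ (lt_of_lt_of_le hz (min_le_right _ _))).le

theorem IsBoundedFunctional.sub {k : ℕ} {L L' : CkFun n k →ₗ[ℂ] ℂ} (hL : IsBoundedFunctional L)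
    (hL' : IsBoundedFunctional L') : IsBoundedFunctional (L - L') := by
  obtain ⟨K, C, hK, h⟩ := hL
  obtain ⟨K', C', hK', h'⟩ := hL'
  refine ⟨K ∪ K', C + C', hK.union hK', fun f M hM hf => ?_⟩
  rw [LinearMap.sub_apply, add_mul]
  exact (norm_sub_le _ _).trans (add_le_add
    (h f M hM fun j hj x hx => hf j hj x (Or.inl hx))
    (h' f M hM fun j hj x hx => hf j hj x (Or.inr hx)))

/-- A bounded functional on `C^k` vanishing on compactly supported `C^k ∩ C²` functions is zero. -/
theorem IsBoundedFunctional.eq_zero {k : ℕ} (hk : 1 ≤ k) {L : CkFun n k →ₗ[ℂ] ℂ}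
    (hL : IsBoundedFunctional L) (h0 : ∀ f : CkFun n k, ContDiff ℝ 2 (f : RSpace n → ℂ) →
      HasCompactSupport (f : RSpace n → ℂ) → L f = 0) : L = 0 := by
  obtain ⟨K, C, hK, hb⟩ := hL
  have hcs : ∀ f : CkFun n k, HasCompactSupport (f : RSpace n → ℂ) → L f = 0 := by
    intro f hfs
    have hf : ContDiff ℝ k (f : RSpace n → ℂ) := f.2
    -- For k ≥ 2 every C^k function is C². Only k = 1 needs smoothing, and there C¹ closeness is all
    -- that boundedness asks for.
    rcases hk.eq_or_lt with rfl | hk2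
    · have hle : ∀ M : ℝ, 0 < M → ‖L f‖ ≤ C * M := fun M hM => by
        obtain ⟨g, hg, hgs, happ⟩ := exists_contDiff_two_approx
          (by exact_mod_cast hf) hfs hM
        let G : CkFun n 1 := ⟨g, by exact_mod_cast hg.of_le one_le_two⟩
        have h1 := hb (f - G) M hM.le fun j hj x _ => happ j hj x
        rwa [map_sub, h0 G hg hgs, sub_zero] at h1
      have hlim : Tendsto (fun M : ℝ => C * M) (𝓝[>] 0) (𝓝 0) := by
        have : Tendsto (fun M : ℝ => C * M) (𝓝 0) (𝓝 (C * 0)) :=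
          (continuous_const.mul continuous_id).tendsto 0
        rw [mul_zero] at this
        exact this.mono_left nhdsWithin_le_nhds
      refine norm_le_zero_iff.1 (ge_of_tendsto hlim ?_)
      filter_upwards [self_mem_nhdsWithin] with M hM using hle M hM
    · exact h0 f (hf.of_le (by exact_mod_cast hk2)) hfs
  ext f
  have hf : ContDiff ℝ k (f : RSpace n → ℂ) := f.2
  obtain ⟨R, hR⟩ := hK.isBounded.subset_closedBall 0
  -- χ = 1 on a neighbourhood of K, so f - χf has zero derivatives on K and the bound with M = 0
  -- kills it. The absolute value covers a negative R.
  let χ : ContDiffBump (0 : RSpace n) := ⟨|R| + 1, |R| + 2, by positivity, by linarith⟩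
  have hχ : ContDiff ℝ k fun x => (χ x : ℂ) := Complex.ofRealCLM.contDiff.comp χ.contDiff
  let G : CkFun n k := ⟨fun x => (χ x : ℂ) * (f : RSpace n → ℂ) x, hχ.mul hf⟩
  have hGs : HasCompactSupport (G : RSpace n → ℂ) :=
    (χ.hasCompactSupport.comp_left (g := fun r : ℝ => (r : ℂ)) Complex.ofReal_zero).mul_right
  have h1 := hb (f - G) 0 le_rfl fun j _ x hx => by
    have hx' : x ∈ Metric.ball (0 : RSpace n) (|R| + 1) := by
      have := hR hx
      rw [mem_closedBall_zero_iff] at this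
      rw [mem_ball_zero_iff]
      linarith [le_abs_self R]
    have hev : ((f - G : CkFun n k) : RSpace n → ℂ) =ᶠ[𝓝 x] fun _ => 0 := by
      filter_upwards [Metric.isOpen_ball.mem_nhds hx'] with z hz
      have : χ z = 1 := χ.one_of_mem_closedBall (Metric.ball_subset_closedBall hz)
      change (f : RSpace n → ℂ) z - (χ z : ℂ) * (f : RSpace n → ℂ) z = 0
      rw [this]
      simp
    rw [(hev.iteratedFDeriv ℝ j).eq_of_nhds]
    simp [show (fun _ : RSpace n => (0 : ℂ)) = 0 from rfl]
  rw [map_sub, hcs G hGs, sub_zero, mul_zero] at h1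
  simpa using h1

end Uniqueness

/-! ### Existence, uniqueness and the formula -/

theorem theorem4 {n k : ℕ} (hk : 1 ≤ k) (hn : n = 2 * k + 2) (y : RSpace n) (hy : y ≠ 0) :
    ∃ L : CkFun n k →ₗ[ℂ] ℂ,
      IsSourceDistribution y L ∧
      (∀ L' : CkFun n k →ₗ[ℂ] ℂ, IsSourceDistribution y L' → L' = L) ∧
      ∀ f : CkFun n k,
        (∀ ρ : ℝ, DifferentiableAt ℝ (fun ζ : ℝ => sphMean y (f : RSpace n → ℂ) ρ ζ) 0) ∧
        ContDiffAt ℝ ((k - 1 : ℕ) : WithTop ℕ∞) (cylF k y (f : RSpace n → ℂ)) ‖y‖ ∧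
        DifferentiableAt ℝ (Drho^[k - 1] (cylF k y (f : RSpace n → ℂ))) ‖y‖ ∧
        L f =
          (((‖y‖ * Real.sqrt Real.pi / Real.Gamma ((k : ℝ) + 1 / 2)) : ℝ) : ℂ) *
            (Drho^[k] (cylF k y (f : RSpace n → ℂ))) ‖y‖ := by
  have hb := isBoundedFunctional_sourceFunctional hk hn hy
  have hlim : ∀ f : CkFun n k, ContDiff ℝ 2 (f : RSpace n → ℂ) →
      HasCompactSupport (f : RSpace n → ℂ) →
      Tendsto (fun ε : ℝ => regSource y ε (f : RSpace n → ℂ)) (𝓝[>] 0)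
        (𝓝 (sourceFunctional hk hn hy f)) := fun f hf hfs =>
    tendsto_regSource hk hn hy hf f.2 hfs
  refine ⟨sourceFunctional hk hn hy, ⟨hb, hlim⟩, fun L' hL' => ?_, fun f =>
    ⟨fun ρ => (hasDerivAt_sphMean hk hn hy f.2 ρ 0).differentiableAt,
      sourceFunctional_formula hk hn hy f.2⟩⟩
  refine sub_eq_zero.1 ((hL'.1.sub hb).eq_zero hk fun f hf hfs => ?_)
  rw [LinearMap.sub_apply, sub_eq_zero]
  exact tendsto_nhds_unique (hL'.2 f hf hfs) (hlim f hf hfs)
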